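/- Let $\Omega\subset\mathbb R^2$ be a bounded open set with smooth boundary and let $0<T<\infty$. Let $\nu_n>0$ with $\nu_n\to 0$. Let $f_n\in H^1(\Omega;\mathbb R^2)$ be (time-independent) forces that are bounded in $H^1(\Omega)$ uniformly in $n$ and converge weakly in $H^1(\Omega)$ to $f$. For each $n$ let $u_n$ be a strong solution on $[0,T]$ of the Navier–Stokes equations $$\partial_t u_n-\nu_n\Delta u_n+u_n\cdot\nabla u_n+\nabla p_n=f_n,\qquad \nabla\cdot u_n=0\ \text{ in }\Omega,\qquad u_n|_{\partial\Omega}=0,$$ that is, $u_n\in C([0,T];L^2(\Omega))\cap L^\infty(0,T;H^1_0(\Omega))\cap L^2(0,T;H^2(\Omega))$, $\partial_tu_n\in L^2(0,T;L^2(\Omega))$, $p_n\in L^2(0,T;H^1(\Omega))$, and the equations hold almost everywhere in $(0,T)\times\Omega$. Assume that the initial data $u_n(0)$ are divergence-free and bounded in $H^1_0(\Omega)$ uniformly in $n$. Let $\omega_n=\partial_1u_{n,2}-\partial_2u_{n,1}$, and assume that for every compact $K\subset\Omega$ there is a constant $\mathcal E_K$, independent of $n$, with $$\sup_{0\le t\le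 T}\int_K|\omega_n(x,t)|^2\,dx\le\mathcal E_K\qquad\text{for all } n$$ (the supremum being the essential supremum in $t$). Let $u_\infty$ be the weak limit in $L^2(0,T;L^2(\Omega))$ of the sequence $u_n$ or of a subsequence. Then: 1. $u_\infty$ is a weak solution of the Euler equations with force $f$: it belongs to $L^2(0,T;L^2(\Omega))$, it is divergence-free in the sense of distributions, and $$\int_0^T\!\!\int_\Omega\big(u_\infty\cdot\partial_t\Phi+(u_\infty\otimes u_\infty):\nabla\Phi+f\cdot\Phi\big)\,dx\,dt=0$$ for every divergence-free $\Phi\in C_0^\infty((0,T)\times\Omega;\mathbb R^2)$. 2. $u_\infty$ has bounded energy: $u_\infty\in L^\infty(0,T;L^2(\Omega))$. 3. The distributional vorticity $\omega_\infty=\partial_1u_{\infty,2}-\partial_2u_{\infty,1}$ on $(0,T)\times\Omega$ is a locally integrable function, $\omega_\infty u_\infty$ is locally integrable, and $\partial_t\omega_\infty+u_\infty\cdot\nabla\omega_\infty=g$ with $g=\partial_1f_2-\partial_2f_1$ in the sense of distributions: $$\int_0^T\!\!\int_\Omega\big(\omega_\infty\,\partial_t\varphi+\omega_\infty\,u_\infty\cdot\nabla\varphi+g\,\varphi\big)\,dx\,dt=0\qquad\text{for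 all }\varphi\in C_0^\infty((0,T)\times\Omega).$$ 4. $\omega_\infty$ has a representative such that for every compact $K\subset\Omega$ there is a constant $\widetilde{\mathcal E}_K$ with $$\sup_{t\in[0,T]}\int_K|\omega_\infty(x,t)|^2\,dx\le\widetilde{\mathcal E}_K.$$ -/

import Mathlib

open MeasureTheory Set Filter Topology
open scoped ContDiff NNReal ENNReal

noncomputable section

/-- The Euclidean plane `ℝ²`. -/
abbrev Plane : Type := EuclideanSpace ℝ (Fin 2)

/-- The standard basis vectors of the plane. -/
def planeBasis (i : Fin 2) : Plane := EuclideanSpace.single i (1 : ℝ)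

/-- The space-time cylinder `(0,T) × Ω`. -/
def spaceTime (T : ℝ) (Ω : Set Plane) : Set (ℝ × Plane) := Ioo 0 T ×ˢ Ω

/-- `Ω` has a smooth boundary: near each boundary point it is the sublevel set `{ρ < 0}` of a
smooth function without critical points. -/
def HasSmoothBoundary (Ω : Set Plane) : Prop :=
  ∀ a ∈ frontier Ω, ∃ (U : Set Plane) (ρ : Plane → ℝ), IsOpen U ∧ a ∈ U ∧
    ContDiffOn ℝ ∞ ρ U ∧ (∀ x ∈ U, fderiv ℝ ρ x ≠ 0) ∧ Ω ∩ U = {x ∈ U | ρ x < 0}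

section General

variable {X F : Type*} [NormedAddCommGroup X] [NormedSpace ℝ X]
  [NormedAddCommGroup F] [NormedSpace ℝ F]

/-- `φ ∈ C_c^∞(U)`. -/
def IsTestFunction (U : Set X) (φ : X → F) : Prop :=
  ContDiff ℝ ∞ φ ∧ HasCompactSupport φ ∧ tsupport φ ⊆ U

/-- On the open set `U`, the locally integrable function `w` is the weak (distributional)
derivative of the locally integrable function `v` in the direction `h`. -/
def HasWeakDeriv [MeasureSpace X] (U : Set X) (h : X) (v w : X → F) : Prop :=
  LocallyIntegrableOn v U ∧ LocallyIntegrableOn w U ∧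
    ∀ φ : X → ℝ, IsTestFunction U φ →
      ∫ x in U, (fderiv ℝ φ x h) • v x = - ∫ x in U, φ x • w x

end General

/-- Weak convergence in `L²(U; ℝ²)`, all functions being in `L²`. -/
def WeakTendstoL2 {X : Type*} [MeasureSpace X] (U : Set X) (v : ℕ → X → Plane)
    (w : X → Plane) : Prop :=
  (∀ n, MemLp (v n) 2 (volume.restrict U)) ∧ MemLp w 2 (volume.restrict U) ∧
    ∀ g : X → Plane, MemLp g 2 (volume.restrict U) →
      Tendsto (fun n => ∫ x in U, inner ℝ (v n x) (g x)) atTop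
        (𝓝 (∫ x in U, inner ℝ (w x) (g x)))

/-- `v ∈ H¹(Ω; ℝ²)`, with weak partial derivatives `Dv i = ∂ᵢ v`. -/
def MemH1 (Ω : Set Plane) (v : Plane → Plane) (Dv : Fin 2 → Plane → Plane) : Prop :=
  MemLp v 2 (volume.restrict Ω) ∧
    ∀ i, MemLp (Dv i) 2 (volume.restrict Ω) ∧ HasWeakDeriv Ω (planeBasis i) v (Dv i)

/-- `‖v‖²` in `H¹(Ω; ℝ²)`, where `Dv i = ∂ᵢ v`. -/
def h1NormSq (Ω : Set Plane) (v : Plane → Plane) (Dv : Fin 2 → Plane → Plane) : ℝ≥0∞ :=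
  eLpNorm v 2 (volume.restrict Ω) ^ 2 + ∑ i, eLpNorm (Dv i) 2 (volume.restrict Ω) ^ 2

/-- `v ∈ H¹₀(Ω; ℝ²)`, the closure of `C_c^∞(Ω; ℝ²)` in `H¹(Ω; ℝ²)`; `Dv i = ∂ᵢ v`. -/
def MemH10 (Ω : Set Plane) (v : Plane → Plane) (Dv : Fin 2 → Plane → Plane) : Prop :=
  MemH1 Ω v Dv ∧ ∃ φ : ℕ → Plane → Plane, (∀ k, IsTestFunction Ω (φ k)) ∧
    Tendsto (fun k => h1NormSq Ω (fun x => φ k x - v x)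
      (fun i x => fderiv ℝ (φ k) x (planeBasis i) - Dv i x)) atTop (𝓝 0)

/-- Weak convergence in `H¹(Ω; ℝ²)`: the bounded linear functionals on `H¹` are precisely
`v ↦ ∫ v · g + ∑ᵢ ∫ ∂ᵢ v · Gᵢ` with `g, G₁, G₂ ∈ L²`. -/
def WeakTendstoH1 (Ω : Set Plane) (v : ℕ → Plane → Plane) (Dv : ℕ → Fin 2 → Plane → Plane)
    (w : Plane → Plane) (Dw : Fin 2 → Plane → Plane) : Prop :=
  (∀ n, MemH1 Ω (v n) (Dv n)) ∧ MemH1 Ω w Dw ∧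
    WeakTendstoL2 Ω v w ∧ ∀ i, WeakTendstoL2 Ω (fun n => Dv n i) (Dw i)

/-- `u` is a strong solution on `[0,T]` of the Navier–Stokes equations
`∂ₜu - νΔu + (u·∇)u + ∇p = f`, `∇·u = 0` in `Ω`, `u = 0` on `∂Ω`, with time-independent force:
`u ∈ C([0,T]; L²) ∩ L^∞(0,T; H¹₀) ∩ L²(0,T; H²)`, `∂ₜu ∈ L²(0,T; L²)`, `p ∈ L²(0,T; H¹)`, and the
equations hold almost everywhere. Here `Du i = ∂ᵢu`, `D2u i j = ∂ⱼ∂ᵢu`, `Dp i = ∂ᵢp`. The initial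
velocity is `u 0`. -/
structure IsStrongNavierStokes (Ω : Set Plane) (T ν : ℝ) (f : Plane → Plane)
    (u : ℝ → Plane → Plane) : Prop where
  memLp_slice : ∀ t ∈ Icc 0 T, MemLp (u t) 2 (volume.restrict Ω)
  continuous_time : ∀ t ∈ Icc 0 T,
    Tendsto (fun s => eLpNorm (fun x => u s x - u t x) 2 (volume.restrict Ω))
      (𝓝[Icc 0 T] t) (𝓝 0)
  memLp : MemLp (fun z : ℝ × Plane => u z.1 z.2) 2 (volume.restrict (spaceTime T Ω))
  equation : ∃ (ut : ℝ → Plane → Plane) (Du : Fin 2 → ℝ → Plane → Plane)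
      (D2u : Fin 2 → Fin 2 → ℝ → Plane → Plane) (p : ℝ → Plane → ℝ)
      (Dp : Fin 2 → ℝ → Plane → ℝ),
    -- `∂ₜu ∈ L²(0,T; L²)`
    MemLp (fun z : ℝ × Plane => ut z.1 z.2) 2 (volume.restrict (spaceTime T Ω)) ∧
    HasWeakDeriv (spaceTime T Ω) ((1 : ℝ), (0 : Plane)) (fun z => u z.1 z.2)
      (fun z => ut z.1 z.2) ∧
    -- `u ∈ L^∞(0,T; H¹₀)`
    (∀ i, MemLp (fun z : ℝ × Plane => Du i z.1 z.2) 2 (volume.restrict (spaceTime T Ω))) ∧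
    (∀ᵐ t ∂volume.restrict (Ioo 0 T), MemH10 Ω (u t) (fun i => Du i t)) ∧
    (∃ C : ℝ≥0, ∀ᵐ t ∂volume.restrict (Ioo 0 T), h1NormSq Ω (u t) (fun i => Du i t) ≤ C) ∧
    -- `u ∈ L²(0,T; H²)`
    (∀ i j, MemLp (fun z : ℝ × Plane => D2u i j z.1 z.2) 2
      (volume.restrict (spaceTime T Ω))) ∧
    (∀ᵐ t ∂volume.restrict (Ioo 0 T),
      ∀ i j, HasWeakDeriv Ω (planeBasis j) (Du i t) (D2u i j t)) ∧
    -- `p ∈ L²(0,T; H¹)`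
    MemLp (fun z : ℝ × Plane => p z.1 z.2) 2 (volume.restrict (spaceTime T Ω)) ∧
    (∀ i, MemLp (fun z : ℝ × Plane => Dp i z.1 z.2) 2 (volume.restrict (spaceTime T Ω))) ∧
    (∀ᵐ t ∂volume.restrict (Ioo 0 T),
      ∀ i, HasWeakDeriv Ω (planeBasis i) (p t) (Dp i t)) ∧
    -- the equations
    (∀ᵐ z ∂volume.restrict (spaceTime T Ω), ∑ i, Du i z.1 z.2 i = 0) ∧
    (∀ᵐ z ∂volume.restrict (spaceTime T Ω), ∀ j,
      ut z.1 z.2 j - ν * ∑ i, D2u i i z.1 z.2 j + ∑ i, u z.1 z.2 i * Du i z.1 z.2 j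
        + Dp j z.1 z.2 = f z.2 j)

/-- `om` is the vorticity `∂₁u₂ - ∂₂u₁` of `u` in the sense of distributions on `(0,T) × Ω`. -/
def IsVorticity (Ω : Set Plane) (T : ℝ) (u : ℝ → Plane → Plane) (om : ℝ → Plane → ℝ) : Prop :=
  LocallyIntegrableOn (fun z : ℝ × Plane => om z.1 z.2) (spaceTime T Ω) ∧
    ∀ φ : ℝ × Plane → ℝ, IsTestFunction (spaceTime T Ω) φ →
      ∫ z in spaceTime T Ω, φ z * om z.1 z.2 =
        - ∫ z in spaceTime T Ω, (fderiv ℝ φ z (0, planeBasis 0) * u z.1 z.2 1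
            - fderiv ℝ φ z (0, planeBasis 1) * u z.1 z.2 0)

/-- `u ∈ L²(0,T; L²(Ω))` is a weak solution of the Euler equations
`∂ₜu + u·∇u + ∇p = f`, `∇·u = 0` on `(0,T) × Ω`: it is divergence-free in the sense of
distributions, and `(u, ∂ₜΦ) + (u ⊗ u : ∇Φ) + (f, Φ) = 0` for all divergence-free test fields. -/
def IsWeakEuler (Ω : Set Plane) (T : ℝ) (f : Plane → Plane) (u : ℝ → Plane → Plane) : Prop :=
  MemLp (fun z : ℝ × Plane => u z.1 z.2) 2 (volume.restrict (spaceTime T Ω)) ∧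
  (∀ φ : ℝ × Plane → ℝ, IsTestFunction (spaceTime T Ω) φ →
    ∫ z in spaceTime T Ω, fderiv ℝ φ z (0, u z.1 z.2) = 0) ∧
  ∀ Φ : ℝ × Plane → Plane, IsTestFunction (spaceTime T Ω) Φ →
    (∀ z, ∑ i, fderiv ℝ Φ z (0, planeBasis i) i = 0) →
    ∫ z in spaceTime T Ω, (inner ℝ (u z.1 z.2) (fderiv ℝ Φ z (1, 0))
      + inner ℝ (u z.1 z.2) (fderiv ℝ Φ z (0, u z.1 z.2))
      + inner ℝ (f z.2) (Φ z)) = 0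

/-- The vorticity equation `∂ₜω + u·∇ω = g`, with `om` for `ω`, in the sense of distributions on
`(0,T) × Ω`, for divergence-free `u`: the product `ωu` is locally integrable, and
`∫∫ (ω ∂ₜφ + ω u·∇φ + g φ) = 0` for all test functions `φ`. -/
def IsWeakEulerVorticity (Ω : Set Plane) (T : ℝ) (g : Plane → ℝ) (u : ℝ → Plane → Plane)
    (om : ℝ → Plane → ℝ) : Prop :=
  LocallyIntegrableOn (fun z : ℝ × Plane => om z.1 z.2) (spaceTime T Ω) ∧
  LocallyIntegrableOn (fun z : ℝ × Plane => om z.1 z.2 • u z.1 z.2) (spaceTime T Ω) ∧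
  ∀ φ : ℝ × Plane → ℝ, IsTestFunction (spaceTime T Ω) φ →
    ∫ z in spaceTime T Ω, (om z.1 z.2 * fderiv ℝ φ z (1, 0)
      + om z.1 z.2 * fderiv ℝ φ z (0, u z.1 z.2) + g z.2 * φ z) = 0

end

/-! The difficulty is the quadratic term: weak convergence of the velocities does not give
convergence of `u_n ⊗ u_n`, and nothing is controlled near the boundary except the energy. Two
bounds are uniform in the viscosity: the energy, obtained by testing the equation with the solution
itself (`IsStrongNavierStokes.eLpNorm_le`), and the assumed local enstrophy.

Compactness in space. For compactly supported plane fields the integral of `|∇w|²` equals that of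
`(div w)² + (curl w)²`. Applied to `χ u_n` with a cut-off `χ`, this bounds the translation
differences in `L²` by `C‖h‖` with `C` independent of `n` (`exists_translate_bound`), so
mollification at scale `ε` costs `O(ε)` uniformly in `n`.

Compactness in time. Paired with a solenoidal test field, the equation loses its pressure and every
derivative falls on the test field. Such pairings of `u_n` are therefore Lipschitz in time uniformly
in `n`, and weak convergence improves to convergence at almost every time
(`ae_tendsto_of_lipschitz_of_weak`). The curl of the mollified velocity at a point is such a
pairing, against a rotated gradient of the mollifier.

Combination. For solenoidal `V` one has `(V·∇)V = ∇|V|²/2 + (curl V) V^⊥`, and the gradient is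
invisible to solenoidal test fields. The mollified quadratic form is thus an integral of mollified
curl, which converges strongly, against mollified velocity, which converges weakly. Removing the
mollifier at the uniform cost `O(ε)` gives `tendsto_convForm` and with it the Euler equations;
strong convergence of the velocities is never needed.

Vorticity. The enstrophy bound provides weak local limits of the vorticities, glued over a compact
exhaustion; by linearity the result is the curl of the limit velocity. The same identity for a field
with square integrable local curl (`convForm_eq_neg_integral_curl`) turns the Euler equations tested
with `∇^⊥φ` into the vorticity equation tested with `φ`. The bounds on time slices survive weak
limits by `WeakL2.slice_bound`. -/

/-! ### Strong and weak convergence in `L²` -/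

section L2Tools

variable {X Y ι : Type*} [MeasurableSpace X] [MeasurableSpace Y]

/-- Strong convergence in `L²(m)` of a sequence of real functions. -/
def L2Tendsto (m : Measure X) (a : ℕ → X → ℝ) (b : X → ℝ) : Prop :=
  (∀ n, MemLp (a n) 2 m) ∧ MemLp b 2 m ∧
    Tendsto (fun n => eLpNorm (fun x => a n x - b x) 2 m) atTop (𝓝 0)

/-- Weak convergence in `L²(m)` of real functions along a filter. -/
def WeakL2 (m : Measure X) (l : Filter ι) (a : ι → X → ℝ) (b : X → ℝ) : Prop :=
  (∀ n, MemLp (a n) 2 m) ∧ MemLp b 2 m ∧ ∀ g : X → ℝ, MemLp g 2 m →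
    Tendsto (fun n => ∫ x, a n x * g x ∂m) l (𝓝 (∫ x, b x * g x ∂m))

theorem lintegral_enorm_sq_eq {F : Type*} [NormedAddCommGroup F] (m : Measure X) (a : X → F) :
    ∫⁻ x, ‖a x‖ₑ ^ 2 ∂m = eLpNorm a 2 m ^ 2 := by
  have := eLpNorm_nnreal_pow_eq_lintegral (μ := m) (f := a) (p := 2) (by norm_num)
  have h2 : ((2 : ℝ≥0) : ℝ) = ((2 : ℕ) : ℝ) := by norm_num
  rw [h2] at this
  simp only [ENNReal.rpow_natCast] at this
  exact this.symm

theorem eLpNorm_two_le_of_lintegral_le {F : Type*} [NormedAddCommGroup F] {m : Measure X}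
    {a : X → F} {C : ℝ≥0∞} (h : ∫⁻ x, ‖a x‖ₑ ^ 2 ∂m ≤ C ^ 2) : eLpNorm a 2 m ≤ C := by
  rw [lintegral_enorm_sq_eq] at h
  exact (ENNReal.pow_le_pow_left_iff two_ne_zero).1 h

theorem ofReal_integral_sq {m : Measure X} {a : X → ℝ} (ha : MemLp a 2 m) :
    ENNReal.ofReal (∫ x, a x ^ 2 ∂m) = ∫⁻ x, ‖a x‖ₑ ^ 2 ∂m := by
  rw [ofReal_integral_eq_lintegral_ofReal ha.integrable_sq (ae_of_all _ fun x => sq_nonneg _)]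
  congr 1 with x
  rw [← sq_abs, ENNReal.ofReal_pow (abs_nonneg _), ← Real.norm_eq_abs, ofReal_norm]

theorem integral_sq_le_of_lintegral_le {m : Measure X} {a : X → ℝ} (ha : MemLp a 2 m) {C : ℝ≥0}
    (h : ∫⁻ x, ‖a x‖ₑ ^ 2 ∂m ≤ C) : ∫ x, a x ^ 2 ∂m ≤ C := by
  rw [← ofReal_integral_sq ha] at h
  exact (ENNReal.ofReal_le_iff_le_toReal ENNReal.coe_ne_top).1 h

theorem MeasureTheory.MemLp.integrable_mul_two {m : Measure X} {a b : X → ℝ} (ha : MemLp a 2 m)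
    (hb : MemLp b 2 m) : Integrable (fun x => a x * b x) m :=
  MemLp.integrable_mul (p := 2) (q := 2) ha hb

theorem integral_mul_eq_inner {m : Measure X} {a b : X → ℝ} (ha : MemLp a 2 m)
    (hb : MemLp b 2 m) : ∫ x, a x * b x ∂m = inner ℝ (ha.toLp a) (hb.toLp b) := by
  rw [L2.inner_def]
  apply integral_congr_ae
  filter_upwards [ha.coeFn_toLp, hb.coeFn_toLp] with x h1 h2
  simp [h1, h2, mul_comm]

theorem abs_integral_mul_le {m : Measure X} {a b : X → ℝ} (ha : MemLp a 2 m) (hb : MemLp b 2 m) :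
    |∫ x, a x * b x ∂m| ≤ (eLpNorm a 2 m).toReal * (eLpNorm b 2 m).toReal := by
  rw [integral_mul_eq_inner ha hb, ← Lp.norm_toLp a ha, ← Lp.norm_toLp b hb]
  exact abs_real_inner_le_norm _ _

theorem MeasureTheory.MemLp.mul_bdd {m : Measure X} {a g : X → ℝ} (ha : MemLp a 2 m)
    (hg : AEStronglyMeasurable g m) {C : ℝ} (hC : ∀ x, |g x| ≤ C) :
    MemLp (fun x => a x * g x) 2 m := by
  refine MemLp.of_le_mul (c := C) ha (ha.1.mul hg) (ae_of_all _ fun x => ?_)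
  rw [norm_mul, mul_comm]
  exact mul_le_mul_of_nonneg_right (hC x) (norm_nonneg _)

theorem eLpNorm_mul_bdd_le {m : Measure X} {a g : X → ℝ} {C : ℝ≥0} (hC : ∀ x, |g x| ≤ C) :
    eLpNorm (fun x => a x * g x) 2 m ≤ C * eLpNorm a 2 m := by
  have := eLpNorm_le_nnreal_smul_eLpNorm_of_ae_le_mul (μ := m) (f := fun x => a x * g x) (g := a)
    (c := C) (ae_of_all _ fun x => ?_) 2
  · simpa [ENNReal.smul_def] using this
  · rw [← NNReal.coe_le_coe]
    push_cast
    rw [norm_mul, mul_comm]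
    exact mul_le_mul_of_nonneg_right (hC x) (norm_nonneg _)

namespace L2Tendsto

variable {m : Measure X} {a a' : ℕ → X → ℝ} {b b' : X → ℝ}

theorem tendsto_toLp (h : L2Tendsto m a b) :
    Tendsto (fun n => (h.1 n).toLp (a n)) atTop (𝓝 (h.2.1.toLp b)) :=
  (Lp.tendsto_Lp_iff_tendsto_eLpNorm'' _ h.1 _ h.2.1).2 h.2.2

theorem const (hb : MemLp b 2 m) : L2Tendsto m (fun _ => b) b :=
  ⟨fun _ => hb, hb, by simp⟩

theorem integral_mul (h : L2Tendsto m a b) (h' : L2Tendsto m a' b') :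
    Tendsto (fun n => ∫ x, a n x * a' n x ∂m) atTop (𝓝 (∫ x, b x * b' x ∂m)) := by
  rw [integral_mul_eq_inner h.2.1 h'.2.1]
  simp_rw [fun n => integral_mul_eq_inner (h.1 n) (h'.1 n)]
  exact h.tendsto_toLp.inner h'.tendsto_toLp

theorem add (h : L2Tendsto m a b) (h' : L2Tendsto m a' b') :
    L2Tendsto m (fun n x => a n x + a' n x) (fun x => b x + b' x) := by
  refine ⟨fun n => (h.1 n).add (h'.1 n), h.2.1.add h'.2.1, ?_⟩
  refine tendsto_of_tendsto_of_tendsto_of_le_of_le tendsto_const_nhds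
    (by simpa using h.2.2.add h'.2.2) (fun n => zero_le) (fun n => ?_)
  refine le_trans (le_of_eq ?_) (eLpNorm_add_le ((h.1 n).1.sub h.2.1.1) ((h'.1 n).1.sub h'.2.1.1)
    one_le_two)
  congr 1
  ext x
  simp only [Pi.add_apply]
  ring

theorem mul_bdd (h : L2Tendsto m a b) {g : X → ℝ} (hg : AEStronglyMeasurable g m) {C : ℝ}
    (hC : ∀ x, |g x| ≤ C) : L2Tendsto m (fun n x => a n x * g x) (fun x => b x * g x) := by
  refine ⟨fun n => (h.1 n).mul_bdd hg hC, h.2.1.mul_bdd hg hC, ?_⟩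
  have hC' : ∀ x, |g x| ≤ C.toNNReal := fun x => (hC x).trans (Real.le_coe_toNNReal C)
  refine tendsto_of_tendsto_of_tendsto_of_le_of_le tendsto_const_nhds
    (by simpa using ENNReal.Tendsto.const_mul h.2.2 (Or.inr (ENNReal.coe_ne_top (r := C.toNNReal))))
    (fun n => zero_le) (fun n => ?_)
  simp only [← sub_mul]
  exact eLpNorm_mul_bdd_le hC'

theorem neg (h : L2Tendsto m a b) : L2Tendsto m (fun n x => -a n x) (fun x => -b x) := by
  have := h.mul_bdd (g := fun _ => -1) aestronglyMeasurable_const (C := 1) (by simp)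
  simpa using this

theorem sub (h : L2Tendsto m a b) (h' : L2Tendsto m a' b') :
    L2Tendsto m (fun n x => a n x - a' n x) (fun x => b x - b' x) := by
  simpa only [sub_eq_add_neg] using h.add h'.neg

theorem tendsto_eLpNorm (h : L2Tendsto m a b) :
    Tendsto (fun n => eLpNorm (a n) 2 m) atTop (𝓝 (eLpNorm b 2 m)) := by
  have := (continuous_enorm.tendsto _).comp h.tendsto_toLp
  simpa [Function.comp_def, Lp.enorm_toLp] using this

end L2Tendsto

namespace WeakL2

variable {m : Measure X} {l : Filter ι} {a : ι → X → ℝ} {b : X → ℝ}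

theorem mul_bdd (h : WeakL2 m l a b) {g : X → ℝ} (hg : AEStronglyMeasurable g m) {C : ℝ}
    (hC : ∀ x, |g x| ≤ C) : WeakL2 m l (fun n x => a n x * g x) (fun x => b x * g x) := by
  refine ⟨fun n => (h.1 n).mul_bdd hg hC, h.2.1.mul_bdd hg hC, fun f hf => ?_⟩
  have := h.2.2 (fun x => f x * g x) (hf.mul_bdd hg hC)
  simpa only [mul_assoc, mul_comm (g _)] using this

/-- Test against the limit itself: `‖b‖² = lim ⟨a n, b⟩ ≤ C‖b‖`. -/
theorem eLpNorm_le [l.NeBot] (h : WeakL2 m l a b) {C : ℝ≥0} (hC : ∀ n, eLpNorm (a n) 2 m ≤ C) :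
    eLpNorm b 2 m ≤ C := by
  have h1 := h.2.2 b h.2.1
  have h2 : ∫ x, b x * b x ∂m = ‖h.2.1.toLp b‖ ^ 2 := by
    rw [integral_mul_eq_inner h.2.1 h.2.1, real_inner_self_eq_norm_sq]
  have h3 : ‖h.2.1.toLp b‖ ^ 2 ≤ C * ‖h.2.1.toLp b‖ := by
    rw [← h2]
    refine le_of_tendsto h1 (Eventually.of_forall fun n => ?_)
    rw [integral_mul_eq_inner (h.1 n) h.2.1]
    refine (real_inner_le_norm _ _).trans (mul_le_mul_of_nonneg_right ?_ (norm_nonneg _))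
    rw [Lp.norm_toLp]
    exact ENNReal.toReal_le_coe_of_le_coe (hC n)
  have h4 : ‖h.2.1.toLp b‖ ≤ C := by
    rcases (norm_nonneg (h.2.1.toLp b)).eq_or_lt with h0 | h0
    · rw [← h0]; exact C.2
    · nlinarith
  rw [Lp.norm_toLp] at h4
  rw [← ENNReal.ofReal_toReal h.2.1.2.ne, ← ENNReal.ofReal_coe_nnreal]
  exact ENNReal.ofReal_le_ofReal h4

/-- Weak times strong: split `c n = d + (c n - d)`. The first part is weak convergence, the second
is at most `C` times a norm tending to zero. This is how every quadratic quantity passes to the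
limit. -/
theorem mul_strong {a : ℕ → X → ℝ} (h : WeakL2 m atTop a b) {c : ℕ → X → ℝ} {d : X → ℝ}
    (hc : L2Tendsto m c d) {C : ℝ≥0} (hC : ∀ n, eLpNorm (a n) 2 m ≤ C) :
    Tendsto (fun n => ∫ x, a n x * c n x ∂m) atTop (𝓝 (∫ x, b x * d x ∂m)) := by
  have h1 : Tendsto (fun n => ∫ x, a n x * (c n x - d x) ∂m) atTop (𝓝 0) := by
    have h0 : Tendsto (fun n => C * (eLpNorm (fun x => c n x - d x) 2 m).toReal) atTop (𝓝 0) := by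
      simpa using ((ENNReal.tendsto_toReal ENNReal.zero_ne_top).comp hc.2.2).const_mul (C : ℝ)
    refine squeeze_zero_norm (fun n => ?_) h0
    refine (abs_integral_mul_le (h.1 n) ((hc.1 n).sub hc.2.1)).trans ?_
    exact mul_le_mul_of_nonneg_right (ENNReal.toReal_le_coe_of_le_coe (hC n))
      ENNReal.toReal_nonneg
  have h2 := h1.add (h.2.2 d hc.2.1)
  rw [zero_add] at h2
  refine h2.congr fun n => ?_
  have h3 : Integrable (fun x => a n x * (c n x - d x)) m :=
    (h.1 n).integrable_mul_two ((hc.1 n).sub hc.2.1)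
  rw [← integral_add h3 ((h.1 n).integrable_mul_two hc.2.1)]
  congr 1 with x
  ring

end WeakL2

theorem MeasureTheory.MemLp.ae_slice {F : Type*} [NormedAddCommGroup F] {μ : Measure X}
    {lam : Measure Y} [SFinite μ] [SFinite lam] {a : X × Y → F} (ha : MemLp a 2 (μ.prod lam)) :
    ∀ᵐ t ∂μ, MemLp (fun y => a (t, y)) 2 lam := by
  have h1 := (memLp_two_iff_integrable_sq_norm ha.1).1 ha
  filter_upwards [h1.prod_right_ae, ha.1.prodMk_left] with t h2 h3
  exact (memLp_two_iff_integrable_sq_norm h3).2 h2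

/-- Uniform `L²` bounds on slices pass to weak limits. -/
theorem WeakL2.slice_bound {μ : Measure X} {lam : Measure Y} [IsFiniteMeasure μ] [SFinite lam]
    {l : Filter ι} [l.NeBot] {a : ι → X × Y → ℝ} {b : X × Y → ℝ}
    (h : WeakL2 (μ.prod lam) l a b) {C : ℝ≥0}
    (hC : ∀ n, ∀ᵐ t ∂μ, ∫⁻ y, ‖a n (t, y)‖ₑ ^ 2 ∂lam ≤ C) :
    ∀ᵐ t ∂μ, ∫⁻ y, ‖b (t, y)‖ₑ ^ 2 ∂lam ≤ C := by
  have hbm : AEMeasurable (fun z => ‖b z‖ₑ ^ 2) (μ.prod lam) := h.2.1.1.enorm.pow_const 2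
  -- It suffices to compare integrals over measurable sets `A` of times. Weak convergence tested
  -- with `b` restricted to `A × Y` makes `∫ b²` a limit of `∫ a b ≤ ½∫ a² + ½∫ b²`; the last half
  -- is absorbed on the left.
  refine ae_le_of_forall_setLIntegral_le_of_sigmaFinite₀ hbm.lintegral_prod_right' ?_
  intro A hA _
  have key : ∀ f : X × Y → ℝ, MemLp f 2 (μ.prod lam) →
      ENNReal.ofReal (∫ z in A ×ˢ univ, f z ^ 2 ∂(μ.prod lam))
        = ∫⁻ t in A, ∫⁻ y, ‖f (t, y)‖ₑ ^ 2 ∂lam ∂μ := by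
    intro f hf
    rw [ofReal_integral_sq (hf.restrict _), ← Measure.prod_restrict, Measure.restrict_univ,
      lintegral_prod]
    have : (μ.restrict A).prod lam = (μ.prod lam).restrict (A ×ˢ univ) := by
      rw [← Measure.prod_restrict, Measure.restrict_univ]
    rw [this]
    exact (hf.1.enorm.pow_const 2).restrict
  rw [← key b h.2.1, setLIntegral_const]
  have hS : MeasurableSet (A ×ˢ (univ : Set Y)) := hA.prod MeasurableSet.univ
  have h1 := h.2.2 ((A ×ˢ univ).indicator b) (h.2.1.indicator hS)
  have e : ∀ f : X × Y → ℝ, ∫ z, f z * (A ×ˢ univ).indicator b z ∂(μ.prod lam)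
      = ∫ z in A ×ˢ univ, f z * b z ∂(μ.prod lam) := by
    intro f
    rw [← integral_indicator hS]
    congr 1 with z
    by_cases hz : z ∈ A ×ˢ (univ : Set Y) <;> simp [hz]
  rw [e] at h1
  simp only [e] at h1
  have hfin : (C : ℝ≥0∞) * μ A ≠ ⊤ := ENNReal.mul_ne_top ENNReal.coe_ne_top (measure_ne_top _ _)
  have hle : ∀ n, ∫ z in A ×ˢ univ, a n z ^ 2 ∂(μ.prod lam) ≤ (C * μ A).toReal := by
    intro n
    rw [← ENNReal.ofReal_le_iff_le_toReal hfin, key _ (h.1 n), ← setLIntegral_const]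
    exact lintegral_mono_ae (ae_restrict_of_ae (hC n))
  have h2 : ∫ z in A ×ˢ univ, b z * b z ∂(μ.prod lam)
      ≤ (C * μ A).toReal / 2 + (∫ z in A ×ˢ univ, b z ^ 2 ∂(μ.prod lam)) / 2 := by
    refine le_of_tendsto h1 (Eventually.of_forall fun n => ?_)
    have hb2 := (h.2.1.restrict (A ×ˢ univ)).integrable_sq
    have ha2 := ((h.1 n).restrict (A ×ˢ univ)).integrable_sq
    calc ∫ z in A ×ˢ univ, a n z * b z ∂(μ.prod lam)
        ≤ ∫ z in A ×ˢ univ, (a n z ^ 2 / 2 + b z ^ 2 / 2) ∂(μ.prod lam) := by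
          refine integral_mono ((h.1 n).restrict _ |>.integrable_mul_two (h.2.1.restrict _))
            ((ha2.div_const 2).add (hb2.div_const 2)) fun z => ?_
          show a n z * b z ≤ a n z ^ 2 / 2 + b z ^ 2 / 2
          nlinarith [sq_nonneg (a n z - b z)]
      _ ≤ _ := by
          rw [integral_add (ha2.div_const 2) (hb2.div_const 2), integral_div, integral_div]
          linarith [hle n]
  simp only [← pow_two] at h2
  rw [ENNReal.ofReal_le_iff_le_toReal hfin]
  linarith

/-- Bounded sequences in `L²` have weak limits along the hyperfilter. -/
theorem exists_weakL2_hyperfilter {m : Measure X} {a : ℕ → X → ℝ} (ha : ∀ n, MemLp (a n) 2 m)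
    {C : ℝ≥0} (hC : ∀ n, eLpNorm (a n) 2 m ≤ C) :
    ∃ b, WeakL2 m (hyperfilter ℕ : Filter ℕ) a b := by
  let D : ℕ → WeakDual ℝ (Lp ℝ 2 m) := fun n =>
    StrongDual.toWeakDual (InnerProductSpace.toDual ℝ _ ((ha n).toLp (a n)))
  -- Banach–Alaoglu. A limit along an ultrafilter replaces the choice of a subsequence, so no
  -- separability or diagonal argument is needed when many sequences are treated together.
  have hcpt := WeakDual.isCompact_closedBall (𝕜 := ℝ) (E := Lp ℝ 2 m) 0 C
  have hmem : ∀ n, D n ∈ WeakDual.toStrongDual ⁻¹' Metric.closedBall (0 : StrongDual ℝ (Lp ℝ 2 m)) C := by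
    intro n
    simp only [mem_preimage, mem_closedBall_zero_iff, D]
    refine ((InnerProductSpace.toDual ℝ (Lp ℝ 2 m)).norm_map _).trans_le ?_
    rw [Lp.norm_toLp]
    exact ENNReal.toReal_le_coe_of_le_coe (hC n)
  obtain ⟨x, -, hx⟩ := hcpt.ultrafilter_le_nhds ((hyperfilter ℕ).map D)
    (le_principal_iff.2 (mem_map.2 (Eventually.of_forall hmem)))
  have hx' : Tendsto D (hyperfilter ℕ : Filter ℕ) (𝓝 x) := hx
  let y : Lp ℝ 2 m := (InnerProductSpace.toDual ℝ _).symm (WeakDual.toStrongDual x)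
  refine ⟨y, ha, Lp.memLp y, fun g hg => ?_⟩
  have h1 := ((WeakDual.eval_continuous (hg.toLp g)).tendsto x).comp hx'
  have h2 : ∫ z, y z * g z ∂m = x (hg.toLp g) := by
    rw [integral_mul_eq_inner (Lp.memLp y) hg, Lp.toLp_coeFn, InnerProductSpace.toDual_symm_apply]
    rfl
  rw [h2]
  refine h1.congr fun n => ?_
  rw [integral_mul_eq_inner (ha n) hg]
  rfl

end L2Tools

/-! ### Test functions: products, components and time slices -/

section TestFunctions

variable {X F : Type*} [NormedAddCommGroup X] [NormedSpace ℝ X]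
  [NormedAddCommGroup F] [NormedSpace ℝ F]

namespace IsTestFunction

theorem fderiv_apply {U : Set X} {φ : X → F} (h : IsTestFunction U φ) (v : X) :
    IsTestFunction U (fun x => fderiv ℝ φ x v) :=
  ⟨(h.1.fderiv_right (m := ∞) le_rfl).clm_apply contDiff_const, h.2.1.fderiv_apply (𝕜 := ℝ) v,
    (tsupport_fderiv_apply_subset ℝ v).trans h.2.2⟩

theorem mul_left {U : Set X} {φ g : X → ℝ} (h : IsTestFunction U φ) (hg : ContDiff ℝ ∞ g) :
    IsTestFunction U (fun x => g x * φ x) :=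
  ⟨hg.mul h.1, h.2.1.mul_left, (tsupport_mul_subset_right (f := g) (g := φ)).trans h.2.2⟩

theorem exists_bound {U : Set X} {φ : X → F} (h : IsTestFunction U φ) :
    ∃ C : ℝ≥0, ∀ x, ‖φ x‖ ≤ C := by
  obtain ⟨C, hC⟩ := h.2.1.exists_bound_of_continuous h.1.continuous
  exact ⟨C.toNNReal, fun x => (hC x).trans (Real.le_coe_toNNReal C)⟩

theorem eq_zero {U : Set X} {φ : X → F} (h : IsTestFunction U φ) {x : X} (hx : x ∉ U) :
    φ x = 0 := by
  by_contra h0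
  exact hx (h.2.2 (subset_tsupport φ h0))

theorem differentiable {U : Set X} {φ : X → F} (h : IsTestFunction U φ) : Differentiable ℝ φ :=
  h.1.differentiable (by simp)

theorem memLp [MeasurableSpace X] [BorelSpace X] [SecondCountableTopologyEither X F] {U : Set X}
    {φ : X → F} (h : IsTestFunction U φ)
    (μ : Measure X) [IsFiniteMeasureOnCompacts μ] (p : ℝ≥0∞) : MemLp φ p μ :=
  h.1.continuous.memLp_of_hasCompactSupport h.2.1

theorem clm_comp {G : Type*} [NormedAddCommGroup G] [NormedSpace ℝ G] {U : Set X} {φ : X → F}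
    (h : IsTestFunction U φ) (L : F →L[ℝ] G) : IsTestFunction U (fun x => L (φ x)) := by
  refine ⟨L.contDiff.comp h.1, h.2.1.comp_left (g := L) L.map_zero, ?_⟩
  exact (closure_mono (Function.support_comp_subset (g := L) L.map_zero φ)).trans h.2.2

theorem mono {U V : Set X} (hUV : U ⊆ V) {φ : X → F} (h : IsTestFunction U φ) :
    IsTestFunction V φ := ⟨h.1, h.2.1, h.2.2.trans hUV⟩

end IsTestFunction

theorem fderiv_component {Φ : X → Plane} {x : X} (h : DifferentiableAt ℝ Φ x) (v : X) (j : Fin 2) :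
    fderiv ℝ (fun y => Φ y j) x v = fderiv ℝ Φ x v j := by
  have := ((EuclideanSpace.proj j : Plane →L[ℝ] ℝ).hasFDerivAt.comp x
    h.hasFDerivAt).fderiv
  have h2 : fderiv ℝ (fun y => Φ y j) x = _ := this
  rw [h2]
  rfl

theorem IsTestFunction.component {U : Set X} {Φ : X → Plane} (h : IsTestFunction U Φ) (j : Fin 2) :
    IsTestFunction U (fun x => Φ x j) :=
  h.clm_comp (EuclideanSpace.proj j : Plane →L[ℝ] ℝ)

theorem IsTestFunction.neg {U : Set X} {φ : X → ℝ} (h : IsTestFunction U φ) :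
    IsTestFunction U (fun x => -φ x) := by
  simpa using h.mul_left (g := fun _ => -1) contDiff_const

/-- The product of test functions in time and in space. -/
theorem IsTestFunction.tprod {T : ℝ} {Ω : Set Plane} {θ : ℝ → ℝ} {ψ : Plane → ℝ}
    (hθ : IsTestFunction (Ioo 0 T) θ) (hψ : IsTestFunction Ω ψ) :
    IsTestFunction (spaceTime T Ω) (fun z : ℝ × Plane => θ z.1 * ψ z.2) := by
  have hs : tsupport (fun z : ℝ × Plane => θ z.1 * ψ z.2) ⊆ tsupport θ ×ˢ tsupport ψ := by
    rw [tsupport, tsupport, tsupport, ← closure_prod_eq]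
    refine closure_mono fun z hz => ?_
    have := mul_ne_zero_iff.1 (Function.mem_support.1 hz)
    exact ⟨this.1, this.2⟩
  refine ⟨(hθ.1.comp contDiff_fst).mul (hψ.1.comp contDiff_snd), ?_,
    hs.trans (prod_mono hθ.2.2 hψ.2.2)⟩
  exact (hθ.2.1.isCompact.prod hψ.2.1.isCompact).of_isClosed_subset (isClosed_tsupport _) hs

theorem fderiv_tprod {θ : ℝ → ℝ} {ψ : Plane → ℝ} (hθ : Differentiable ℝ θ)
    (hψ : Differentiable ℝ ψ) (z v : ℝ × Plane) :
    fderiv ℝ (fun z : ℝ × Plane => θ z.1 * ψ z.2) z v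
      = deriv θ z.1 * v.1 * ψ z.2 + θ z.1 * fderiv ℝ ψ z.2 v.2 := by
  have h1 : HasFDerivAt (fun z : ℝ × Plane => θ z.1) _ z :=
    (hθ z.1).hasFDerivAt.comp z hasFDerivAt_fst
  have h2 : HasFDerivAt (fun z : ℝ × Plane => ψ z.2) _ z :=
    (hψ z.2).hasFDerivAt.comp z hasFDerivAt_snd
  have h3 : fderiv ℝ (fun z : ℝ × Plane => θ z.1 * ψ z.2) z = _ := (h1.mul h2).fderiv
  rw [h3]
  simp
  ring

theorem fderiv_slice {φ : ℝ × Plane → F} {z : ℝ × Plane} (h : DifferentiableAt ℝ φ z) (v : Plane) :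
    fderiv ℝ (fun x => φ (z.1, x)) z.2 v = fderiv ℝ φ z (0, v) := by
  have := (HasFDerivAt.comp (f := fun x : Plane => (z.1, x)) z.2 (g := φ) (g' := fderiv ℝ φ z)
    h.hasFDerivAt (hasFDerivAt_prodMk_right z.1 z.2)).fderiv
  have h2 : fderiv ℝ (fun x => φ (z.1, x)) z.2 = _ := this
  rw [h2]
  rfl

theorem IsTestFunction.slice {T : ℝ} {Ω : Set Plane} {φ : ℝ × Plane → F}
    (h : IsTestFunction (spaceTime T Ω) φ) (t : ℝ) : IsTestFunction Ω (fun x => φ (t, x)) := by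
  have hs : tsupport (fun x => φ (t, x)) ⊆ (fun x => (t, x)) ⁻¹' tsupport φ :=
    closure_minimal (fun x hx => subset_tsupport φ hx)
      ((isClosed_tsupport φ).preimage (by fun_prop))
  refine ⟨h.1.comp (contDiff_const.prodMk contDiff_id), ?_, fun x hx => (h.2.2 (hs hx)).2⟩
  refine (h.2.1.isCompact.image continuous_snd).of_isClosed_subset (isClosed_tsupport _) ?_
  exact fun x hx => ⟨(t, x), hs hx, rfl⟩

end TestFunctions

/-! ### Div-curl identities, translations and Ladyzhenskaya's inequality for smooth functions -/

section Calculus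

theorem integral_fderiv_mul_eq_neg {f g : Plane → ℝ} (hf : ContDiff ℝ 1 f) (hg : ContDiff ℝ 1 g)
    (hc : HasCompactSupport g) (v : Plane) :
    ∫ x, fderiv ℝ f x v * g x = - ∫ x, f x * fderiv ℝ g x v := by
  have hf' : Continuous (fun x => fderiv ℝ f x v) :=
    (hf.continuous_fderiv one_ne_zero).clm_apply continuous_const
  have hg' : Continuous (fun x => fderiv ℝ g x v) :=
    (hg.continuous_fderiv one_ne_zero).clm_apply continuous_const
  rw [integral_mul_fderiv_eq_neg_fderiv_mul_of_integrable, neg_neg]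
  · exact (hf'.mul hg.continuous).integrable_of_hasCompactSupport hc.mul_left
  · exact (hf.continuous.mul hg').integrable_of_hasCompactSupport (hc.fderiv_apply (𝕜 := ℝ) v).mul_left
  · exact (hf.continuous.mul hg.continuous).integrable_of_hasCompactSupport hc.mul_left
  · exact fun x _ => hf.differentiable one_ne_zero x
  · exact fun x _ => hg.differentiable one_ne_zero x

theorem fderiv_mul_apply {X : Type*} [NormedAddCommGroup X] [NormedSpace ℝ X] {f g : X → ℝ} {x : X}
    (hf : DifferentiableAt ℝ f x) (hg : DifferentiableAt ℝ g x) (v : X) :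
    fderiv ℝ (fun y => f y * g y) x v = fderiv ℝ f x v * g x + f x * fderiv ℝ g x v := by
  rw [fderiv_fun_mul hf hg]
  simp
  ring

theorem fderiv_fderiv_comm {X : Type*} [NormedAddCommGroup X] [NormedSpace ℝ X] {f : X → ℝ}
    (hf : ContDiff ℝ 2 f) (x v w : X) :
    fderiv ℝ (fun y => fderiv ℝ f y v) x w = fderiv ℝ (fun y => fderiv ℝ f y w) x v := by
  have hd : DifferentiableAt ℝ (fderiv ℝ f) x :=
    (hf.fderiv_right (m := 1) (by norm_num)).differentiable one_ne_zero x
  have h : ∀ v w, fderiv ℝ (fun y => fderiv ℝ f y v) x w = fderiv ℝ (fderiv ℝ f) x w v := by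
    intro v w
    rw [fderiv_clm_apply hd (differentiableAt_const v)]
    simp
  rw [h, h]
  exact (hf.contDiffAt.isSymmSndFDerivAt (by simp)).eq w v

/-- For compactly supported fields, the gradient is controlled by divergence and curl. -/
theorem integral_sq_fderiv_eq {w : Fin 2 → Plane → ℝ} (hw : ∀ j, ContDiff ℝ 2 (w j))
    (hc : ∀ j, HasCompactSupport (w j)) :
    ∑ i, ∑ j, ∫ x, fderiv ℝ (w j) x (planeBasis i) ^ 2
      = (∫ x, (fderiv ℝ (w 0) x (planeBasis 0) + fderiv ℝ (w 1) x (planeBasis 1)) ^ 2)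
      + ∫ x, (fderiv ℝ (w 1) x (planeBasis 0) - fderiv ℝ (w 0) x (planeBasis 1)) ^ 2 := by
  have h1 : ∀ j i, ContDiff ℝ 1 (fun x => fderiv ℝ (w j) x (planeBasis i)) := fun j i =>
    ((hw j).fderiv_right (m := 1) (by norm_num)).clm_apply contDiff_const
  have hc1 : ∀ j i, HasCompactSupport (fun x => fderiv ℝ (w j) x (planeBasis i)) :=
    fun j i => (hc j).fderiv_apply (𝕜 := ℝ) _
  have hint : ∀ j i j' i', Integrable (fun x => fderiv ℝ (w j) x (planeBasis i)
      * fderiv ℝ (w j') x (planeBasis i')) := fun j i j' i' =>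
    ((h1 j i).continuous.mul (h1 j' i').continuous).integrable_of_hasCompactSupport
      (hc1 j' i').mul_left
  have hadd : ∀ j i j' i' k l k' l', Integrable (fun x => fderiv ℝ (w j) x (planeBasis i)
      * fderiv ℝ (w j') x (planeBasis i') + fderiv ℝ (w k) x (planeBasis l)
      * fderiv ℝ (w k') x (planeBasis l')) := fun j i j' i' k l k' l' =>
    (hint j i j' i').add (hint k l k' l')
  -- Integrating by parts twice exchanges the two derivatives, so the mixed terms arising from the
  -- squares of the divergence and of the curl cancel.
  have key : ∫ x, fderiv ℝ (w 0) x (planeBasis 0) * fderiv ℝ (w 1) x (planeBasis 1)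
      = ∫ x, fderiv ℝ (w 0) x (planeBasis 1) * fderiv ℝ (w 1) x (planeBasis 0) := by
    rw [integral_fderiv_mul_eq_neg ((hw 0).of_le (by norm_num)) (h1 1 1) (hc1 1 1),
      integral_fderiv_mul_eq_neg ((hw 0).of_le (by norm_num)) (h1 1 0) (hc1 1 0)]
    simp_rw [fderiv_fderiv_comm (hw 1) _ (planeBasis 1) (planeBasis 0)]
  have e1 : ∫ x, (fderiv ℝ (w 0) x (planeBasis 0) + fderiv ℝ (w 1) x (planeBasis 1)) ^ 2
      = (∫ x, fderiv ℝ (w 0) x (planeBasis 0) ^ 2) + (∫ x, fderiv ℝ (w 1) x (planeBasis 1) ^ 2)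
        + 2 * ∫ x, fderiv ℝ (w 0) x (planeBasis 0) * fderiv ℝ (w 1) x (planeBasis 1) := by
    simp only [pow_two]
    rw [← integral_const_mul, ← integral_add (hint _ _ _ _) (hint _ _ _ _),
      ← integral_add (hadd _ _ _ _ _ _ _ _) ((hint _ _ _ _).const_mul 2)]
    congr 1 with x
    ring
  have e2 : ∫ x, (fderiv ℝ (w 1) x (planeBasis 0) - fderiv ℝ (w 0) x (planeBasis 1)) ^ 2
      = (∫ x, fderiv ℝ (w 1) x (planeBasis 0) ^ 2) + (∫ x, fderiv ℝ (w 0) x (planeBasis 1) ^ 2)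
        - 2 * ∫ x, fderiv ℝ (w 0) x (planeBasis 1) * fderiv ℝ (w 1) x (planeBasis 0) := by
    simp only [pow_two]
    rw [← integral_const_mul, ← integral_add (hint _ _ _ _) (hint _ _ _ _),
      ← integral_sub (hadd _ _ _ _ _ _ _ _) ((hint _ _ _ _).const_mul 2)]
    congr 1 with x
    ring
  rw [e1, e2, key]
  simp only [Fin.sum_univ_two]
  ring

/-- The variance of `f` on the unit interval is nonnegative. -/
theorem sq_intervalIntegral_le {f : ℝ → ℝ} (hf : Continuous f) :
    (∫ s in (0 : ℝ)..1, f s) ^ 2 ≤ ∫ s in (0 : ℝ)..1, f s ^ 2 := by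
  set c := ∫ s in (0 : ℝ)..1, f s
  have h : 0 ≤ ∫ s in (0 : ℝ)..1, (f s - c) ^ 2 :=
    intervalIntegral.integral_nonneg zero_le_one fun s _ => sq_nonneg _
  have e : ∫ s in (0 : ℝ)..1, (f s - c) ^ 2 = (∫ s in (0 : ℝ)..1, f s ^ 2) - c ^ 2 := by
    have : ∀ s, (f s - c) ^ 2 = f s ^ 2 - 2 * c * f s + c ^ 2 := fun s => by ring
    simp only [this]
    rw [intervalIntegral.integral_add, intervalIntegral.integral_sub,
      intervalIntegral.integral_const_mul]
    · simp only [intervalIntegral.integral_const]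
      simp only [sub_zero, smul_eq_mul, one_mul]
      ring
    all_goals apply Continuous.intervalIntegrable; fun_prop
  linarith

/-- Translations of smooth functions in `L²`. -/
theorem integral_sq_translate_sub_le {w : Plane → ℝ} (hw : ContDiff ℝ 1 w)
    (hc : HasCompactSupport w) (h : Plane) :
    ∫ x, (w (x - h) - w x) ^ 2 ≤ ∫ x, fderiv ℝ w x h ^ 2 := by
  have hd : Continuous (fun x => fderiv ℝ w x h) :=
    (hw.continuous_fderiv one_ne_zero).clm_apply continuous_const
  have hdint : Integrable (fun x => fderiv ℝ w x h ^ 2) := by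
    simp only [pow_two]
    exact (hd.mul hd).integrable_of_hasCompactSupport (hc.fderiv_apply (𝕜 := ℝ) h).mul_left
  -- The increment is the integral of the derivative along the segment from `x` to `x - h`; square
  -- it by the previous Cauchy–Schwarz inequality. Tonelli and translation invariance then remove
  -- the parameter `s`.
  have hpt : ∀ x, ENNReal.ofReal ((w (x - h) - w x) ^ 2)
      ≤ ∫⁻ s in Ioc (0 : ℝ) 1, ENNReal.ofReal (fderiv ℝ w (x - s • h) h ^ 2) := by
    intro x
    have hcs : Continuous (fun s : ℝ => fderiv ℝ w (x - s • h) h) := hd.comp (by fun_prop)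
    have hD : ∀ s : ℝ, HasDerivAt (fun s : ℝ => w (x - s • h)) (-fderiv ℝ w (x - s • h) h) s := by
      intro s
      have h1 : HasDerivAt (fun s : ℝ => x - s • h) (-h) s := by
        simpa using ((hasDerivAt_id s).smul_const h).const_sub x
      have := (hw.differentiable one_ne_zero (x - s • h)).hasFDerivAt.comp_hasDerivAt s h1
      rw [map_neg] at this
      exact this
    have h2 : ∫ s in (0 : ℝ)..1, -fderiv ℝ w (x - s • h) h = w (x - h) - w x := by
      rw [intervalIntegral.integral_eq_sub_of_hasDerivAt (fun s _ => hD s)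
        (hcs.neg.intervalIntegrable _ _)]
      simp
    have h3 := sq_intervalIntegral_le (f := fun s => -fderiv ℝ w (x - s • h) h) hcs.neg
    rw [h2] at h3
    simp only [neg_sq] at h3
    rw [intervalIntegral.integral_of_le zero_le_one] at h3
    refine (ENNReal.ofReal_le_ofReal h3).trans_eq ?_
    rw [ofReal_integral_eq_lintegral_ofReal]
    · exact ((hcs.pow 2).integrableOn_Icc).mono_set Ioc_subset_Icc_self
    · exact ae_of_all _ fun s => sq_nonneg _
  have hmeas : Measurable (fun p : Plane × ℝ =>
      ENNReal.ofReal (fderiv ℝ w (p.1 - p.2 • h) h ^ 2)) := by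
    have : Continuous (fun p : Plane × ℝ => fderiv ℝ w (p.1 - p.2 • h) h ^ 2) :=
      (hd.comp (by fun_prop : Continuous fun p : Plane × ℝ => p.1 - p.2 • h)).pow 2
    exact this.measurable.ennreal_ofReal
  have hsq : Continuous (fun x => (w (x - h) - w x) ^ 2) := by
    have := hw.continuous
    fun_prop
  rw [integral_eq_lintegral_of_nonneg_ae (ae_of_all _ fun x => sq_nonneg _)
    hsq.aestronglyMeasurable, integral_eq_lintegral_of_nonneg_ae (ae_of_all _ fun x => sq_nonneg _)
    hdint.1]
  refine ENNReal.toReal_mono ?_ ?_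
  · rw [← ofReal_integral_eq_lintegral_ofReal hdint (ae_of_all _ fun x => sq_nonneg _)]
    exact ENNReal.ofReal_ne_top
  calc ∫⁻ x, ENNReal.ofReal ((w (x - h) - w x) ^ 2)
      ≤ ∫⁻ x, ∫⁻ s in Ioc (0 : ℝ) 1, ENNReal.ofReal (fderiv ℝ w (x - s • h) h ^ 2) :=
        lintegral_mono hpt
    _ = ∫⁻ s in Ioc (0 : ℝ) 1, ∫⁻ x, ENNReal.ofReal (fderiv ℝ w (x - s • h) h ^ 2) :=
        lintegral_lintegral_swap hmeas.aemeasurable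
    _ = ∫⁻ s in Ioc (0 : ℝ) 1, ∫⁻ x, ENNReal.ofReal (fderiv ℝ w x h ^ 2) := by
        refine lintegral_congr fun s => ?_
        exact lintegral_sub_right_eq_self (fun x => ENNReal.ofReal (fderiv ℝ w x h ^ 2)) (s • h)
    _ = _ := by simp

theorem fderiv_eq_sum (w : Plane → ℝ) (x h : Plane) :
    fderiv ℝ w x h = ∑ i, h i * fderiv ℝ w x (planeBasis i) := by
  have : h = ∑ i, h i • planeBasis i := by
    ext j
    simp [planeBasis, Fin.sum_univ_two]
    fin_cases j <;> simp
  conv_lhs => rw [this]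
  rw [map_sum]
  simp

theorem sq_fderiv_le (w : Plane → ℝ) (x h : Plane) :
    fderiv ℝ w x h ^ 2 ≤ ‖h‖ ^ 2 * ∑ i, fderiv ℝ w x (planeBasis i) ^ 2 := by
  rw [fderiv_eq_sum, EuclideanSpace.norm_sq_eq]
  simp only [Real.norm_eq_abs, sq_abs]
  exact Finset.sum_mul_sq_le_sq_mul_sq _ _ _

/-- The translation estimate in terms of divergence and curl. -/
theorem sum_integral_sq_translate_sub_le {w : Fin 2 → Plane → ℝ} (hw : ∀ j, ContDiff ℝ 2 (w j))
    (hc : ∀ j, HasCompactSupport (w j)) (h : Plane) :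
    ∑ j, ∫ x, (w j (x - h) - w j x) ^ 2
      ≤ ‖h‖ ^ 2 * ((∫ x, (fderiv ℝ (w 0) x (planeBasis 0) + fderiv ℝ (w 1) x (planeBasis 1)) ^ 2)
      + ∫ x, (fderiv ℝ (w 1) x (planeBasis 0) - fderiv ℝ (w 0) x (planeBasis 1)) ^ 2) := by
  rw [← integral_sq_fderiv_eq hw hc, Finset.sum_comm, Finset.mul_sum]
  refine Finset.sum_le_sum fun j _ => ?_
  refine (integral_sq_translate_sub_le ((hw j).of_le (by norm_num)) (hc j) h).trans ?_
  have hint : ∀ v, Integrable (fun x => fderiv ℝ (w j) x v ^ 2) := fun v => by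
    have hd : Continuous (fun x => fderiv ℝ (w j) x v) :=
      ((hw j).continuous_fderiv two_ne_zero).clm_apply continuous_const
    simp only [pow_two]
    exact (hd.mul hd).integrable_of_hasCompactSupport ((hc j).fderiv_apply (𝕜 := ℝ) v).mul_left
  rw [← integral_finsetSum _ fun i _ => hint _, ← integral_const_mul]
  exact integral_mono (hint h) ((integrable_finsetSum _ fun i _ => hint _).const_mul _)
    fun x => sq_fderiv_le (w j) x h

/-- The identity `(V·∇)V = ∇|V|²/2 + (curl V) V^⊥`, tested against a divergence-free field, for
a field `V` which is divergence-free on the support of the test field. -/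
theorem sum_integral_mul_mul_fderiv_eq {V Φ : Fin 2 → Plane → ℝ} (hV : ∀ j, ContDiff ℝ 1 (V j))
    (hΦ : ∀ j, ContDiff ℝ 1 (Φ j)) (hc : ∀ j, HasCompactSupport (Φ j))
    (hdivΦ : ∀ x, ∑ i, fderiv ℝ (Φ i) x (planeBasis i) = 0)
    (hdiv : ∀ᵐ x, ∀ j, Φ j x = 0 ∨ ∑ i, fderiv ℝ (V i) x (planeBasis i) = 0) :
    ∑ i, ∑ j, ∫ x, V i x * V j x * fderiv ℝ (Φ j) x (planeBasis i)
      = - ∫ x, (fderiv ℝ (V 1) x (planeBasis 0) - fderiv ℝ (V 0) x (planeBasis 1))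
          * (V 0 x * Φ 1 x - V 1 x * Φ 0 x) := by
  have cd : ∀ j i, Continuous (fun x => fderiv ℝ (V j) x (planeBasis i)) := fun j i =>
    ((hV j).continuous_fderiv one_ne_zero).clm_apply continuous_const
  have cV := fun j => (hV j).continuous
  have cΦ := fun j => (hΦ j).continuous
  have dV := fun j => (hV j).differentiable one_ne_zero
  have step1 : ∀ i j, ∫ x, V i x * V j x * fderiv ℝ (Φ j) x (planeBasis i)
      = - ∫ x, (fderiv ℝ (V i) x (planeBasis i) * V j x
        + V i x * fderiv ℝ (V j) x (planeBasis i)) * Φ j x := by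
    intro i j
    have := integral_fderiv_mul_eq_neg ((hV i).mul (hV j)) (hΦ j) (hc j) (planeBasis i)
    simp only [fun x => fderiv_mul_apply (dV i x) (dV j x)] at this
    rw [this, neg_neg]
  have step2 : ∑ j, ∫ x, (∑ i, V i x * fderiv ℝ (V i) x (planeBasis j)) * Φ j x = 0 := by
    have hK : ∀ j, ∫ x, (∑ i, V i x * fderiv ℝ (V i) x (planeBasis j)) * Φ j x
        = - ∫ x, (∑ i, V i x * V i x) / 2 * fderiv ℝ (Φ j) x (planeBasis j) := by
      intro j
      have hC : ContDiff ℝ 1 (fun x => (∑ i, V i x * V i x) / 2) :=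
        (ContDiff.sum fun i _ => (hV i).mul (hV i)).div_const 2
      rw [← integral_fderiv_mul_eq_neg hC (hΦ j) (hc j)]
      congr 1 with x
      congr 1
      have h1 : ∀ i, HasFDerivAt (fun x => V i x * V i x)
          (V i x • fderiv ℝ (V i) x + V i x • fderiv ℝ (V i) x) x := fun i =>
        (dV i x).hasFDerivAt.mul (dV i x).hasFDerivAt
      have h2 := ((HasFDerivAt.fun_sum (u := Finset.univ) fun i _ => h1 i).mul_const (2 : ℝ)⁻¹)
      simp only [div_eq_mul_inv]
      rw [h2.fderiv]
      simp [Fin.sum_univ_two]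
      ring
    simp only [hK]
    rw [Finset.sum_neg_distrib, ← integral_finsetSum, neg_eq_zero]
    · rw [← integral_zero Plane ℝ]
      congr 1 with x
      rw [← Finset.mul_sum, hdivΦ, mul_zero]
    · intro j _
      have : Continuous (fun x => fderiv ℝ (Φ j) x (planeBasis j)) :=
        ((hΦ j).continuous_fderiv one_ne_zero).clm_apply continuous_const
      refine Continuous.integrable_of_hasCompactSupport (by fun_prop) ?_
      exact ((hc j).fderiv_apply (𝕜 := ℝ) _).mul_left
  simp only [step1]
  have hint : ∀ (g : Plane → ℝ) (j), Continuous g → Integrable (fun x => g x * Φ j x) :=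
    fun g j hg => (hg.mul (cΦ j)).integrable_of_hasCompactSupport (hc j).mul_left
  have i1 : ∀ i j, Integrable (fun x => (fderiv ℝ (V i) x (planeBasis i) * V j x
        + V i x * fderiv ℝ (V j) x (planeBasis i)) * Φ j x) := fun i j => by
    refine hint (fun x => _) j ?_
    have := cd i i; have := cd j i
    fun_prop
  have i2 : ∀ j, Integrable (fun x => (∑ i, V i x * fderiv ℝ (V i) x (planeBasis j)) * Φ j x) :=
    fun j => by
      refine hint (fun x => _) j ?_
      have := fun i => cd i j
      fun_prop
  -- Inserting the vanishing gradient term makes the two sides agree almost everywhere pointwise, up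
  -- to a multiple of `div V`, which is zero wherever `Φ` is not.
  rw [← sub_zero (- ∫ x, (fderiv ℝ (V 1) x (planeBasis 0) - fderiv ℝ (V 0) x (planeBasis 1))
          * (V 0 x * Φ 1 x - V 1 x * Φ 0 x)), ← step2]
  simp only [Finset.sum_neg_distrib]
  rw [← neg_add', neg_inj]
  simp_rw [← integral_finsetSum _ fun j _ => i1 _ j]
  rw [← integral_finsetSum _ fun i _ => integrable_finsetSum _ fun j _ => i1 i j,
    ← integral_finsetSum _ fun j _ => i2 j, ← integral_add]
  · refine integral_congr_ae ?_
    filter_upwards [hdiv] with x hx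
    have h0 : (fderiv ℝ (V 0) x (planeBasis 0) + fderiv ℝ (V 1) x (planeBasis 1)) * Φ 0 x = 0 := by
      rcases hx 0 with h | h
      · rw [h, mul_zero]
      · rw [Fin.sum_univ_two] at h; rw [h, zero_mul]
    have h1 : (fderiv ℝ (V 0) x (planeBasis 0) + fderiv ℝ (V 1) x (planeBasis 1)) * Φ 1 x = 0 := by
      rcases hx 1 with h | h
      · rw [h, mul_zero]
      · rw [Fin.sum_univ_two] at h; rw [h, zero_mul]
    simp only [Fin.sum_univ_two]
    linear_combination V 0 x * h0 + V 1 x * h1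
  · have : ∀ x, (fderiv ℝ (V 1) x (planeBasis 0) - fderiv ℝ (V 0) x (planeBasis 1))
          * (V 0 x * Φ 1 x - V 1 x * Φ 0 x)
        = ((fderiv ℝ (V 1) x (planeBasis 0) - fderiv ℝ (V 0) x (planeBasis 1)) * V 0 x) * Φ 1 x
        - ((fderiv ℝ (V 1) x (planeBasis 0) - fderiv ℝ (V 0) x (planeBasis 1)) * V 1 x) * Φ 0 x :=
      fun x => by ring
    simp only [this]
    have := cd 1 0; have := cd 0 1
    exact (hint _ 1 (by fun_prop)).sub (hint _ 0 (by fun_prop))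
  · exact integrable_finsetSum _ fun j _ => i2 j

/-- The Gagliardo-Nirenberg-Sobolev inequality for squares of smooth functions on the plane. -/
theorem exists_eLpNorm_sq_le : ∃ C : ℝ≥0, ∀ w : Plane → ℝ, ContDiff ℝ 1 w → HasCompactSupport w →
    eLpNorm (fun x => w x * w x) 2 volume
      ≤ C * (eLpNorm w 2 volume * ∑ i, eLpNorm (fun x => fderiv ℝ w x (planeBasis i)) 2 volume) := by
  -- In dimension two the Sobolev exponent of `W^{1,1}` is 2. The embedding is applied to `w²`,
  -- whose gradient `2w∇w` lies in `L¹` by Hölder; the factor 2 in the constant comes from this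
  -- gradient.
  have hp : NNReal.HolderConjugate (Module.finrank ℝ Plane) 2 := by
    rw [finrank_euclideanSpace_fin]
    constructor <;> norm_num
  refine ⟨2 * eLpNormLESNormFDerivOneConst (volume : Measure Plane) (2 : ℝ≥0), fun w hw hc => ?_⟩
  have h1 := eLpNorm_le_eLpNorm_fderiv_one (μ := (volume : Measure Plane)) (hw.mul hw)
    hc.mul_left hp
  have hd : ∀ i, Continuous (fun x => fderiv ℝ w x (planeBasis i)) := fun i =>
    (hw.continuous_fderiv one_ne_zero).clm_apply continuous_const
  have h2 : ∀ x, ‖fderiv ℝ (fun y => w y * w y) x‖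
      ≤ 2 * ‖w x * ∑ i, |fderiv ℝ w x (planeBasis i)|‖ := by
    intro x
    have hdx := hw.differentiable one_ne_zero x
    rw [fderiv_fun_mul hdx hdx, ← two_smul ℝ, norm_smul, norm_smul, norm_mul, Real.norm_two]
    have : ‖fderiv ℝ w x‖ ≤ ‖∑ i, |fderiv ℝ w x (planeBasis i)|‖ := by
      refine ContinuousLinearMap.opNorm_le_bound _ (norm_nonneg _) fun h => ?_
      rw [fderiv_eq_sum, Real.norm_of_nonneg (Finset.sum_nonneg fun i _ => abs_nonneg _),
        Finset.sum_mul]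
      refine (norm_sum_le _ _).trans (Finset.sum_le_sum fun i _ => ?_)
      rw [norm_mul, mul_comm, Real.norm_eq_abs]
      exact mul_le_mul_of_nonneg_left (PiLp.norm_apply_le h i) (abs_nonneg _)
    gcongr
  have h3 : eLpNorm (fderiv ℝ (fun y => w y * w y)) 1 volume
      ≤ 2 * (eLpNorm w 2 volume * ∑ i, eLpNorm (fun x => fderiv ℝ w x (planeBasis i)) 2 volume) := by
    calc eLpNorm (fderiv ℝ (fun y => w y * w y)) 1 volume
        ≤ 2 * eLpNorm (fun x => w x * ∑ i, |fderiv ℝ w x (planeBasis i)|) 1 volume := by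
          have := eLpNorm_le_nnreal_smul_eLpNorm_of_ae_le_mul (μ := (volume : Measure Plane))
            (f := fderiv ℝ (fun y => w y * w y))
            (g := fun x => w x * ∑ i, |fderiv ℝ w x (planeBasis i)|) (c := 2)
            (ae_of_all _ fun x => by exact_mod_cast h2 x) 1
          simpa [ENNReal.smul_def] using this
      _ ≤ 2 * (eLpNorm w 2 volume
            * eLpNorm (fun x => ∑ i, |fderiv ℝ w x (planeBasis i)|) 2 volume) := by
          gcongr
          refine eLpNorm_smul_le_mul_eLpNorm (p := 2) (q := 2) (r := 1) (f := fun x => ∑ i, |fderiv ℝ w x (planeBasis i)|)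
            (φ := w) ?_ hw.continuous.aestronglyMeasurable
          exact (continuous_finsetSum _ fun i _ => (hd i).abs).aestronglyMeasurable
      _ ≤ _ := by
          gcongr
          have := eLpNorm_sum_le (p := 2) (μ := (volume : Measure Plane)) (s := Finset.univ)
            (f := fun (i : Fin 2) x => |fderiv ℝ w x (planeBasis i)|)
            (fun i _ => (hd i).abs.aestronglyMeasurable) one_le_two
          have e : (fun x => ∑ i, |fderiv ℝ w x (planeBasis i)|)
              = ∑ i, fun x => |fderiv ℝ w x (planeBasis i)| := by
            ext x; simp
          rw [e]
          refine this.trans (Finset.sum_le_sum fun i _ => le_of_eq ?_)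
          exact eLpNorm_norm (fun x => fderiv ℝ w x (planeBasis i))
  refine h1.trans ((mul_le_mul_right h3 _).trans_eq ?_)
  push_cast
  ring

end Calculus

/-! ### The Navier–Stokes equations at a fixed time -/

section Slices

theorem L2Tendsto.comp_measurePreserving {X Y : Type*} [MeasurableSpace X] [MeasurableSpace Y]
    {m : Measure X} {m' : Measure Y} {a : ℕ → X → ℝ} {b : X → ℝ} (h : L2Tendsto m a b) {f : Y → X}
    (hf : MeasurePreserving f m' m) : L2Tendsto m' (fun n y => a n (f y)) (fun y => b (f y)) := by
  refine ⟨fun n => (h.1 n).comp_measurePreserving hf, h.2.1.comp_measurePreserving hf,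
    h.2.2.congr fun n => ?_⟩
  exact (eLpNorm_comp_measurePreserving ((h.1 n).1.sub h.2.1.1) hf).symm

theorem memLp_of_restrict {X : Type*} [MeasurableSpace X] {m : Measure X} {Ω : Set X}
    (hΩ : MeasurableSet Ω) {a : X → ℝ} (ha : MemLp a 2 (m.restrict Ω)) (h0 : ∀ x ∉ Ω, a x = 0) :
    MemLp a 2 m := by
  have := (memLp_indicator_iff_restrict hΩ).2 ha
  rwa [indicator_eq_self.2 fun x hx => by_contra fun h => hx (h0 x h)] at this

theorem L2Tendsto.of_restrict {X : Type*} [MeasurableSpace X] {m : Measure X} {Ω : Set X}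
    (hΩ : MeasurableSet Ω) {a : ℕ → X → ℝ} {b : X → ℝ} (h : L2Tendsto (m.restrict Ω) a b)
    (ha : ∀ n, ∀ x ∉ Ω, a n x = 0) (hb : ∀ x ∉ Ω, b x = 0) : L2Tendsto m a b := by
  refine ⟨fun n => memLp_of_restrict hΩ (h.1 n) (ha n), memLp_of_restrict hΩ h.2.1 hb,
    h.2.2.congr fun n => ?_⟩
  rw [← eLpNorm_indicator_eq_eLpNorm_restrict hΩ, indicator_eq_self.2]
  intro x hx
  by_contra h'
  exact hx (by simp [ha n x h', hb x h'])

theorem MeasureTheory.MemLp.component {X : Type*} [MeasurableSpace X] {m : Measure X} {p : ℝ≥0∞}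
    {v : X → Plane} (hv : MemLp v p m) (j : Fin 2) : MemLp (fun x => v x j) p m :=
  hv.mono ((EuclideanSpace.proj j : Plane →L[ℝ] ℝ).continuous.comp_aestronglyMeasurable hv.1)
    (ae_of_all _ fun x => PiLp.norm_apply_le (v x) j)

/-- A coordinate projection commutes with a Bochner integral only when the integrand is integrable,
which the square integrability of `v` and `w` ensures. -/
theorem HasWeakDeriv.integral_component {X : Type*} [NormedAddCommGroup X] [NormedSpace ℝ X]
    [MeasureSpace X] [BorelSpace X] [SecondCountableTopology X]
    [IsFiniteMeasureOnCompacts (volume : Measure X)] {U : Set X} {d : X} {v w : X → Plane}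
    (h : HasWeakDeriv U d v w) (hv : MemLp v 2 (volume.restrict U))
    (hw : MemLp w 2 (volume.restrict U)) {φ : X → ℝ} (hφ : IsTestFunction U φ) (j : Fin 2) :
    ∫ x in U, fderiv ℝ φ x d * v x j = - ∫ x in U, φ x * w x j := by
  have key : ∀ (g : X → ℝ) (a : X → Plane), MemLp g 2 (volume.restrict U) →
      MemLp a 2 (volume.restrict U) →
      ∫ x in U, g x * a x j = (∫ x in U, g x • a x) j := by
    intro g a hg ha
    have hi : Integrable (fun x => g x • a x) (volume.restrict U) :=
      memLp_one_iff_integrable.1 (ha.smul hg)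
    exact (EuclideanSpace.proj j : Plane →L[ℝ] ℝ).integral_comp_comm hi
  rw [key _ _ (((hφ.fderiv_apply d).memLp volume 2).restrict U) hv,
    key _ _ ((hφ.memLp volume 2).restrict U) hw, h.2.2 φ hφ]
  rfl

variable {Ω : Set Plane} {v : Plane → Plane} {Dv : Fin 2 → Plane → Plane}

/-- Density of test functions, read off component by component. Integrations by parts for `H¹₀`
fields are done on these approximations and then passed to the limit. -/
theorem MemH10.exists_approx (h : MemH10 Ω v Dv) :
    ∃ φ : ℕ → Fin 2 → Plane → ℝ, (∀ k j, IsTestFunction Ω (φ k j)) ∧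
      (∀ j, L2Tendsto (volume.restrict Ω) (fun k => φ k j) (fun x => v x j)) ∧
      ∀ i j, L2Tendsto (volume.restrict Ω)
        (fun k x => fderiv ℝ (φ k j) x (planeBasis i)) (fun x => Dv i x j) := by
  obtain ⟨⟨hv, hD⟩, φ, hφ, hlim⟩ := h
  have hsq : ∀ (a : ℕ → Plane → Plane), (∀ k, eLpNorm (a k) 2 (volume.restrict Ω) ^ 2 ≤
      h1NormSq Ω (fun x => φ k x - v x) (fun i x => fderiv ℝ (φ k) x (planeBasis i) - Dv i x)) →
      Tendsto (fun k => eLpNorm (a k) 2 (volume.restrict Ω)) atTop (𝓝 0) := by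
    intro a ha
    have h1 := tendsto_of_tendsto_of_tendsto_of_le_of_le tendsto_const_nhds hlim
      (fun n => zero_le) ha
    have h2 := (ENNReal.continuous_rpow_const (y := (1 / 2 : ℝ))).tendsto 0 |>.comp h1
    rw [ENNReal.zero_rpow_of_pos (by norm_num)] at h2
    refine h2.congr fun k => ?_
    simp only [Function.comp]
    rw [← ENNReal.rpow_natCast, ← ENNReal.rpow_mul]
    norm_num
  have hcomp : ∀ (a : ℕ → Plane → Plane) (j : Fin 2),
      Tendsto (fun k => eLpNorm (a k) 2 (volume.restrict Ω)) atTop (𝓝 0) →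
      Tendsto (fun k => eLpNorm (fun x => a k x j) 2 (volume.restrict Ω)) atTop (𝓝 0) := by
    intro a j ha
    refine tendsto_of_tendsto_of_tendsto_of_le_of_le tendsto_const_nhds ha (fun n => zero_le)
      fun k => eLpNorm_mono fun x => PiLp.norm_apply_le _ _
  refine ⟨fun k j x => φ k x j, fun k j => (hφ k).component j, fun j => ⟨fun k => ?_,
    hv.component j, ?_⟩, fun i j => ⟨fun k => ?_, (hD i).1.component j, ?_⟩⟩
  · exact ((hφ k).component j).memLp _ _
  · refine hcomp (fun k x => φ k x - v x) j (hsq _ fun k => ?_)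
    exact le_self_add
  · exact (((hφ k).component j).fderiv_apply _).memLp _ _
  · refine (hcomp (fun k x => fderiv ℝ (φ k) x (planeBasis i) - Dv i x) j
      (hsq _ fun k => ?_)).congr fun k => ?_
    · refine le_trans ?_ le_add_self
      exact Finset.single_le_sum
        (f := fun i => eLpNorm (fun x => fderiv ℝ (φ k) x (planeBasis i) - Dv i x) 2
          (volume.restrict Ω) ^ 2) (fun _ _ => zero_le) (Finset.mem_univ i)
    · congr 1
      ext x
      exact congrArg (· - (Dv i x).ofLp j)
        (fderiv_component (hφ k).differentiable.differentiableAt (planeBasis i) j).symm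

/-- Products of components of a field in `H¹₀` are square integrable. -/
theorem MemH10.memLp_mul (hΩ : IsOpen Ω) (h : MemH10 Ω v Dv) (i j : Fin 2) :
    MemLp (fun x => v x i * v x j) 2 (volume.restrict Ω) := by
  obtain ⟨φ, hφ, hφv, hφD⟩ := h.exists_approx
  obtain ⟨C, hC⟩ := exists_eLpNorm_sq_le
  have hsq : ∀ j, MemLp (fun x => v x j * v x j) 2 (volume.restrict Ω) := by
    intro j
    have hlim : Tendsto (fun k => C * (eLpNorm (φ k j) 2 (volume.restrict Ω)
        * ∑ i, eLpNorm (fun x => fderiv ℝ (φ k j) x (planeBasis i)) 2 (volume.restrict Ω))) atTop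
        (𝓝 (C * (eLpNorm (fun x => v x j) 2 (volume.restrict Ω)
        * ∑ i, eLpNorm (fun x => Dv i x j) 2 (volume.restrict Ω)))) := by
      refine ENNReal.Tendsto.const_mul ?_ (Or.inr ENNReal.coe_ne_top)
      refine ENNReal.Tendsto.mul (hφv j).tendsto_eLpNorm (Or.inr ?_)
        (tendsto_finsetSum _ fun i _ => (hφD i j).tendsto_eLpNorm) (Or.inr (hφv j).2.1.2.ne)
      exact ENNReal.sum_ne_top.2 fun i _ => (hφD i j).2.1.2.ne
    set B := C * (eLpNorm (fun x => v x j) 2 (volume.restrict Ω)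
        * ∑ i, eLpNorm (fun x => Dv i x j) 2 (volume.restrict Ω))
    have hB : B < ⊤ := ENNReal.mul_lt_top ENNReal.coe_lt_top (ENNReal.mul_lt_top (hφv j).2.1.2
      (ENNReal.sum_lt_top.2 fun i _ => (hφD i j).2.1.2))
    obtain ⟨ns, hns, hae⟩ := (tendstoInMeasure_of_tendsto_eLpNorm (two_ne_zero)
      (fun k => ((hφv j).1 k).1) (hφv j).2.1.1 (hφv j).2.2).exists_seq_tendsto_ae
    have hbd : ∀ k, eLpNorm (fun x => φ k j x * φ k j x) 2 (volume.restrict Ω)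
        ≤ C * (eLpNorm (φ k j) 2 (volume.restrict Ω)
        * ∑ i, eLpNorm (fun x => fderiv ℝ (φ k j) x (planeBasis i)) 2 (volume.restrict Ω)) := by
      intro k
      have e : ∀ g : Plane → ℝ, IsTestFunction Ω g →
          eLpNorm g 2 (volume.restrict Ω) = eLpNorm g 2 volume := by
        intro g hg
        rw [← eLpNorm_indicator_eq_eLpNorm_restrict hΩ.measurableSet, indicator_eq_self.2]
        intro x hx
        by_contra h'
        exact hx (hg.eq_zero h')
      rw [e _ (hφ k j)]
      simp_rw [fun i => e _ ((hφ k j).fderiv_apply (planeBasis i))]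
      rw [e _ ((hφ k j).mul_left (hφ k j).1)]
      exact hC _ ((hφ k j).1.of_le (by simp)) (hφ k j).2.1
    have hmv : AEStronglyMeasurable (fun x => v x j * v x j) (volume.restrict Ω) :=
      (hφv j).2.1.1.mul (hφv j).2.1.1
    -- The Ladyzhenskaya bounds for the approximations converge to `B`, hence are eventually below
    -- `B + 1`. Fatou's lemma along an almost everywhere convergent subsequence transfers this to
    -- the limit.
    refine ⟨hmv, lt_of_le_of_lt (b := B + 1) ?_ (ENNReal.add_lt_top.2 ⟨hB, ENNReal.one_lt_top⟩)⟩
    have hev : ∀ᶠ k in atTop, eLpNorm (fun x => φ (ns k) j x * φ (ns k) j x) 2 (volume.restrict Ω)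
        ≤ B + 1 := by
      have := (hlim.comp hns.tendsto_atTop).eventually_lt_const
        (ENNReal.lt_add_right hB.ne one_ne_zero)
      filter_upwards [this] with k hk
      exact (hbd _).trans hk.le
    refine Lp.eLpNorm_le_of_ae_tendsto (u := atTop)
      (f := fun k x => φ (ns k) j x * φ (ns k) j x) hev
      (fun k => ((hφv j).1 _).1.mul ((hφv j).1 _).1) ?_
    filter_upwards [hae] with x hx
    exact hx.mul hx
  refine ((hsq i).add (hsq j)).mono ((hφv i).2.1.1.mul (hφv j).2.1.1) (ae_of_all _ fun x => ?_)
  simp only [Pi.add_apply, Real.norm_eq_abs]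
  rw [abs_of_nonneg (by nlinarith [mul_self_nonneg (v x i), mul_self_nonneg (v x j)] :
    0 ≤ v x i * v x i + v x j * v x j), abs_le]
  constructor <;> nlinarith [sq_nonneg (v x i - v x j), sq_nonneg (v x i + v x j),
    sq_nonneg (v x i), sq_nonneg (v x j)]

theorem IsTestFunction.abs_le {X : Type*} [NormedAddCommGroup X] [NormedSpace ℝ X] {U : Set X}
    {φ : X → ℝ} (h : IsTestFunction U φ) : ∃ C : ℝ≥0, ∀ x, |φ x| ≤ C := h.exists_bound

theorem IsTestFunction.aesm {X : Type*} [NormedAddCommGroup X] [NormedSpace ℝ X]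
    [MeasurableSpace X] [BorelSpace X] [SecondCountableTopology X] {U : Set X}
    {φ : X → ℝ} (h : IsTestFunction U φ) (m : Measure X) : AEStronglyMeasurable φ m :=
  h.1.continuous.aestronglyMeasurable

/-- The weak form of the convection term for divergence-free fields in `H¹₀`. -/
theorem MemH10.integral_convection (h : MemH10 Ω v Dv)
    (hdiv : ∀ᵐ x ∂volume.restrict Ω, ∑ i, Dv i x i = 0) {ψ : Plane → ℝ} (hψ : IsTestFunction Ω ψ)
    (j : Fin 2) : ∑ i, ∫ x in Ω, v x i * (Dv i x j * ψ x)
      = - ∑ i, ∫ x in Ω, v x i * (v x j * fderiv ℝ ψ x (planeBasis i)) := by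
  obtain ⟨φ, hφ, hφv, hφD⟩ := h.exists_approx
  obtain ⟨C, hC⟩ := hψ.abs_le
  choose C' hC' using fun i => (hψ.fderiv_apply (planeBasis i)).abs_le
  have hm := hψ.aesm (volume.restrict Ω)
  have hm' := fun i => (hψ.fderiv_apply (planeBasis i)).aesm (volume.restrict Ω)
  have l1 := tendsto_finsetSum Finset.univ fun i _ =>
    (hφv i).integral_mul ((hφD i j).mul_bdd hm hC)
  -- The approximations need not be divergence-free, so integrating by parts leaves this additional
  -- divergence term; it disappears only in the limit.
  have l2 := tendsto_finsetSum Finset.univ fun i _ =>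
    (hφD i i).integral_mul ((hφv j).mul_bdd hm hC)
  have l3 := tendsto_finsetSum Finset.univ fun i _ =>
    (hφv i).integral_mul ((hφv j).mul_bdd (hm' i) (hC' i))
  have hz : ∑ i, ∫ x in Ω, Dv i x i * (v x j * ψ x) = 0 := by
    rw [← integral_finsetSum _ fun i _ => (hφD i i).2.1.integrable_mul_two
      ((hφv j).2.1.mul_bdd hm hC)]
    rw [← integral_zero Plane ℝ]
    refine integral_congr_ae ?_
    filter_upwards [hdiv] with x hx
    rw [← Finset.sum_mul, hx, zero_mul]
  rw [hz] at l2
  have l4 := (l3.add l2).neg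
  rw [add_zero] at l4
  refine tendsto_nhds_unique (l1.congr fun k => ?_) l4
  rw [← Finset.sum_add_distrib, ← Finset.sum_neg_distrib]
  refine Finset.sum_congr rfl fun i _ => ?_
  have e : ∀ g g' : Plane → ℝ, IsTestFunction Ω g →
      ∫ x in Ω, g' x * g x = ∫ x, g' x * g x := fun g g' hg =>
    setIntegral_eq_integral_of_forall_compl_eq_zero fun x hx => by simp [hg.eq_zero hx]
  have t1 : IsTestFunction Ω (fun x => fderiv ℝ (φ k j) x (planeBasis i) * ψ x) :=
    hψ.mul_left ((hφ k j).fderiv_apply _).1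
  have t2 : IsTestFunction Ω (fun x => φ k j x * ψ x) := hψ.mul_left (hφ k j).1
  have t3 : IsTestFunction Ω (fun x => φ k j x * fderiv ℝ ψ x (planeBasis i)) :=
    (hψ.fderiv_apply _).mul_left (hφ k j).1
  rw [e _ _ t1, e _ _ t2, e _ _ t3, integral_fderiv_mul_eq_neg ((hφ k i).1.of_le (by simp))
    (t2.1.of_le (by simp)) t2.2.1]
  simp_rw [fun x => fderiv_mul_apply ((hφ k j).differentiable x) (hψ.differentiable x)
    (planeBasis i)]
  have i1 : Integrable fun x => φ k i x * (fderiv ℝ (φ k j) x (planeBasis i) * ψ x) :=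
    ((hφ k i).memLp _ 2).integrable_mul_two (t1.memLp _ 2)
  have i3 : Integrable fun x => φ k i x * (φ k j x * fderiv ℝ ψ x (planeBasis i)) :=
    ((hφ k i).memLp _ 2).integrable_mul_two (t3.memLp _ 2)
  simp only [mul_add]
  rw [integral_add i1 i3]
  ring

/-- The velocity, its derivatives, the pressure and the force at a fixed time. -/
structure IsNavierStokesSlice (Ω : Set Plane) (ν : ℝ) (f ut v : Plane → Plane)
    (Dv : Fin 2 → Plane → Plane) (D2v : Fin 2 → Fin 2 → Plane → Plane) (p : Plane → ℝ)
    (Dp : Fin 2 → Plane → ℝ) : Prop where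
  memH10 : MemH10 Ω v Dv
  memLp_ut : MemLp ut 2 (volume.restrict Ω)
  memLp_f : MemLp f 2 (volume.restrict Ω)
  memLp_D2v : ∀ i j, MemLp (D2v i j) 2 (volume.restrict Ω)
  weak_D2v : ∀ i j, HasWeakDeriv Ω (planeBasis j) (Dv i) (D2v i j)
  memLp_p : MemLp p 2 (volume.restrict Ω)
  memLp_Dp : ∀ i, MemLp (Dp i) 2 (volume.restrict Ω)
  weak_Dp : ∀ i, HasWeakDeriv Ω (planeBasis i) p (Dp i)
  div : ∀ᵐ x ∂volume.restrict Ω, ∑ i, Dv i x i = 0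
  eq : ∀ᵐ x ∂volume.restrict Ω, ∀ j,
    ut x j - ν * ∑ i, D2v i i x j + ∑ i, v x i * Dv i x j + Dp j x = f x j

namespace IsNavierStokesSlice

variable {ν : ℝ} {f ut : Plane → Plane} {D2v : Fin 2 → Fin 2 → Plane → Plane} {p : Plane → ℝ}
  {Dp : Fin 2 → Plane → ℝ}

/-- Read off from the equation, all of whose other terms are in `L²`; a product of two `L²`
functions would only be in `L¹`. -/
theorem memLp_convection (h : IsNavierStokesSlice Ω ν f ut v Dv D2v p Dp) (j : Fin 2) :
    MemLp (fun x => ∑ i, v x i * Dv i x j) 2 (volume.restrict Ω) := by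
  have h1 : MemLp (fun x => f x j - ut x j + ν * ∑ i, D2v i i x j - Dp j x) 2
      (volume.restrict Ω) :=
    (((h.memLp_f.component j).sub (h.memLp_ut.component j)).add
      ((memLp_finsetSum _ fun i _ => (h.memLp_D2v i i).component j).const_mul ν)).sub
      (h.memLp_Dp j)
  refine h1.ae_eq ?_
  filter_upwards [h.eq] with x hx
  linarith [hx j]

/-- The equation at a fixed time, tested against a square integrable function. -/
theorem integral_ut_mul (h : IsNavierStokesSlice Ω ν f ut v Dv D2v p Dp) (j : Fin 2)
    {g : Plane → ℝ} (hg : MemLp g 2 (volume.restrict Ω)) :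
    ∫ x in Ω, ut x j * g x = ν * ∑ i, (∫ x in Ω, D2v i i x j * g x)
      - (∫ x in Ω, (∑ i, v x i * Dv i x j) * g x) - (∫ x in Ω, Dp j x * g x)
      + ∫ x in Ω, f x j * g x := by
  have i1 := fun i => ((h.memLp_D2v i i).component j).integrable_mul_two hg
  have i2 := (h.memLp_convection j).integrable_mul_two hg
  have i3 := (h.memLp_Dp j).integrable_mul_two hg
  have i4 := (h.memLp_f.component j).integrable_mul_two hg
  have i5 : Integrable (fun x => ν * ∑ i, D2v i i x j * g x) (volume.restrict Ω) :=
    (integrable_finsetSum _ fun i _ => i1 i).const_mul ν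
  have i6 : Integrable (fun x => ν * ∑ i, D2v i i x j * g x
    - (∑ i, v x i * Dv i x j) * g x) (volume.restrict Ω) := i5.sub i2
  have i7 : Integrable (fun x => ν * ∑ i, D2v i i x j * g x
    - (∑ i, v x i * Dv i x j) * g x - Dp j x * g x) (volume.restrict Ω) := i6.sub i3
  rw [← integral_finsetSum _ fun i _ => i1 i, ← integral_const_mul, ← integral_sub i5 i2,
    ← integral_sub i6 i3, ← integral_add i7 i4]
  refine integral_congr_ae ?_
  filter_upwards [h.eq] with x hx
  rw [← Finset.sum_mul]
  linear_combination g x * hx j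

/-- All derivatives are moved onto `ψ`, and the pressure disappears because `ψ` is solenoidal. The
right side is then controlled by the energy and the force alone, uniformly in bounded viscosities.
-/
theorem sum_integral_ut_mul_test (h : IsNavierStokesSlice Ω ν f ut v Dv D2v p Dp)
    {ψ : Fin 2 → Plane → ℝ} (hψ : ∀ j, IsTestFunction Ω (ψ j))
    (hdivψ : ∀ x, ∑ i, fderiv ℝ (ψ i) x (planeBasis i) = 0) :
    ∑ j, ∫ x in Ω, ut x j * ψ j x
      = ν * (∑ j, ∑ i, ∫ x in Ω, v x j
          * fderiv ℝ (fun y => fderiv ℝ (ψ j) y (planeBasis i)) x (planeBasis i))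
        + (∑ j, ∑ i, ∫ x in Ω, v x i * (v x j * fderiv ℝ (ψ j) x (planeBasis i)))
        + ∑ j, ∫ x in Ω, f x j * ψ j x := by
  have hv := h.memH10.1.1
  have hDv := h.memH10.1.2
  have hlap : ∀ i j, ∫ x in Ω, D2v i i x j * ψ j x = ∫ x in Ω, v x j
          * fderiv ℝ (fun y => fderiv ℝ (ψ j) y (planeBasis i)) x (planeBasis i) := by
    intro i j
    have h1 := (h.weak_D2v i i).integral_component (hDv i).1 (h.memLp_D2v i i) (hψ j) j
    have h2 := (hDv i).2.integral_component hv (hDv i).1 ((hψ j).fderiv_apply (planeBasis i)) j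
    simp only [mul_comm (D2v _ _ _ _), mul_comm (v _ _)]
    rw [h2, h1, neg_neg]
  have hconv : ∀ j, ∫ x in Ω, (∑ i, v x i * Dv i x j) * ψ j x
      = - ∑ i, ∫ x in Ω, v x i * (v x j * fderiv ℝ (ψ j) x (planeBasis i)) := by
    intro j
    rw [← h.memH10.integral_convection h.div (hψ j) j]
    obtain ⟨C, hC⟩ := (hψ j).abs_le
    rw [← integral_finsetSum _ fun i _ => (hv.component i).integrable_mul_two
      (((hDv i).1.component j).mul_bdd ((hψ j).aesm _) hC)]
    congr 1 with x
    rw [Finset.sum_mul]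
    simp only [mul_assoc]
  have hpr : ∑ j, ∫ x in Ω, Dp j x * ψ j x = 0 := by
    have h1 : ∀ j, ∫ x in Ω, Dp j x * ψ j x = - ∫ x in Ω, p x * fderiv ℝ (ψ j) x (planeBasis j) := by
      intro j
      have := (h.weak_Dp j).2.2 (ψ j) (hψ j)
      simp only [smul_eq_mul] at this
      simp only [mul_comm (Dp _ _), mul_comm (p _)]
      rw [this, neg_neg]
    simp only [h1]
    rw [Finset.sum_neg_distrib, ← integral_finsetSum _ fun j _ => h.memLp_p.integrable_mul_two
      (((hψ j).fderiv_apply (planeBasis j)).memLp _ 2), neg_eq_zero]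
    rw [← integral_zero Plane ℝ]
    congr 1 with x
    rw [← Finset.mul_sum, hdivψ, mul_zero]
  simp only [fun j => h.integral_ut_mul j (((hψ j).memLp volume 2).restrict Ω), hlap, hconv,
    Finset.sum_add_distrib, Finset.sum_sub_distrib, hpr, Finset.mul_sum, Finset.sum_neg_distrib]
  ring

/-- The energy inequality at a fixed time. -/
theorem sum_integral_ut_mul_self_le (hΩ : IsOpen Ω) (hν : 0 ≤ ν)
    (h : IsNavierStokesSlice Ω ν f ut v Dv D2v p Dp) :
    ∑ j, ∫ x in Ω, ut x j * v x j ≤ ∑ j, ∫ x in Ω, f x j * v x j := by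
  have hv := h.memH10.1.1
  have hDv := h.memH10.1.2
  obtain ⟨φ, hφ, hφv, hφD⟩ := h.memH10.exists_approx
  -- The field `v` is not itself a test function: this identity and the next two are proved by
  -- testing with `φ k` and letting `k` tend to infinity.
  have hlap : ∀ i j, ∫ x in Ω, D2v i i x j * v x j = - ∫ x in Ω, Dv i x j * Dv i x j := by
    intro i j
    have l1 := (L2Tendsto.const ((h.memLp_D2v i i).component j)).integral_mul (hφv j)
    have l2 := ((L2Tendsto.const ((hDv i).1.component j)).integral_mul (hφD i j)).neg
    refine tendsto_nhds_unique l1 (l2.congr fun k => ?_)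
    have h1 := (h.weak_D2v i i).integral_component (hDv i).1 (h.memLp_D2v i i) (hφ k j) j
    simp only [mul_comm (D2v _ _ _ _), mul_comm (Dv _ _ _)]
    rw [h1, neg_neg]
  have hpr : ∑ j, ∫ x in Ω, Dp j x * v x j = 0 := by
    have l1 := tendsto_finsetSum Finset.univ fun j _ =>
      (L2Tendsto.const (h.memLp_Dp j)).integral_mul (hφv j)
    have l2 := (tendsto_finsetSum Finset.univ fun j _ =>
      (L2Tendsto.const h.memLp_p).integral_mul (hφD j j)).neg
    have hz : - ∑ j, ∫ x in Ω, p x * Dv j x j = 0 := by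
      rw [← integral_finsetSum _ fun j _ => h.memLp_p.integrable_mul_two ((hDv j).1.component j),
        neg_eq_zero, ← integral_zero Plane ℝ]
      refine integral_congr_ae ?_
      filter_upwards [h.div] with x hx
      rw [← Finset.mul_sum, hx, mul_zero]
    rw [hz] at l2
    refine tendsto_nhds_unique l1 (l2.congr fun k => ?_)
    rw [← Finset.sum_neg_distrib]
    refine Finset.sum_congr rfl fun j _ => ?_
    have := (h.weak_Dp j).2.2 (φ k j) (hφ k j)
    simp only [smul_eq_mul] at this
    simp only [mul_comm (Dp _ _), mul_comm (p _)]
    rw [this, neg_neg]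
  -- Integration by parts shows that this number equals its own negative. Passing to the limit in
  -- `k` requires the products `v i * v j` to be in `L²`.
  have hconv : ∑ j, ∫ x in Ω, (∑ i, v x i * Dv i x j) * v x j = 0 := by
    have l1 := tendsto_finsetSum Finset.univ fun j _ =>
      (L2Tendsto.const (h.memLp_convection j)).integral_mul (hφv j)
    have l2 := (tendsto_finsetSum Finset.univ fun j _ => tendsto_finsetSum Finset.univ fun i _ =>
      (L2Tendsto.const (h.memH10.memLp_mul hΩ i j)).integral_mul (hφD i j)).neg
    have e : ∑ j, ∑ i, ∫ x in Ω, v x i * v x j * Dv i x j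
        = ∑ j, ∫ x in Ω, (∑ i, v x i * Dv i x j) * v x j := by
      refine Finset.sum_congr rfl fun j _ => ?_
      rw [← integral_finsetSum _ fun i _ => (h.memH10.memLp_mul hΩ i j).integrable_mul_two
        ((hDv i).1.component j)]
      congr 1 with x
      rw [Finset.sum_mul]
      exact Finset.sum_congr rfl fun i _ => by ring
    have := tendsto_nhds_unique l1 (l2.congr fun k => ?_)
    · rw [e] at this
      linarith
    rw [← Finset.sum_neg_distrib]
    refine Finset.sum_congr rfl fun j _ => ?_
    have h1 := h.memH10.integral_convection h.div (hφ k j) j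
    have e1 : ∀ i, ∫ x in Ω, v x i * v x j * fderiv ℝ (φ k j) x (planeBasis i)
        = ∫ x in Ω, v x i * (v x j * fderiv ℝ (φ k j) x (planeBasis i)) := fun i => by
      simp only [mul_assoc]
    simp only [e1]
    rw [← h1]
    obtain ⟨C, hC⟩ := (hφ k j).abs_le
    rw [← integral_finsetSum _ fun i _ => (hv.component i).integrable_mul_two
      (((hDv i).1.component j).mul_bdd ((hφ k j).aesm _) hC)]
    congr 1 with x
    rw [Finset.sum_mul]
    simp only [mul_assoc]
  have hneg : ∑ j, ν * ∑ i, ∫ x in Ω, D2v i i x j * v x j ≤ 0 := by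
    refine Finset.sum_nonpos fun j _ => mul_nonpos_of_nonneg_of_nonpos hν ?_
    refine Finset.sum_nonpos fun i _ => ?_
    rw [hlap, neg_nonpos]
    exact integral_nonneg fun x => mul_self_nonneg _
  simp only [fun j => h.integral_ut_mul j (hv.component j), Finset.sum_add_distrib,
    Finset.sum_sub_distrib, hpr, hconv]
  linarith

end IsNavierStokesSlice

/-- Localized divergence-free fields in `H¹₀` have translations controlled by the local vorticity. -/
theorem exists_translate_bound (hΩ : IsOpen Ω) {χ : Plane → ℝ} (hχ : IsTestFunction Ω χ) :
    ∃ A : ℝ≥0, ∀ (v : Plane → Plane) (Dv : Fin 2 → Plane → Plane), MemH10 Ω v Dv →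
      (∀ᵐ x ∂volume.restrict Ω, ∑ i, Dv i x i = 0) → ∀ h : Plane,
      ∑ j, ∫ x, (χ (x - h) * v (x - h) j - χ x * v x j) ^ 2
        ≤ ‖h‖ ^ 2 * (A * (∑ j, ∫ x in Ω, v x j ^ 2)
          + 2 * ∫ x in Ω, (χ x * (Dv 0 x 1 - Dv 1 x 0)) ^ 2) := by
  obtain ⟨C, hC⟩ := hχ.abs_le
  choose G hG using fun i => (hχ.fderiv_apply (planeBasis i)).abs_le
  -- The divergence of `χv` is `v·∇χ`, and its curl is `χ` times the curl of `v` plus a term bounded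
  -- by `|∇χ||v|`. With `(p + q)² ≤ 2p² + 2q²`, the gradient of `χ` contributes `3(G 0 + G 1)²|v|²`;
  -- the factor 6 leaves room.
  refine ⟨6 * (G 0 + G 1) ^ 2, fun v Dv hv hdiv h => ?_⟩
  obtain ⟨φ, hφ, hφv, hφD⟩ := hv.exists_approx
  have hm := hχ.aesm (volume.restrict Ω)
  have hm' := fun i => (hχ.fderiv_apply (planeBasis i)).aesm (volume.restrict Ω)
  have hw : ∀ j, L2Tendsto volume (fun k x => φ k j x * χ x) (fun x => v x j * χ x) := fun j =>
    L2Tendsto.of_restrict hΩ.measurableSet ((hφv j).mul_bdd hm hC)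
      (fun n x hx => by simp [hχ.eq_zero hx]) (fun x hx => by simp [hχ.eq_zero hx])
  have hdiff : ∀ j, L2Tendsto volume (fun k x => φ k j (x - h) * χ (x - h) - φ k j x * χ x)
      (fun x => v (x - h) j * χ (x - h) - v x j * χ x) := fun j =>
    ((hw j).comp_measurePreserving (measurePreserving_sub_right volume h)).sub (hw j)
  have tw : ∀ k j, IsTestFunction Ω (fun x => φ k j x * χ x) := fun k j =>
    hχ.mul_left (hφ k j).1
  have hd : ∀ i j, L2Tendsto (volume.restrict Ω)
      (fun k x => fderiv ℝ (fun x => φ k j x * χ x) x (planeBasis i))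
      (fun x => Dv i x j * χ x + v x j * fderiv ℝ χ x (planeBasis i)) := fun i j => by
    have := ((hφD i j).mul_bdd hm hC).add ((hφv j).mul_bdd (hm' i) (hG i))
    simpa only [fun k x => fderiv_mul_apply ((hφ k j).differentiable x) (hχ.differentiable x)
      (planeBasis i)] using this
  have ldiv := (hd 0 0).add (hd 1 1)
  have lcurl := (hd 0 1).sub (hd 1 0)
  have l1 := tendsto_finsetSum Finset.univ fun j _ => (hdiff j).integral_mul (hdiff j)
  have l2 := ((ldiv.integral_mul ldiv).add (lcurl.integral_mul lcurl)).const_mul (‖h‖ ^ 2)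
  have hle := le_of_tendsto_of_tendsto' l1 l2 fun k => ?_
  · simp only [← pow_two] at hle
    simp only [mul_comm (χ _) (v _ _)]
    refine hle.trans (mul_le_mul_of_nonneg_left ?_ (sq_nonneg _))
    have i0 : ∀ j, Integrable (fun x => v x j ^ 2) (volume.restrict Ω) := fun j =>
      (hv.1.1.component j).integrable_sq
    have i1 : Integrable (fun x => (χ x * (Dv 0 x 1 - Dv 1 x 0)) ^ 2) (volume.restrict Ω) := by
      have := ((((hv.1.2 0).1.component 1).sub ((hv.1.2 1).1.component 0)).mul_bdd hm hC).integrable_sq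
      refine this.congr (ae_of_all _ fun x => ?_)
      simp only [Pi.sub_apply]
      ring
    have i2 := ldiv.2.1.integrable_sq
    have i3 := lcurl.2.1.integrable_sq
    have i4 : Integrable (fun x => (6 * (G 0 + G 1) ^ 2) * ∑ j, v x j ^ 2) (volume.restrict Ω) :=
      (integrable_finsetSum _ fun j _ => i0 j).const_mul _
    have i5 : Integrable (fun x => (6 * (G 0 + G 1) ^ 2) * ∑ j, v x j ^ 2
        + 2 * (χ x * (Dv 0 x 1 - Dv 1 x 0)) ^ 2) (volume.restrict Ω) := i4.add (i1.const_mul 2)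
    rw [← integral_add i2 i3, ← integral_finsetSum _ fun j _ => i0 j, ← integral_const_mul 2]
    push_cast
    rw [← integral_const_mul, ← integral_add i4 (i1.const_mul 2)]
    refine integral_mono_ae (i2.add i3) i5 ?_
    filter_upwards [hdiv] with x hx
    rw [Fin.sum_univ_two] at hx
    simp only [Fin.sum_univ_two]
    set a := fderiv ℝ χ x (planeBasis 0) with ha
    set b := fderiv ℝ χ x (planeBasis 1) with hb
    have ha' : |a| ≤ G 0 := hG 0 x
    have hb' : |b| ≤ G 1 := hG 1 x
    have hab : a ^ 2 + b ^ 2 ≤ (G 0 + G 1 : ℝ) ^ 2 := by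
      rw [← sq_abs a, ← sq_abs b]
      nlinarith [abs_nonneg a, abs_nonneg b, (G 0).2, (G 1).2]
    have e1 : Dv 0 x 0 * χ x + v x 0 * a + (Dv 1 x 1 * χ x + v x 1 * b) = v x 0 * a + v x 1 * b := by
      linear_combination χ x * hx
    have e2 : Dv 0 x 1 * χ x + v x 1 * a - (Dv 1 x 0 * χ x + v x 0 * b)
        = χ x * (Dv 0 x 1 - Dv 1 x 0) + (v x 1 * a - v x 0 * b) := by ring
    rw [e1, e2]
    have f1 : (v x 0 * a + v x 1 * b) ^ 2 ≤ (a ^ 2 + b ^ 2) * (v x 0 ^ 2 + v x 1 ^ 2) := by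
      nlinarith [sq_nonneg (v x 0 * b - v x 1 * a)]
    have f2 : (v x 1 * a - v x 0 * b) ^ 2 ≤ (a ^ 2 + b ^ 2) * (v x 0 ^ 2 + v x 1 ^ 2) := by
      nlinarith [sq_nonneg (v x 1 * b + v x 0 * a)]
    have f3 : (a ^ 2 + b ^ 2) * (v x 0 ^ 2 + v x 1 ^ 2)
        ≤ (G 0 + G 1 : ℝ) ^ 2 * (v x 0 ^ 2 + v x 1 ^ 2) :=
      mul_le_mul_of_nonneg_right hab (by positivity)
    have f4 : 0 ≤ (G 0 + G 1 : ℝ) ^ 2 * (v x 0 ^ 2 + v x 1 ^ 2) := by positivity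
    nlinarith [sq_nonneg (χ x * (Dv 0 x 1 - Dv 1 x 0) - (v x 1 * a - v x 0 * b))]
  · have := sum_integral_sq_translate_sub_le (w := fun j x => φ k j x * χ x)
      (fun j => by exact_mod_cast contDiff_infty.1 (tw k j).1 2) (fun j => (tw k j).2.1) h
    simp only [← pow_two]
    refine this.trans (le_of_eq ?_)
    congr 2
    · symm
      exact setIntegral_eq_integral_of_forall_compl_eq_zero fun x hx => by
        rw [((tw k 0).fderiv_apply _).eq_zero hx, ((tw k 1).fderiv_apply _).eq_zero hx]; simp
    · symm
      exact setIntegral_eq_integral_of_forall_compl_eq_zero fun x hx => by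
        rw [((tw k 0).fderiv_apply _).eq_zero hx, ((tw k 1).fderiv_apply _).eq_zero hx]; simp

end Slices

/-! ### Functions of time: weak derivatives, energy identity, almost everywhere convergence -/

section Time

/-- The derivative of the smoothed step is an approximate identity: it lives on `[s, s + 1/k]` and
has total mass 1. After the substitution `y = k(r - s)`, dominated convergence applies. -/
theorem tendsto_integral_deriv_smoothTransition {T : ℝ} {a : ℝ → ℝ} (ha : ContinuousOn a (Icc 0 T))
    {s : ℝ} (hs : s ∈ Ioo 0 T) :
    Tendsto (fun k : ℕ => ∫ r in Ioo 0 T,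
      deriv (fun r => Real.smoothTransition (k * (r - s))) r * a r) atTop (𝓝 (a s)) := by
  have hσ : ContDiff ℝ ∞ Real.smoothTransition := Real.smoothTransition.contDiff
  have hσc : Continuous (deriv Real.smoothTransition) := hσ.continuous_deriv (by simp)
  have hσ0 : ∀ y, y ∉ Icc (0 : ℝ) 1 → deriv Real.smoothTransition y = 0 := by
    intro y hy
    rw [mem_Icc, not_and_or, not_le, not_le] at hy
    rcases hy with hy | hy
    · have : Real.smoothTransition =ᶠ[𝓝 y] fun _ => 0 := by
        filter_upwards [Iio_mem_nhds hy] with z hz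
        exact Real.smoothTransition.zero_of_nonpos (le_of_lt hz)
      rw [this.deriv_eq, deriv_const]
    · have : Real.smoothTransition =ᶠ[𝓝 y] fun _ => 1 := by
        filter_upwards [Ioi_mem_nhds hy] with z hz
        exact Real.smoothTransition.one_of_one_le (le_of_lt hz)
      rw [this.deriv_eq, deriv_const]
  have hd : ∀ (k : ℕ) r, deriv (fun r => Real.smoothTransition (k * (r - s))) r
      = k * deriv Real.smoothTransition (k * (r - s)) := by
    intro k r
    have h1 : HasDerivAt (fun r : ℝ => (k : ℝ) * (r - s)) k r := by
      simpa using ((hasDerivAt_id r).sub_const s).const_mul (k : ℝ)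
    have := ((hσ.differentiable (by simp) (k * (r - s))).hasDerivAt.comp r h1).deriv
    rw [mul_comm]
    exact this
  obtain ⟨C, hC⟩ := (isCompact_Icc (a := (0 : ℝ)) (b := 1)).exists_bound_of_continuousOn
    hσc.continuousOn
  obtain ⟨D, hD⟩ := (isCompact_Icc (a := (0 : ℝ)) (b := T)).exists_bound_of_continuousOn ha
  have hlarge : ∀ᶠ k : ℕ in atTop, 0 < (k : ℝ) ∧ s + 1 / k < T := by
    have h1 : Tendsto (fun k : ℕ => s + 1 / (k : ℝ)) atTop (𝓝 (s + 0)) :=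
      tendsto_const_nhds.add tendsto_one_div_atTop_nhds_zero_nat
    rw [add_zero] at h1
    filter_upwards [h1.eventually_lt_const hs.2, eventually_gt_atTop 0] with k h2 h3
    exact ⟨by exact_mod_cast h3, h2⟩
  have hmem : ∀ k : ℕ, 0 < (k : ℝ) ∧ s + 1 / k < T → ∀ y ∈ Icc (0 : ℝ) 1, s + y / k ∈ Icc 0 T := by
    intro k hk y hy
    have h1 : 0 ≤ y / k := div_nonneg hy.1 hk.1.le
    have h2 : y / k ≤ 1 / k := div_le_div_of_nonneg_right hy.2 hk.1.le
    exact ⟨by linarith [hs.1], by linarith [hk.2]⟩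
  have heq : ∀ k : ℕ, 0 < (k : ℝ) ∧ s + 1 / k < T →
      ∫ r in Ioo 0 T, deriv (fun r => Real.smoothTransition (k * (r - s))) r * a r
      = ∫ y in (0 : ℝ)..1, deriv Real.smoothTransition y * a (s + y / k) := by
    intro k hk
    have h1 : ∫ r in Ioo 0 T, deriv (fun r => Real.smoothTransition (k * (r - s))) r * a r
        = ∫ r in Icc s (s + 1 / k), k * (deriv Real.smoothTransition (k * (r - s)) * a r) := by
      simp only [hd, mul_assoc]
      refine setIntegral_eq_of_subset_of_forall_sdiff_eq_zero measurableSet_Ioo ?_ ?_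
      · exact fun r hr => ⟨hs.1.trans_le hr.1, hr.2.trans_lt hk.2⟩
      · intro r hr
        have : (k : ℝ) * (r - s) ∉ Icc (0 : ℝ) 1 := by
          intro hm
          apply hr.2
          refine ⟨?_, ?_⟩
          · have := nonneg_of_mul_nonneg_right hm.1 hk.1
            linarith
          · have : r - s ≤ 1 / k := by
              rw [le_div_iff₀ hk.1, mul_comm]; exact hm.2
            linarith
        rw [hσ0 _ this]; ring
    have h2 := intervalIntegral.smul_integral_comp_mul_sub (a := s) (b := s + 1 / k)
      (f := fun y => deriv Real.smoothTransition y * a (s + y / k)) (k : ℝ) (k * s)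
    rw [h1, integral_Icc_eq_integral_Ioc, ← intervalIntegral.integral_of_le
      (by linarith [one_div_pos.2 hk.1]), intervalIntegral.integral_const_mul]
    have e1 : (k : ℝ) * s - k * s = 0 := sub_self _
    have e2 : (k : ℝ) * (s + 1 / k) - k * s = 1 := by
      have := hk.1.ne'
      field_simp
      ring
    rw [e1, e2] at h2
    rw [← h2, smul_eq_mul]
    congr 1
    refine intervalIntegral.integral_congr fun r _ => ?_
    have e3 : s + (k * r - k * s) / k = r := by
      have := hk.1.ne'
      field_simp
      ring
    simp only [e3, mul_sub]
  have hlim : Tendsto (fun k : ℕ => ∫ y in (0 : ℝ)..1,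
      deriv Real.smoothTransition y * a (s + y / k)) atTop
      (𝓝 (∫ y in (0 : ℝ)..1, deriv Real.smoothTransition y * a s)) := by
    refine intervalIntegral.tendsto_integral_filter_of_dominated_convergence (fun _ => C * D)
      ?_ ?_ intervalIntegrable_const ?_
    · filter_upwards [hlarge] with k hk
      rw [uIoc_of_le zero_le_one]
      have : ContinuousOn (fun y => deriv Real.smoothTransition y * a (s + y / k)) (Icc 0 1) :=
        hσc.continuousOn.mul (ha.comp (by fun_prop) fun y hy => hmem k hk y hy)
      exact (this.mono Ioc_subset_Icc_self).aestronglyMeasurable measurableSet_Ioc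
    · filter_upwards [hlarge] with k hk
      refine ae_of_all _ fun y hy => ?_
      rw [uIoc_of_le zero_le_one] at hy
      rw [norm_mul]
      have hy' := Ioc_subset_Icc_self hy
      exact mul_le_mul (hC y hy') (hD _ (hmem k hk y hy')) (norm_nonneg _)
        ((norm_nonneg _).trans (hC y hy'))
    · refine ae_of_all _ fun y _ => Tendsto.const_mul _ ?_
      have h1 : ContinuousAt a s := ha.continuousAt (Icc_mem_nhds hs.1 hs.2)
      have h2 : Tendsto (fun k : ℕ => s + y / (k : ℝ)) atTop (𝓝 s) := by
        simpa using tendsto_const_nhds.add (tendsto_const_div_atTop_nhds_zero_nat y)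
      exact h1.tendsto.comp h2
  have hval : ∫ y in (0 : ℝ)..1, deriv Real.smoothTransition y * a s = a s := by
    rw [intervalIntegral.integral_mul_const, intervalIntegral.integral_deriv_eq_sub
      (fun y _ => hσ.differentiable (by simp) y) (hσc.intervalIntegrable _ _)]
    simp
  rw [hval] at hlim
  refine hlim.congr' ?_
  filter_upwards [hlarge] with k hk
  exact (heq k hk).symm

/-- A continuous function on `[0,T]` with integrable distributional derivative `b` is a primitive
of `b`. -/
theorem sub_eq_integral_of_weak_deriv {T : ℝ} {a b : ℝ → ℝ}
    (ha : ContinuousOn a (Icc 0 T)) (hb : IntegrableOn b (Ioo 0 T))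
    (h : ∀ θ : ℝ → ℝ, IsTestFunction (Ioo 0 T) θ →
      ∫ t in Ioo 0 T, deriv θ t * a t = - ∫ t in Ioo 0 T, θ t * b t)
    {s t : ℝ} (hs : s ∈ Icc 0 T) (ht : t ∈ Icc 0 T) : a t - a s = ∫ r in s..t, b r := by
  have key : ∀ s ∈ Ioo 0 T, ∀ t ∈ Ioo 0 T, s < t → a t - a s = ∫ r in s..t, b r := by
    intro s hs t ht hst
    -- Smooth versions of the indicator of `(s, t]`, rising just after `s` and falling just after
    -- `t`. The support stays inside `(0, T)` as soon as `t + 1/k < T`.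
    let θ : ℕ → ℝ → ℝ := fun k r =>
      Real.smoothTransition (k * (r - s)) - Real.smoothTransition (k * (r - t))
    have hsm : ∀ (k : ℕ) (c : ℝ), ContDiff ℝ ∞ (fun r => Real.smoothTransition (k * (r - c))) :=
      fun k c => Real.smoothTransition.contDiff.comp (by fun_prop)
    have hlarge : ∀ᶠ k : ℕ in atTop, 0 < (k : ℝ) ∧ t + 1 / k < T := by
      have h1 : Tendsto (fun k : ℕ => t + 1 / (k : ℝ)) atTop (𝓝 (t + 0)) :=
        tendsto_const_nhds.add tendsto_one_div_atTop_nhds_zero_nat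
      rw [add_zero] at h1
      filter_upwards [h1.eventually_lt_const ht.2, eventually_gt_atTop 0] with k h2 h3
      exact ⟨by exact_mod_cast h3, h2⟩
    have htest : ∀ k : ℕ, 0 < (k : ℝ) ∧ t + 1 / k < T → IsTestFunction (Ioo 0 T) (θ k) := by
      intro k hk
      have hsupp : tsupport (θ k) ⊆ Icc s (t + 1 / k) := by
        refine closure_minimal (fun r hr => ?_) isClosed_Icc
        by_contra hr'
        apply hr
        rw [mem_Icc, not_and_or, not_le, not_le] at hr'
        simp only [θ]
        rcases hr' with h1 | h1
        · rw [Real.smoothTransition.zero_of_nonpos, Real.smoothTransition.zero_of_nonpos, sub_zero]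
          · exact mul_nonpos_of_nonneg_of_nonpos hk.1.le (by linarith)
          · exact mul_nonpos_of_nonneg_of_nonpos hk.1.le (by linarith)
        · have h2 : 1 / (k : ℝ) ≤ r - t := by linarith
          rw [div_le_iff₀ hk.1, mul_comm] at h2
          rw [Real.smoothTransition.one_of_one_le, Real.smoothTransition.one_of_one_le h2, sub_self]
          nlinarith [hk.1]
      refine ⟨(hsm k s).sub (hsm k t), isCompact_Icc.of_isClosed_subset (isClosed_tsupport _) hsupp,
        hsupp.trans fun r hr => ⟨hs.1.trans_le hr.1, hr.2.trans_lt hk.2⟩⟩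
    have haI : IntegrableOn a (Ioo 0 T) := (ha.integrableOn_Icc).mono_set Ioo_subset_Icc_self
    have l1 : Tendsto (fun k : ℕ => ∫ r in Ioo 0 T, deriv (θ k) r * a r) atTop
        (𝓝 (a s - a t)) := by
      refine ((tendsto_integral_deriv_smoothTransition ha hs).sub
        (tendsto_integral_deriv_smoothTransition ha ht)).congr fun k => ?_
      have hi : ∀ c, IntegrableOn (fun r => deriv (fun r => Real.smoothTransition (k * (r - c))) r
          * a r) (Ioo 0 T) := by
        intro c
        have hc : Continuous (deriv (fun r => Real.smoothTransition (k * (r - c)))) :=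
          (hsm k c).continuous_deriv (by simp)
        exact ((hc.continuousOn.mul ha).integrableOn_Icc).mono_set Ioo_subset_Icc_self
      rw [← integral_sub (hi s) (hi t)]
      congr 1 with r
      have : deriv (θ k) r = _ := deriv_fun_sub ((hsm k s).differentiable (by simp) r)
        ((hsm k t).differentiable (by simp) r)
      rw [this, sub_mul]
    have l2 : Tendsto (fun k : ℕ => ∫ r in Ioo 0 T, θ k r * b r) atTop
        (𝓝 (∫ r in Ioo 0 T, (Ioc s t).indicator b r)) := by
      refine tendsto_integral_of_dominated_convergence (fun r => ‖b r‖) (fun k => ?_) hb.norm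
        (fun k => ae_of_all _ fun r => ?_) (ae_of_all _ fun r => ?_)
      · exact (((hsm k s).sub (hsm k t)).continuous.aestronglyMeasurable).mul hb.1
      · rw [norm_mul]
        refine mul_le_of_le_one_left (norm_nonneg _) ?_
        rw [Real.norm_eq_abs, abs_le]
        have := Real.smoothTransition.nonneg (k * (r - s))
        have := Real.smoothTransition.nonneg (k * (r - t))
        have := Real.smoothTransition.le_one (k * (r - s))
        have := Real.smoothTransition.le_one (k * (r - t))
        constructor <;> simp only [θ] <;> linarith
      · have hone : ∀ c, c < r → ∀ᶠ k : ℕ in atTop, Real.smoothTransition (k * (r - c)) = 1 := by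
          intro c hc
          have : Tendsto (fun k : ℕ => (k : ℝ) * (r - c)) atTop atTop :=
            tendsto_natCast_atTop_atTop.atTop_mul_const (by linarith)
          filter_upwards [this.eventually_ge_atTop 1] with k hk
          exact Real.smoothTransition.one_of_one_le hk
        have hzero : ∀ c, r ≤ c → ∀ k : ℕ, Real.smoothTransition (k * (r - c)) = 0 := fun c hc k =>
          Real.smoothTransition.zero_of_nonpos
            (mul_nonpos_of_nonneg_of_nonpos k.cast_nonneg (by linarith))
        refine tendsto_const_nhds.congr' ?_
        by_cases h1 : r ≤ s
        · refine Eventually.of_forall fun k => ?_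
          simp [θ, hzero s h1 k, hzero t (h1.trans hst.le) k, h1]
        · rw [not_le] at h1
          by_cases h2 : r ≤ t
          · filter_upwards [hone s h1] with k hk
            simp [θ, hk, hzero t h2 k, h1, h2]
          · rw [not_le] at h2
            filter_upwards [hone s h1, hone t h2] with k hk hk'
            simp [θ, hk, hk', h2]
    have e : ∫ r in Ioo 0 T, (Ioc s t).indicator b r = ∫ r in s..t, b r := by
      rw [setIntegral_indicator measurableSet_Ioc, intervalIntegral.integral_of_le hst.le]
      congr 2
      exact inter_eq_right.2 fun r hr => ⟨hs.1.trans hr.1, hr.2.trans_lt ht.2⟩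
    rw [e] at l2
    have := tendsto_nhds_unique (l1.congr' ?_) l2.neg
    · linarith
    filter_upwards [hlarge] with k hk
    exact h _ (htest k hk)
  rcases le_or_gt T 0 with hT0 | hT0
  · have : s = t := by linarith [hs.1, hs.2, ht.1, ht.2]
    simp [this]
  have hbi : IntervalIntegrable b volume 0 T := by
    rw [intervalIntegrable_iff_integrableOn_Ioo_of_le hT0.le]; exact hb
  have hbi' : ∀ r ∈ Icc 0 T, IntervalIntegrable b volume 0 r := fun r hr =>
    hbi.mono_set (by rw [uIcc_of_le hr.1, uIcc_of_le hT0.le]; exact Icc_subset_Icc_right hr.2)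
  -- The argument so far only reaches interior times. The difference between `a` and the primitive
  -- of `b` is constant there and continuous up to the endpoints, which gives the closed interval.
  set c : ℝ → ℝ := fun r => a r - ∫ x in (0 : ℝ)..r, b x
  have hc : ContinuousOn c (Icc 0 T) := by
    refine ha.sub ?_
    have := intervalIntegral.continuousOn_primitive_interval (f := b) (a := 0) (b := T)
      (μ := volume) (by rw [uIcc_of_le hT0.le]; exact (integrableOn_Icc_iff_integrableOn_Ioo).2 hb)
    rwa [uIcc_of_le hT0.le] at this
  have hmid : T / 2 ∈ Ioo 0 T := ⟨by linarith, by linarith⟩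
  have hcc : EqOn c (fun _ => c (T / 2)) (Ioo 0 T) := by
    have h2 : ∀ p ∈ Ioo 0 T, ∀ q ∈ Ioo 0 T, p < q → c p = c q := by
      intro p hp q hq hpq
      have h3 := key p hp q hq hpq
      have h4 := intervalIntegral.integral_add_adjacent_intervals
        (hbi' p (Ioo_subset_Icc_self hp))
        ((hbi' p (Ioo_subset_Icc_self hp)).symm.trans (hbi' q (Ioo_subset_Icc_self hq)))
      simp only [c]
      linarith
    intro r hr
    rcases lt_trichotomy r (T / 2) with h1 | h1 | h1
    · exact h2 r hr _ hmid h1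
    · rw [h1]
    · exact (h2 _ hmid r hr h1).symm
  have hcc' := hcc.of_subset_closure hc continuousOn_const Ioo_subset_Icc_self
    (by rw [closure_Ioo hT0.ne])
  have h5 := hcc' hs
  have h6 := hcc' ht
  have h4 := intervalIntegral.integral_add_adjacent_intervals (hbi' s hs)
        ((hbi' s hs).symm.trans (hbi' t ht))
  simp only [c] at h5 h6
  linarith

theorem ae_eq_zero_of_forall_test {T : ℝ} {b : ℝ → ℝ} (hb : IntegrableOn b (Ioo 0 T))
    (h : ∀ θ : ℝ → ℝ, IsTestFunction (Ioo 0 T) θ → ∫ t in Ioo 0 T, θ t * b t = 0) :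
    ∀ᵐ t ∂volume.restrict (Ioo 0 T), b t = 0 := by
  rw [ae_restrict_iff' measurableSet_Ioo]
  refine isOpen_Ioo.ae_eq_zero_of_integral_contDiff_smul_eq_zero hb.locallyIntegrableOn ?_
  intro g hg hc hs
  rw [← h g ⟨hg, hc, hs⟩]
  exact (setIntegral_eq_integral_of_forall_compl_eq_zero fun x hx => by
    rw [image_eq_zero_of_notMem_tsupport fun h' => hx (hs h'), zero_smul]).symm

/-- The energy identity for a continuous curve in a Hilbert space with integrable weak
derivative. -/
theorem norm_sq_sub_eq_integral {H : Type*} [NormedAddCommGroup H] [InnerProductSpace ℝ H]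
    {T : ℝ} {U V : ℝ → H} {n : ℝ → ℝ} (hU : ContinuousOn U (Icc 0 T))
    (hn : IntegrableOn n (Ioo 0 T)) (hVn : ∀ᵐ r ∂volume.restrict (Ioo 0 T), ‖V r‖ ≤ n r)
    (hVg : ∀ τ ∈ Icc 0 T, IntegrableOn (fun r => inner ℝ (V r) (U τ)) (Ioo 0 T))
    (hVU : IntegrableOn (fun r => inner ℝ (V r) (U r)) (Ioo 0 T))
    (h : ∀ τ ∈ Icc 0 T, ∀ s ∈ Icc 0 T, ∀ t ∈ Icc 0 T,
      inner ℝ (U t) (U τ) - inner ℝ (U s) (U τ) = ∫ r in s..t, inner ℝ (V r) (U τ))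
    {t : ℝ} (ht : t ∈ Icc 0 T) :
    ‖U t‖ ^ 2 - ‖U 0‖ ^ 2 = 2 * ∫ r in (0 : ℝ)..t, inner ℝ (V r) (U r) := by
  have hT0 : 0 ≤ T := ht.1.trans ht.2
  have hii : ∀ f : ℝ → ℝ, IntegrableOn f (Ioo 0 T) → ∀ a ∈ Icc 0 T, ∀ b ∈ Icc 0 T,
      IntervalIntegrable f volume a b := by
    intro f hf a ha b hb
    have h1 : IntervalIntegrable f volume 0 T := by
      rw [intervalIntegrable_iff_integrableOn_Ioo_of_le hT0]; exact hf
    exact h1.mono_set (by rw [uIcc_of_le hT0]; exact uIcc_subset_Icc ha hb)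
  -- On a short interval `‖U q‖² - ‖U p‖² = ⟨U q - U p, U q⟩ + ⟨U q - U p, U p⟩`, and each bracket
  -- is a time integral of `V` against a frozen vector. Replacing the frozen vector by `U r` costs
  -- the modulus of continuity of `U`. Only scalar pairings of `V` and its majorant `n` occur, so
  -- Bochner measurability of `V` plays no role.
  have hloc : ∀ η > 0, ∃ δ > 0, ∀ p ∈ Icc 0 T, ∀ q ∈ Icc 0 T, p ≤ q → q - p < δ →
      |‖U q‖ ^ 2 - ‖U p‖ ^ 2 - 2 * ∫ r in p..q, inner ℝ (V r) (U r)|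
        ≤ 2 * η * ∫ r in p..q, n r := by
    intro η hη
    obtain ⟨δ, hδ, hUC⟩ := Metric.uniformContinuousOn_iff.1
      (isCompact_Icc.uniformContinuousOn_of_continuous hU) η hη
    refine ⟨δ, hδ, fun p hp q hq hpq hlt => ?_⟩
    have i1 := hii _ (hVg q hq) p hp q hq
    have i2 := hii _ (hVg p hp) p hp q hq
    have i3 := hii _ hVU p hp q hq
    have e : ‖U q‖ ^ 2 - ‖U p‖ ^ 2 - 2 * ∫ r in p..q, inner ℝ (V r) (U r)
        = ∫ r in p..q, (inner ℝ (V r) (U q) + inner ℝ (V r) (U p) - 2 * inner ℝ (V r) (U r)) := by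
      rw [intervalIntegral.integral_sub (i1.add i2) (i3.const_mul 2),
        intervalIntegral.integral_add i1 i2, intervalIntegral.integral_const_mul,
        ← h q hq p hp q hq, ← h p hp p hp q hq, real_inner_self_eq_norm_sq,
        real_inner_self_eq_norm_sq, real_inner_comm (U p) (U q)]
      ring
    rw [e, ← intervalIntegral.integral_const_mul, ← Real.norm_eq_abs]
    refine intervalIntegral.norm_integral_le_of_norm_le hpq ?_ ((hii n hn p hp q hq).const_mul _)
    have h0 : ∀ᵐ r, r ∈ Ioo 0 T → ‖V r‖ ≤ n r := (ae_restrict_iff' measurableSet_Ioo).1 hVn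
    have hq' : ∀ᵐ r : ℝ, r ≠ q := by simp [ae_iff]
    filter_upwards [h0, hq'] with r hr hrq hmem
    have hrT : r ∈ Ioo 0 T := ⟨hp.1.trans_lt hmem.1, (lt_of_le_of_ne hmem.2 hrq).trans_le hq.2⟩
    have hrI := Ioo_subset_Icc_self hrT
    have e2 : inner ℝ (V r) (U q) + inner ℝ (V r) (U p) - 2 * inner ℝ (V r) (U r)
        = inner ℝ (V r) (U q - U r) + inner ℝ (V r) (U p - U r) := by
      rw [inner_sub_right, inner_sub_right]; ring
    have d1 : ‖U q - U r‖ ≤ η := by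
      rw [← dist_eq_norm]
      refine (hUC q hq r hrI ?_).le
      rw [Real.dist_eq, abs_of_nonneg (by linarith [hmem.2])]
      linarith [hmem.1]
    have d2 : ‖U p - U r‖ ≤ η := by
      rw [← dist_eq_norm]
      refine (hUC p hp r hrI ?_).le
      rw [Real.dist_eq, abs_of_nonpos (by linarith [hmem.1])]
      linarith [hmem.2]
    rw [e2]
    refine (norm_add_le _ _).trans ?_
    have b1 := (norm_inner_le_norm (𝕜 := ℝ) (V r) (U q - U r))
    have b2 := (norm_inner_le_norm (𝕜 := ℝ) (V r) (U p - U r))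
    have hV0 := norm_nonneg (V r)
    have c1 : ‖V r‖ * ‖U q - U r‖ ≤ n r * η := by
      exact mul_le_mul (hr hrT) d1 (norm_nonneg _) (hV0.trans (hr hrT))
    have c2 : ‖V r‖ * ‖U p - U r‖ ≤ n r * η := by
      exact mul_le_mul (hr hrT) d2 (norm_nonneg _) (hV0.trans (hr hrT))
    linarith
  -- Sum the local estimate over a uniform partition of mesh below `δ`; the errors add up to `η`
  -- times the integral of `n`, independently of the number of pieces.
  have hglob : ∀ η > 0, |‖U t‖ ^ 2 - ‖U 0‖ ^ 2 - 2 * ∫ r in (0 : ℝ)..t, inner ℝ (V r) (U r)|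
      ≤ 2 * η * ∫ r in (0 : ℝ)..t, n r := by
    intro η hη
    obtain ⟨δ, hδ, hloc⟩ := hloc η hη
    obtain ⟨N, hN⟩ := exists_nat_gt (t / δ)
    have hN0 : 0 < (N : ℝ) := (div_nonneg ht.1 hδ.le).trans_lt hN
    let p : ℕ → ℝ := fun i => i * (t / N)
    have hp0 : p 0 = 0 := by simp [p]
    have hpN : p N = t := by simp only [p]; field_simp
    have hstep : ∀ i, p (i + 1) - p i = t / N := fun i => by simp only [p]; push_cast; ring
    have htN : 0 ≤ t / N := div_nonneg ht.1 hN0.le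
    have hpm : ∀ i ≤ N, p i ∈ Icc 0 T := by
      intro i hi
      refine ⟨mul_nonneg i.cast_nonneg htN, le_trans ?_ ht.2⟩
      rw [← hpN]
      exact mul_le_mul_of_nonneg_right (by exact_mod_cast hi) htN
    have hsmall : t / N < δ := by
      rw [div_lt_iff₀ hN0, mul_comm, ← div_lt_iff₀ hδ]; exact hN
    have s1 : ∑ i ∈ Finset.range N, (‖U (p (i + 1))‖ ^ 2 - ‖U (p i)‖ ^ 2)
        = ‖U t‖ ^ 2 - ‖U 0‖ ^ 2 := by
      rw [Finset.sum_range_sub (fun i => ‖U (p i)‖ ^ 2), hpN, hp0]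
    have s2 : ∀ f : ℝ → ℝ, IntegrableOn f (Ioo 0 T) →
        ∑ i ∈ Finset.range N, ∫ r in p i..p (i + 1), f r = ∫ r in (0 : ℝ)..t, f r := by
      intro f hf
      rw [intervalIntegral.sum_integral_adjacent_intervals, hp0, hpN]
      exact fun k hk => hii f hf _ (hpm k hk.le) _ (hpm (k + 1) hk)
    rw [← s1, ← s2 _ hVU, ← s2 _ hn, Finset.mul_sum, Finset.mul_sum, ← Finset.sum_sub_distrib]
    refine (Finset.abs_sum_le_sum_abs _ _).trans (Finset.sum_le_sum fun i hi => ?_)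
    have hi' := Finset.mem_range.1 hi
    refine hloc _ (hpm i hi'.le) _ (hpm (i + 1) hi') ?_ ?_
    · linarith [hstep i]
    · rw [hstep]; exact hsmall
  have hn0 : 0 ≤ ∫ r in (0 : ℝ)..t, n r := by
    have := (abs_nonneg _).trans (hglob 1 one_pos)
    linarith
  have hle : |‖U t‖ ^ 2 - ‖U 0‖ ^ 2 - 2 * ∫ r in (0 : ℝ)..t, inner ℝ (V r) (U r)| ≤ 0 := by
    refine le_of_forall_pos_le_add fun ε hε => ?_
    set I := ∫ r in (0 : ℝ)..t, n r
    refine (hglob (ε / (2 * (I + 1))) (by positivity)).trans ?_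
    rw [zero_add]
    have : 2 * (ε / (2 * (I + 1))) * I = ε * (I / (I + 1)) := by
      field_simp
    rw [this]
    exact mul_le_of_le_one_right hε.le ((div_le_one (by positivity)).2 (by linarith))
  have := abs_nonpos_iff.1 hle
  linarith

/-- Weakly convergent, uniformly Lipschitz functions of time converge almost everywhere. -/
theorem ae_tendsto_of_lipschitz_of_weak {T : ℝ} {a : ℕ → ℝ → ℝ} {b : ℝ → ℝ} {L : ℝ}
    (hL : ∀ n, ∀ s ∈ Icc 0 T, ∀ t ∈ Icc 0 T, |a n t - a n s| ≤ L * |t - s|)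
    (hb : IntegrableOn b (Ioo 0 T))
    (h : ∀ s t, Icc s t ⊆ Ioo 0 T →
      Tendsto (fun n => ∫ r in Icc s t, a n r) atTop (𝓝 (∫ r in Icc s t, b r))) :
    ∀ᵐ t ∂volume.restrict (Ioo 0 T), Tendsto (fun n => a n t) atTop (𝓝 (b t)) := by
  have hbi : Integrable ((Ioo 0 T).indicator b) := (integrable_indicator_iff measurableSet_Ioo).2 hb
  -- At a Lebesgue point `t` of `b`, averages of `b` over small intervals are close to `b t`. The
  -- same averages of `a n` differ from `a n t` by at most `|L|δ`, uniformly in `n`, and at fixed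
  -- `δ` they converge by hypothesis.
  have hleb := IsUnifLocDoublingMeasure.ae_tendsto_average (μ := (volume : Measure ℝ))
    hbi.locallyIntegrable 1
  rw [ae_restrict_iff' measurableSet_Ioo]
  filter_upwards [hleb] with t ht htT
  have h1 : Tendsto (fun δ => ⨍ y in Metric.closedBall t δ, (Ioo 0 T).indicator b y) (𝓝[>] 0)
      (𝓝 (b t)) := by
    have := ht (l := 𝓝[>] (0 : ℝ)) (fun _ => t) id tendsto_id ?_
    · simpa [htT] using this
    · filter_upwards [self_mem_nhdsWithin] with δ hδ
      simpa using (le_of_lt hδ)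
  rw [Metric.tendsto_atTop]
  intro ε hε
  have e1 : ∀ᶠ δ in 𝓝[>] (0 : ℝ),
      dist (⨍ y in Metric.closedBall t δ, (Ioo 0 T).indicator b y) (b t) < ε / 3 :=
    h1 (Metric.ball_mem_nhds _ (by positivity))
  have e2 : ∀ᶠ δ in 𝓝[>] (0 : ℝ), |L| * δ < ε / 3 := by
    have : Tendsto (fun δ : ℝ => |L| * δ) (𝓝[>] 0) (𝓝 (|L| * 0)) :=
      (tendsto_nhdsWithin_of_tendsto_nhds tendsto_id).const_mul _
    rw [mul_zero] at this
    exact this.eventually_lt_const (by positivity)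
  have e3 : ∀ᶠ δ in 𝓝[>] (0 : ℝ), Metric.closedBall t δ ⊆ Ioo 0 T := by
    obtain ⟨r, hr, hr'⟩ := Metric.nhds_basis_closedBall.mem_iff.1 (Ioo_mem_nhds htT.1 htT.2)
    filter_upwards [Ioo_mem_nhdsGT hr] with δ hδ
    exact (Metric.closedBall_subset_closedBall hδ.2.le).trans hr'
  obtain ⟨δ, h2, h3, h4, hδ⟩ := (e1.and (e2.and (e3.and self_mem_nhdsWithin))).exists
  have hδ' : 0 < δ := hδ
  have hvol : volume.real (Metric.closedBall t δ) = 2 * δ := by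
    rw [measureReal_def, Real.volume_closedBall, ENNReal.toReal_ofReal (by positivity)]
  have hav : ⨍ y in Metric.closedBall t δ, (Ioo 0 T).indicator b y
      = (2 * δ)⁻¹ * ∫ y in Metric.closedBall t δ, b y := by
    rw [setAverage_eq, hvol, smul_eq_mul]
    congr 1
    exact setIntegral_congr_fun Metric.isClosed_closedBall.measurableSet fun y hy => by
      simp [h4 hy]
  have hcont : ∀ n, ContinuousOn (a n) (Icc 0 T) := by
    intro n
    have : LipschitzOnWith L.toNNReal (a n) (Icc 0 T) := by
      refine LipschitzOnWith.of_dist_le_mul fun x hx y hy => ?_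
      rw [Real.dist_eq, Real.dist_eq]
      exact (hL n y hy x hx).trans (mul_le_mul_of_nonneg_right (Real.le_coe_toNNReal L)
        (abs_nonneg _))
    exact this.continuousOn
  have hconv : Tendsto (fun n => (2 * δ)⁻¹ * ∫ y in Metric.closedBall t δ, a n y) atTop
      (𝓝 ((2 * δ)⁻¹ * ∫ y in Metric.closedBall t δ, b y)) := by
    rw [Real.closedBall_eq_Icc] at h4 ⊢
    exact (h _ _ h4).const_mul _
  obtain ⟨N, hN⟩ := Metric.tendsto_atTop.1 hconv (ε / 3) (by positivity)
  refine ⟨N, fun n hn => ?_⟩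
  have h5 := hN n hn
  have h6 : |(2 * δ)⁻¹ * (∫ y in Metric.closedBall t δ, a n y) - a n t| ≤ |L| * δ := by
    have i1 : IntegrableOn (a n) (Metric.closedBall t δ) :=
      ((hcont n).mono (h4.trans Ioo_subset_Icc_self)).integrableOn_compact
        (isCompact_closedBall t δ)
    have : (2 * δ)⁻¹ * (∫ y in Metric.closedBall t δ, a n y) - a n t
        = (2 * δ)⁻¹ * ∫ y in Metric.closedBall t δ, (a n y - a n t) := by
      rw [integral_sub i1 (integrableOn_const measure_closedBall_lt_top.ne),
        setIntegral_const, hvol, smul_eq_mul]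
      field_simp
    rw [this, abs_mul, abs_of_pos (by positivity : 0 < (2 * δ)⁻¹), ← Real.norm_eq_abs (∫ y in _, _)]
    have hb := norm_setIntegral_le_of_norm_le_const (μ := volume) (s := Metric.closedBall t δ)
      (f := fun y => a n y - a n t) (C := |L| * δ) measure_closedBall_lt_top (fun y hy => ?_)
    · rw [hvol] at hb
      calc (2 * δ)⁻¹ * _ ≤ (2 * δ)⁻¹ * (|L| * δ * (2 * δ)) :=
            mul_le_mul_of_nonneg_left hb (by positivity)
        _ = |L| * δ := by field_simp
    · rw [Real.norm_eq_abs]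
      refine (hL n t (Ioo_subset_Icc_self htT) y (Ioo_subset_Icc_self (h4 hy))).trans ?_
      rw [Metric.mem_closedBall, Real.dist_eq] at hy
      exact mul_le_mul (le_abs_self L) hy (abs_nonneg _) (abs_nonneg _)
  rw [hav] at h2
  rw [Real.dist_eq] at h2 h5 ⊢
  rw [abs_lt] at h2 h5 ⊢
  rw [abs_le] at h6
  constructor <;> linarith [h2.1, h2.2, h5.1, h5.2, h6.1, h6.2]

end Time

/-! ### Mollification in the space variable -/

section Mollification

/-- Convolution of the function `b` on the plane with the kernel `k`. -/
noncomputable def kconv (k b : Plane → ℝ) (x : Plane) : ℝ := ∫ y, b y * k (x - y)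

/-- Convolution in the space variable. -/
noncomputable def spaceConv (k : Plane → ℝ) (a : ℝ × Plane → ℝ) (z : ℝ × Plane) : ℝ :=
  kconv k (fun y => a (z.1, y)) z.2

theorem kconv_eq_convolution (k b : Plane → ℝ) :
    kconv k b = convolution b k (ContinuousLinearMap.mul ℝ ℝ) volume := by
  ext x
  simp [kconv, convolution_def]

theorem contDiff_kconv {k b : Plane → ℝ} (hk : ContDiff ℝ 1 k) (hkc : HasCompactSupport k)
    (hb : LocallyIntegrable b) : ContDiff ℝ 1 (kconv k b) := by
  rw [kconv_eq_convolution]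
  exact hkc.contDiff_convolution_right _ hb hk

theorem fderiv_kconv {k b : Plane → ℝ} (hk : ContDiff ℝ 1 k) (hkc : HasCompactSupport k)
    (hb : LocallyIntegrable b) (x v : Plane) :
    fderiv ℝ (kconv k b) x v = kconv (fun y => fderiv ℝ k y v) b x := by
  rw [kconv_eq_convolution, kconv_eq_convolution,
    (hkc.hasFDerivAt_convolution_right _ hb hk x).fderiv,
    convolution_precompR_apply _ hb (hkc.fderiv ℝ) (hk.continuous_fderiv one_ne_zero)]

theorem stronglyMeasurable_spaceConv {k : Plane → ℝ} (hk : Continuous k) {a : ℝ × Plane → ℝ}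
    (ha : StronglyMeasurable a) : StronglyMeasurable (spaceConv k a) := by
  have h : StronglyMeasurable (fun p : (ℝ × Plane) × Plane => a (p.1.1, p.2) * k (p.1.2 - p.2)) := by
    refine StronglyMeasurable.mul (ha.comp_measurable (by fun_prop)) ?_
    exact (hk.comp (by fun_prop)).stronglyMeasurable
  exact h.integral_prod_right'

theorem memLp_comp_sub_left {k : Plane → ℝ} (hk : MemLp k 2 volume) (x : Plane) :
    MemLp (fun y => k (x - y)) 2 volume ∧
      eLpNorm (fun y => k (x - y)) 2 volume = eLpNorm k 2 volume := by
  have hmp := Measure.measurePreserving_sub_left (volume : Measure Plane) x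
  exact ⟨hk.comp_measurePreserving hmp, eLpNorm_comp_measurePreserving hk.1 hmp⟩

theorem abs_kconv_le {k b : Plane → ℝ} (hk : MemLp k 2 volume) (hb : MemLp b 2 volume) {B : ℝ≥0}
    (hB : eLpNorm b 2 volume ≤ B) (x : Plane) :
    |kconv k b x| ≤ B * (eLpNorm k 2 volume).toReal := by
  obtain ⟨h1, h2⟩ := memLp_comp_sub_left hk x
  refine (abs_integral_mul_le hb h1).trans ?_
  rw [h2]
  exact mul_le_mul_of_nonneg_right (ENNReal.toReal_le_coe_of_le_coe hB) ENNReal.toReal_nonneg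

/-- A smooth even probability density supported in the ball of radius `ε`. -/
structure IsMollifier (ρ : Plane → ℝ) (ε : ℝ) : Prop where
  contDiff : ContDiff ℝ ∞ ρ
  nonneg : ∀ x, 0 ≤ ρ x
  integral_eq_one : ∫ x, ρ x = 1
  tsupport_subset : tsupport ρ ⊆ Metric.closedBall 0 ε
  neg : ∀ x, ρ (-x) = ρ x

theorem exists_isMollifier {ε : ℝ} (hε : 0 < ε) : ∃ ρ, IsMollifier ρ ε := by
  let f : ContDiffBump (0 : Plane) := ⟨ε / 2, ε, by positivity, by linarith⟩
  exact ⟨f.normed volume, f.contDiff_normed, f.nonneg_normed, f.integral_normed,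
    f.tsupport_normed_eq.subset, f.normed_neg⟩

namespace IsMollifier

variable {ρ : Plane → ℝ} {ε : ℝ} (hρ : IsMollifier ρ ε)
include hρ

theorem hasCompactSupport : HasCompactSupport ρ :=
  (isCompact_closedBall (0 : Plane) ε).of_isClosed_subset (isClosed_tsupport _) hρ.tsupport_subset

theorem isTestFunction : IsTestFunction univ ρ := ⟨hρ.contDiff, hρ.hasCompactSupport, subset_univ _⟩

theorem isTestFunction_sub {δ : ℝ} (hε : ε < δ) (x : Plane) :
    IsTestFunction (Metric.ball x δ) (fun y => ρ (x - y)) := by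
  have hs : tsupport (fun y => ρ (x - y)) ⊆ Metric.closedBall x ε := by
    refine closure_minimal (fun y hy => ?_) Metric.isClosed_closedBall
    have := hρ.tsupport_subset (subset_tsupport ρ hy)
    rw [mem_closedBall_zero_iff] at this
    rwa [Metric.mem_closedBall, dist_comm, dist_eq_norm]
  exact ⟨hρ.contDiff.comp (contDiff_const.sub contDiff_id),
    (isCompact_closedBall x ε).of_isClosed_subset (isClosed_tsupport _) hs,
    hs.trans (Metric.closedBall_subset_ball hε)⟩

theorem fderiv_sub (x y v : Plane) :
    fderiv ℝ (fun y => ρ (x - y)) y v = - fderiv ℝ ρ (x - y) v := by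
  have h1 : HasFDerivAt (fun y => x - y) (-ContinuousLinearMap.id ℝ Plane) y := by
    simpa using (hasFDerivAt_id y).const_sub x
  have := ((hρ.contDiff.differentiable (by simp) (x - y)).hasFDerivAt.comp y h1).fderiv
  have h2 : fderiv ℝ (fun y => ρ (x - y)) y = _ := this
  rw [h2]
  simp

theorem lintegral_eq_one : ∫⁻ x, ENNReal.ofReal (ρ x) = 1 := by
  rw [← ofReal_integral_eq_lintegral_ofReal
    (hρ.contDiff.continuous.integrable_of_hasCompactSupport hρ.hasCompactSupport)
    (ae_of_all _ hρ.nonneg), hρ.integral_eq_one, ENNReal.ofReal_one]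

/-- The probability measure with density `ρ`. -/
theorem isProbabilityMeasure :
    IsProbabilityMeasure (volume.withDensity fun x => ENNReal.ofReal (ρ x)) :=
  ⟨by rw [withDensity_apply _ MeasurableSet.univ, setLIntegral_univ, hρ.lintegral_eq_one]⟩

theorem ae_norm_le : ∀ᵐ h ∂(volume.withDensity fun x => ENNReal.ofReal (ρ x)), ‖h‖ ≤ ε := by
  rw [ae_withDensity_iff hρ.contDiff.continuous.measurable.ennreal_ofReal]
  refine ae_of_all _ fun x hx => ?_
  have h0 : ρ x ≠ 0 := fun h => hx (by simp [h])
  simpa using hρ.tsupport_subset (subset_tsupport ρ h0)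

theorem integral_withDensity (g : Plane → ℝ) :
    ∫ h, g h ∂(volume.withDensity fun x => ENNReal.ofReal (ρ x)) = ∫ h, ρ h * g h := by
  rw [integral_withDensity_eq_integral_toReal_smul
    hρ.contDiff.continuous.measurable.ennreal_ofReal (ae_of_all _ fun x => ENNReal.ofReal_lt_top)]
  simp only [ENNReal.toReal_ofReal (hρ.nonneg _), smul_eq_mul]

/-- Convolution becomes an average of translates over a probability measure, so Jensen's inequality
turns translation bounds into bounds on the mollification and on its error. -/
theorem kconv_eq (b : Plane → ℝ) (x : Plane) :
    kconv ρ b x = ∫ h, b (x - h) ∂(volume.withDensity fun x => ENNReal.ofReal (ρ x)) := by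
  rw [hρ.integral_withDensity, kconv, ← integral_sub_left_eq_self _ volume x]
  congr 1 with h
  rw [sub_sub_cancel, mul_comm]

theorem kconv_sub_eq {b : Plane → ℝ} (hb : MemLp b 2 volume) (x : Plane) :
    kconv ρ b x - b x
      = ∫ h, (b (x - h) - b x) ∂(volume.withDensity fun x => ENNReal.ofReal (ρ x)) := by
  have := hρ.isProbabilityMeasure
  have hi : Integrable (fun h => b (x - h)) (volume.withDensity fun x => ENNReal.ofReal (ρ x)) := by
    rw [integrable_withDensity_iff_integrable_smul'
      hρ.contDiff.continuous.measurable.ennreal_ofReal (ae_of_all _ fun x => ENNReal.ofReal_lt_top)]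
    simp only [ENNReal.toReal_ofReal (hρ.nonneg _), smul_eq_mul]
    exact (hρ.isTestFunction.memLp volume 2).integrable_mul_two (memLp_comp_sub_left hb x).1
  rw [integral_sub hi (integrable_const _), ← hρ.kconv_eq]
  simp

end IsMollifier

theorem lintegral_sq_le_of_prob {X : Type*} [MeasurableSpace X] {P : Measure X}
    [IsProbabilityMeasure P] {f : X → ℝ} (hf : AEStronglyMeasurable f P) :
    (∫⁻ x, ‖f x‖ₑ ∂P) ^ 2 ≤ ∫⁻ x, ‖f x‖ₑ ^ 2 ∂P := by
  rw [lintegral_enorm_sq_eq, ← eLpNorm_one_eq_lintegral_enorm]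
  exact pow_le_pow_left₀ zero_le (eLpNorm_le_eLpNorm_of_exponent_le one_le_two hf) 2

/-- Averages over a probability measure do not increase the `L²` norm. -/
theorem eLpNorm_integral_prob_le {X Y : Type*} [MeasurableSpace X] [MeasurableSpace Y]
    {m : Measure X} [SFinite m] {P : Measure Y} [IsProbabilityMeasure P] {f : X × Y → ℝ}
    (hf : StronglyMeasurable f) {B : ℝ≥0∞}
    (hB : ∀ᵐ y ∂P, eLpNorm (fun x => f (x, y)) 2 m ≤ B) :
    eLpNorm (fun x => ∫ y, f (x, y) ∂P) 2 m ≤ B := by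
  apply eLpNorm_two_le_of_lintegral_le
  calc ∫⁻ x, ‖∫ y, f (x, y) ∂P‖ₑ ^ 2 ∂m
      ≤ ∫⁻ x, ∫⁻ y, ‖f (x, y)‖ₑ ^ 2 ∂P ∂m := by
        refine lintegral_mono fun x => ?_
        refine (pow_le_pow_left₀ zero_le (enorm_integral_le_lintegral_enorm _) 2).trans ?_
        exact lintegral_sq_le_of_prob (hf.comp_measurable measurable_prodMk_left).aestronglyMeasurable
    _ = ∫⁻ y, ∫⁻ x, ‖f (x, y)‖ₑ ^ 2 ∂m ∂P :=
        lintegral_lintegral_swap (hf.enorm.pow_const 2).aemeasurable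
    _ ≤ ∫⁻ _, B ^ 2 ∂P := by
        refine lintegral_mono_ae ?_
        filter_upwards [hB] with y hy
        rw [lintegral_enorm_sq_eq]
        exact pow_le_pow_left₀ zero_le hy 2
    _ = B ^ 2 := by simp

variable {μ : Measure ℝ} [IsFiniteMeasure μ] {ρ : Plane → ℝ} {ε : ℝ}

theorem measurePreserving_translate (μ : Measure ℝ) [SFinite μ] (h : Plane) :
    MeasurePreserving (fun z : ℝ × Plane => (z.1, z.2 - h)) (μ.prod volume) (μ.prod volume) :=
  (MeasurePreserving.id μ).prod (measurePreserving_sub_right volume h)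

theorem eLpNorm_spaceConv_le (hρ : IsMollifier ρ ε) {a : ℝ × Plane → ℝ} (ha : StronglyMeasurable a) :
    eLpNorm (spaceConv ρ a) 2 (μ.prod volume) ≤ eLpNorm a 2 (μ.prod volume) := by
  have := hρ.isProbabilityMeasure
  have e : spaceConv ρ a = fun z => ∫ h, a (z.1, z.2 - h)
      ∂(volume.withDensity fun x => ENNReal.ofReal (ρ x)) := by
    ext z
    exact hρ.kconv_eq _ _
  rw [e]
  refine eLpNorm_integral_prob_le (f := fun p : (ℝ × Plane) × Plane => a (p.1.1, p.1.2 - p.2))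
    (ha.comp_measurable (by fun_prop)) (ae_of_all _ fun h => le_of_eq ?_)
  exact eLpNorm_comp_measurePreserving ha.aestronglyMeasurable (measurePreserving_translate μ h)

theorem memLp_spaceConv (hρ : IsMollifier ρ ε) {a : ℝ × Plane → ℝ} (ha : StronglyMeasurable a)
    (ha2 : MemLp a 2 (μ.prod volume)) : MemLp (spaceConv ρ a) 2 (μ.prod volume) :=
  ⟨(stronglyMeasurable_spaceConv hρ.contDiff.continuous ha).aestronglyMeasurable,
    (eLpNorm_spaceConv_le hρ ha).trans_lt ha2.2⟩

/-- The error is an average of the differences `a(·, · - h) - a` over `‖h‖ ≤ ε`, so a Lipschitz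
translation bound gives the rate `ε`. -/
theorem eLpNorm_spaceConv_sub_le (hρ : IsMollifier ρ ε) {a : ℝ × Plane → ℝ}
    (ha : StronglyMeasurable a) (ha2 : MemLp a 2 (μ.prod volume)) {C : ℝ≥0}
    (hC : ∀ h : Plane, eLpNorm (fun z => a (z.1, z.2 - h) - a z) 2 (μ.prod volume) ≤ C * ‖h‖ₑ) :
    eLpNorm (fun z => spaceConv ρ a z - a z) 2 (μ.prod volume) ≤ C * ENNReal.ofReal ε := by
  have := hρ.isProbabilityMeasure
  have e : (fun z => spaceConv ρ a z - a z) =ᵐ[μ.prod volume]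
      fun z => ∫ h, (a (z.1, z.2 - h) - a z)
        ∂(volume.withDensity fun x => ENNReal.ofReal (ρ x)) := by
    have h1 : ∀ᵐ z ∂(μ.prod (volume : Measure Plane)), MemLp (fun y => a (z.1, y)) 2 volume :=
      Measure.quasiMeasurePreserving_fst.ae ha2.ae_slice
    filter_upwards [h1] with z hz
    exact hρ.kconv_sub_eq hz z.2
  rw [eLpNorm_congr_ae e]
  refine eLpNorm_integral_prob_le
    (f := fun p : (ℝ × Plane) × Plane => a (p.1.1, p.1.2 - p.2) - a p.1)
    ((ha.comp_measurable (by fun_prop)).sub (ha.comp_measurable measurable_fst)) ?_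
  filter_upwards [hρ.ae_norm_le] with h hh
  refine (hC h).trans (mul_le_mul_right ?_ _)
  rw [← ofReal_norm]
  exact ENNReal.ofReal_le_ofReal hh

/-- Mollification is self-adjoint because `ρ` is even. Fubini is justified by `2|bg|ρ ≤ (b² + g²)ρ`,
whose two terms are integrable convolution integrands. -/
theorem integral_kconv_mul (hρ : IsMollifier ρ ε) {b g : Plane → ℝ} (hb : MemLp b 2 volume)
    (hg : MemLp g 2 volume) : ∫ x, kconv ρ b x * g x = ∫ x, b x * kconv ρ g x := by
  have hρi : Integrable ρ :=
    hρ.contDiff.continuous.integrable_of_hasCompactSupport hρ.hasCompactSupport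
  have hint : Integrable (fun p : Plane × Plane => b p.2 * ρ (p.1 - p.2) * g p.1)
      (volume.prod volume) := by
    have h1 : Integrable (fun p : Plane × Plane => b p.2 ^ 2 * ρ (p.1 - p.2)) (volume.prod volume) :=
      Integrable.convolution_integrand (ContinuousLinearMap.mul ℝ ℝ) hb.integrable_sq hρi
    have h2 : Integrable (fun p : Plane × Plane => g p.1 ^ 2 * ρ (p.1 - p.2))
        (volume.prod volume) := by
      have := (Integrable.convolution_integrand (ContinuousLinearMap.mul ℝ ℝ) hg.integrable_sq
        hρi).swap
      refine this.congr (ae_of_all _ fun p => ?_)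
      simp only [Function.comp, Prod.fst_swap, Prod.snd_swap, ContinuousLinearMap.mul_apply']
      rw [← neg_sub p.1 p.2, hρ.neg]
    refine (h1.add h2).mono ?_ (ae_of_all _ fun p => ?_)
    · exact ((hb.1.comp_snd).mul
        (hρ.contDiff.continuous.comp continuous_sub).aestronglyMeasurable).mul hg.1.comp_fst
    · simp only [Pi.add_apply]
      have h0 := hρ.nonneg (p.1 - p.2)
      rw [Real.norm_of_nonneg (r := _ + _)
        (add_nonneg (mul_nonneg (sq_nonneg _) h0) (mul_nonneg (sq_nonneg _) h0)),
        Real.norm_eq_abs, abs_le]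
      constructor <;> nlinarith [mul_nonneg h0 (sq_nonneg (b p.2 - g p.1)),
        mul_nonneg h0 (sq_nonneg (b p.2 + g p.1)), mul_nonneg h0 (sq_nonneg (b p.2)),
        mul_nonneg h0 (sq_nonneg (g p.1))]
  simp only [kconv, ← integral_mul_const, ← integral_const_mul]
  rw [integral_integral_swap hint]
  congr 1 with y
  congr 1 with x
  rw [← neg_sub x y, hρ.neg]
  ring

theorem integral_spaceConv_mul (hρ : IsMollifier ρ ε) {a g : ℝ × Plane → ℝ}
    (ha : StronglyMeasurable a) (ha2 : MemLp a 2 (μ.prod volume)) (hg : StronglyMeasurable g)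
    (hg2 : MemLp g 2 (μ.prod volume)) :
    ∫ z, spaceConv ρ a z * g z ∂(μ.prod volume) = ∫ z, a z * spaceConv ρ g z ∂(μ.prod volume) := by
  rw [integral_prod _ ((memLp_spaceConv hρ ha ha2).integrable_mul_two hg2),
    integral_prod _ (ha2.integrable_mul_two (memLp_spaceConv hρ hg hg2))]
  refine integral_congr_ae ?_
  filter_upwards [ha2.ae_slice, hg2.ae_slice] with t h1 h2
  exact integral_kconv_mul hρ h1 h2

/-- By self-adjointness the mollifier moves onto the test function. That function is first replaced
by a strongly measurable representative, as required by the measurability of slicewise convolution.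
-/
theorem WeakL2.spaceConv {ι : Type*} {l : Filter ι} (hρ : IsMollifier ρ ε)
    {a : ι → ℝ × Plane → ℝ} {b : ℝ × Plane → ℝ}
    (ha : ∀ n, StronglyMeasurable (a n)) (hb : StronglyMeasurable b)
    (h : WeakL2 (μ.prod volume) l a b) :
    WeakL2 (μ.prod volume) l (fun n => spaceConv ρ (a n)) (spaceConv ρ b) := by
  refine ⟨fun n => memLp_spaceConv hρ (ha n) (h.1 n), memLp_spaceConv hρ hb h.2.1, fun g hg => ?_⟩
  have hgm := hg.1.stronglyMeasurable_mk
  have hg' : MemLp (hg.1.mk g) 2 (μ.prod volume) := hg.ae_eq hg.1.ae_eq_mk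
  have e : ∀ f : ℝ × Plane → ℝ, StronglyMeasurable f → MemLp f 2 (μ.prod volume) →
      ∫ z, _root_.spaceConv ρ f z * g z ∂(μ.prod volume)
        = ∫ z, f z * _root_.spaceConv ρ (hg.1.mk g) z ∂(μ.prod volume) := by
    intro f hf hf2
    rw [← integral_spaceConv_mul hρ hf hf2 hgm hg']
    refine integral_congr_ae ?_
    filter_upwards [hg.1.ae_eq_mk] with z hz
    rw [hz]
  rw [e b hb h.2.1]
  simp only [fun n => e (a n) (ha n) (h.1 n)]
  exact h.2.2 _ (memLp_spaceConv hρ hgm hg')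

end Mollification

/-! ### Compensated compactness of the quadratic form -/

section CompensatedCompactness

theorem L2Tendsto.of_dominated {X : Type*} [MeasurableSpace X] {m : Measure X} {f : ℕ → X → ℝ}
    {g G : X → ℝ} (hf : ∀ n, AEStronglyMeasurable (f n) m) (hg : AEStronglyMeasurable g m)
    (hG : MemLp G 2 m) (hb : ∀ n, ∀ᵐ x ∂m, |f n x| ≤ G x)
    (hl : ∀ᵐ x ∂m, Tendsto (fun n => f n x) atTop (𝓝 (g x))) : L2Tendsto m f g := by
  have hbg : ∀ᵐ x ∂m, |g x| ≤ G x := by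
    filter_upwards [ae_all_iff.2 hb, hl] with x h1 h2
    exact le_of_tendsto h2.abs (Eventually.of_forall h1)
  refine ⟨fun n => hG.mono' (hf n) (hb n), hG.mono' hg hbg, ?_⟩
  have h1 : Tendsto (fun n => ∫⁻ x, ‖f n x - g x‖ₑ ^ 2 ∂m) atTop (𝓝 (∫⁻ _, 0 ∂m)) := by
    refine tendsto_lintegral_of_dominated_convergence' (fun x => ‖2 * G x‖ₑ ^ 2)
      (fun n => ((hf n).sub hg).enorm.pow_const 2) (fun n => ?_) ?_ ?_
    · filter_upwards [hb n, hbg] with x h1 h2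
      refine pow_le_pow_left₀ zero_le ?_ 2
      rw [enorm_le_iff_norm_le, Real.norm_eq_abs, Real.norm_eq_abs]
      refine le_trans ?_ (le_abs_self _)
      exact (abs_sub _ _).trans (by linarith)
    · rw [lintegral_enorm_sq_eq]
      exact (ENNReal.pow_lt_top (hG.const_mul 2).2).ne
    · filter_upwards [hl] with x hx
      have h2 : Tendsto (fun n => f n x - g x) atTop (𝓝 0) := by
        simpa using hx.sub_const (g x)
      have h3 := ((continuous_enorm.tendsto (0 : ℝ)).comp h2)
      have h4 := ENNReal.Tendsto.pow (n := 2) h3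
      simpa using h4
  simp only [lintegral_zero, lintegral_enorm_sq_eq] at h1
  have h2 := (ENNReal.continuous_rpow_const (y := (1 / 2 : ℝ))).tendsto 0 |>.comp h1
  rw [ENNReal.zero_rpow_of_pos (by norm_num)] at h2
  refine h2.congr fun k => ?_
  simp only [Function.comp]
  rw [← ENNReal.rpow_natCast, ← ENNReal.rpow_mul]
  norm_num

theorem abs_integral_mul_le_of_le {X : Type*} [MeasurableSpace X] {m : Measure X} {a b : X → ℝ}
    (ha : MemLp a 2 m) (hb : MemLp b 2 m) {A B : ℝ≥0} (hA : eLpNorm a 2 m ≤ A)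
    (hB : eLpNorm b 2 m ≤ B) : |∫ x, a x * b x ∂m| ≤ A * B :=
  (abs_integral_mul_le ha hb).trans (mul_le_mul (ENNReal.toReal_le_coe_of_le_coe hA)
    (ENNReal.toReal_le_coe_of_le_coe hB) ENNReal.toReal_nonneg A.2)

/-- The quadratic form `∫∫ (a ⊗ a) : ∇Φ`. -/
noncomputable def convForm (m : Measure (ℝ × Plane)) (Φ a : Fin 2 → ℝ × Plane → ℝ) : ℝ :=
  ∑ i, ∑ j, ∫ z, a i z * (a j z * fderiv ℝ (Φ j) z (0, planeBasis i)) ∂m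

/-- Smooth compactly supported divergence-free fields, supported in `K` in the space variable. -/
structure IsSolenoidalTest (K : Set Plane) (Φ : Fin 2 → ℝ × Plane → ℝ) : Prop where
  contDiff : ∀ j, ContDiff ℝ ∞ (Φ j)
  compact : ∀ j, HasCompactSupport (Φ j)
  eq_zero : ∀ j z, z.2 ∉ K → Φ j z = 0
  div : ∀ z, ∑ i, fderiv ℝ (Φ i) z (0, planeBasis i) = 0

namespace IsSolenoidalTest

variable {K : Set Plane} {Φ : Fin 2 → ℝ × Plane → ℝ} (hΦ : IsSolenoidalTest K Φ)
include hΦ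

theorem test (j : Fin 2) : IsTestFunction univ (Φ j) :=
  ⟨hΦ.contDiff j, hΦ.compact j, subset_univ _⟩

theorem exists_bound : ∃ D : ℝ≥0, (∀ j z, |Φ j z| ≤ D) ∧
    ∀ i j z, |fderiv ℝ (Φ j) z (0, planeBasis i)| ≤ D := by
  choose C hC using fun j => (hΦ.test j).abs_le
  choose C' hC' using fun i j => ((hΦ.test j).fderiv_apply (0, planeBasis i)).abs_le
  refine ⟨(∑ j, C j) + ∑ i, ∑ j, C' i j, fun j z => (hC j z).trans ?_,
    fun i j z => (hC' i j z).trans ?_⟩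
  · exact_mod_cast (Finset.single_le_sum (f := C) (fun _ _ => zero_le) (Finset.mem_univ j)).trans
      le_self_add
  · refine NNReal.coe_le_coe.2 (le_trans ?_ le_add_self)
    exact (Finset.single_le_sum (f := C' i) (fun _ _ => zero_le) (Finset.mem_univ j)).trans
      (Finset.single_le_sum (f := fun i => ∑ j, C' i j) (fun _ _ => zero_le) (Finset.mem_univ i))

theorem aesm_fderiv (m : Measure (ℝ × Plane)) (i j : Fin 2) :
    AEStronglyMeasurable (fun z => fderiv ℝ (Φ j) z (0, planeBasis i)) m :=
  ((hΦ.test j).fderiv_apply (0, planeBasis i)).aesm m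

end IsSolenoidalTest

/-- Write `aᵢaⱼ - bᵢbⱼ = (aᵢ - bᵢ)aⱼ + bᵢ(aⱼ - bⱼ)`: two terms for each of the four pairs of
indices, hence the factor 8. -/
theorem abs_convForm_sub_le {K : Set Plane} {m : Measure (ℝ × Plane)}
    {Φ : Fin 2 → ℝ × Plane → ℝ} (hΦ : IsSolenoidalTest K Φ) {D : ℝ≥0}
    (hD : ∀ i j z, |fderiv ℝ (Φ j) z (0, planeBasis i)| ≤ D)
    {a b : Fin 2 → ℝ × Plane → ℝ} (ha : ∀ j, MemLp (a j) 2 m)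
    (hb : ∀ j, MemLp (b j) 2 m) {N e : ℝ≥0} (haN : ∀ j, eLpNorm (a j) 2 m ≤ N)
    (hbN : ∀ j, eLpNorm (b j) 2 m ≤ N) (he : ∀ j, eLpNorm (fun z => a j z - b j z) 2 m ≤ e) :
    |convForm m Φ a - convForm m Φ b| ≤ 8 * (N * D * e) := by
  have hbd : ∀ i j (f : ℝ × Plane → ℝ), MemLp f 2 m →
      MemLp (fun z => f z * fderiv ℝ (Φ j) z (0, planeBasis i)) 2 m := fun i j f hf =>
    hf.mul_bdd (hΦ.aesm_fderiv m i j) (hD i j)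
  have hbd' : ∀ i j (f : ℝ × Plane → ℝ) (A : ℝ≥0), eLpNorm f 2 m ≤ A →
      eLpNorm (fun z => f z * fderiv ℝ (Φ j) z (0, planeBasis i)) 2 m ≤ ((D * A : ℝ≥0) : ℝ≥0∞) := by
    intro i j f A hA
    rw [ENNReal.coe_mul]
    exact (eLpNorm_mul_bdd_le (hD i j)).trans (mul_le_mul_right hA _)
  have key : ∀ i j, |(∫ z, a i z * (a j z * fderiv ℝ (Φ j) z (0, planeBasis i)) ∂m)
      - ∫ z, b i z * (b j z * fderiv ℝ (Φ j) z (0, planeBasis i)) ∂m| ≤ 2 * (N * D * e) := by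
    intro i j
    have h1 := abs_integral_mul_le_of_le ((ha i).sub (hb i)) (hbd i j _ (ha j)) (he i)
      (hbd' i j _ N (haN j))
    have h2 := abs_integral_mul_le_of_le (hb i) (hbd i j _ ((ha j).sub (hb j))) (hbN i)
      (hbd' i j _ e (he j))
    have e1 : (∫ z, a i z * (a j z * fderiv ℝ (Φ j) z (0, planeBasis i)) ∂m)
      - ∫ z, b i z * (b j z * fderiv ℝ (Φ j) z (0, planeBasis i)) ∂m
      = (∫ z, (a i - b i) z * (a j z * fderiv ℝ (Φ j) z (0, planeBasis i)) ∂m)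
      + ∫ z, b i z * ((a j - b j) z * fderiv ℝ (Φ j) z (0, planeBasis i)) ∂m := by
      rw [← integral_sub ((ha i).integrable_mul_two (hbd i j _ (ha j)))
        ((hb i).integrable_mul_two (hbd i j _ (hb j))),
        ← integral_add (((ha i).sub (hb i)).integrable_mul_two (hbd i j _ (ha j)))
        ((hb i).integrable_mul_two (hbd i j _ ((ha j).sub (hb j))))]
      congr 1 with z
      simp only [Pi.sub_apply]
      ring
    rw [e1]
    refine (abs_add_le _ _).trans ((add_le_add h1 h2).trans (le_of_eq ?_))
    push_cast
    ring
  unfold convForm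
  rw [← Finset.sum_sub_distrib]
  simp only [← Finset.sum_sub_distrib]
  refine (Finset.abs_sum_le_sum_abs _ _).trans ?_
  refine (Finset.sum_le_sum fun i _ => (Finset.abs_sum_le_sum_abs _ _).trans
    (Finset.sum_le_sum fun j _ => key i j)).trans (le_of_eq ?_)
  simp
  ring

/-- The curl of the mollified field. -/
noncomputable def curlConv (ρ : Plane → ℝ) (b : Fin 2 → ℝ × Plane → ℝ) (z : ℝ × Plane) : ℝ :=
  spaceConv (fun y => fderiv ℝ ρ y (planeBasis 0)) (b 1) z
    - spaceConv (fun y => fderiv ℝ ρ y (planeBasis 1)) (b 0) z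

variable {μ : Measure ℝ} [IsFiniteMeasure μ] {ρ : Plane → ℝ} {ε δ : ℝ} {K : Set Plane}

omit [IsFiniteMeasure μ] in
theorem eLpNorm_le_of_slice [SFinite μ] {b : ℝ × Plane → ℝ} {B : ℝ≥0}
    (hb : AEStronglyMeasurable b (μ.prod volume))
    (hB : ∀ᵐ t ∂μ, eLpNorm (fun x => b (t, x)) 2 volume ≤ B) :
    eLpNorm b 2 (μ.prod volume) ^ 2 ≤ B ^ 2 * μ univ := by
  rw [← lintegral_enorm_sq_eq, lintegral_prod _ (hb.enorm.pow_const 2)]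
  calc ∫⁻ t, (∫⁻ x, ‖b (t, x)‖ₑ ^ 2) ∂μ ≤ ∫⁻ _, (B : ℝ≥0∞) ^ 2 ∂μ := by
        refine lintegral_mono_ae ?_
        filter_upwards [hB] with t ht
        rw [lintegral_enorm_sq_eq]
        exact pow_le_pow_left₀ zero_le ht 2
    _ = _ := by simp

/-- For a fixed mollifier the derivative falls on the kernel, so the energy bound alone gives a
pointwise bound common to all fields. It provides the majorant for dominated convergence. -/
theorem exists_curlConv_bound (hρ : IsMollifier ρ ε) (B : ℝ≥0) :
    ∃ M : ℝ, ∀ b : Fin 2 → ℝ × Plane → ℝ, (∀ j, MemLp (b j) 2 (μ.prod volume)) →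
      (∀ j, ∀ᵐ t ∂μ, eLpNorm (fun x => b j (t, x)) 2 volume ≤ B) →
      ∀ᵐ z ∂(μ.prod volume), |curlConv ρ b z| ≤ M := by
  refine ⟨B * (eLpNorm (fun y => fderiv ℝ ρ y (planeBasis 0)) 2 volume).toReal
    + B * (eLpNorm (fun y => fderiv ℝ ρ y (planeBasis 1)) 2 volume).toReal, fun b hb hB => ?_⟩
  have h1 : ∀ᵐ t ∂μ, ∀ j, MemLp (fun y => b j (t, y)) 2 volume :=
    ae_all_iff.2 fun j => (hb j).ae_slice
  have h2 := Measure.quasiMeasurePreserving_fst (μ := μ) (ν := (volume : Measure Plane)) |>.ae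
    (h1.and (ae_all_iff.2 hB))
  have hk := fun i => (hρ.isTestFunction.fderiv_apply (planeBasis i)).memLp volume 2
  filter_upwards [h2] with z hz
  exact (abs_sub _ _).trans (add_le_add (abs_kconv_le (hk 0) (hz.1 1) (hz.2 1) _)
    (abs_kconv_le (hk 1) (hz.1 0) (hz.2 0) _))

theorem continuous_fderiv_mollifier (hρ : IsMollifier ρ ε) (i : Fin 2) :
    Continuous (fun y => fderiv ℝ ρ y (planeBasis i)) :=
  (hρ.isTestFunction.fderiv_apply (planeBasis i)).1.continuous

theorem stronglyMeasurable_curlConv (hρ : IsMollifier ρ ε) {b : Fin 2 → ℝ × Plane → ℝ}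
    (hb : ∀ j, StronglyMeasurable (b j)) : StronglyMeasurable (curlConv ρ b) :=
  (stronglyMeasurable_spaceConv (continuous_fderiv_mollifier hρ 0) (hb 1)).sub
    (stronglyMeasurable_spaceConv (continuous_fderiv_mollifier hρ 1) (hb 0))

/-- `(V·∇)V = ∇|V|²/2 + (curl V) V^⊥` for mollified divergence-free fields. -/
theorem convForm_spaceConv_eq (hK : IsCompact K) (hρ : IsMollifier ρ ε) (hεδ : ε < δ)
    {b : Fin 2 → ℝ × Plane → ℝ}
    (hbm : ∀ j, StronglyMeasurable (b j)) (hb : ∀ j, MemLp (b j) 2 (μ.prod volume)) {B : ℝ≥0}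
    (hB : ∀ j, ∀ᵐ t ∂μ, eLpNorm (fun x => b j (t, x)) 2 volume ≤ B)
    (hdiv : ∀ x ∈ K, ∀ ψ, IsTestFunction (Metric.ball x δ) ψ →
      ∀ᵐ t ∂μ, ∑ i, ∫ y, b i (t, y) * fderiv ℝ ψ y (planeBasis i) = 0)
    {Φ : Fin 2 → ℝ × Plane → ℝ} (hΦ : IsSolenoidalTest K Φ) :
    convForm (μ.prod volume) Φ (fun j => spaceConv ρ (b j))
      = - ∫ z, curlConv ρ b z *
        (spaceConv ρ (b 0) z * Φ 1 z - spaceConv ρ (b 1) z * Φ 0 z) ∂(μ.prod volume) := by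
  obtain ⟨D, hD1, hD2⟩ := hΦ.exists_bound
  obtain ⟨M, hM⟩ := exists_curlConv_bound (μ := μ) hρ B
  have hV := fun j => memLp_spaceConv hρ (hbm j) (hb j)
  have hVm := fun j => stronglyMeasurable_spaceConv hρ.contDiff.continuous (hbm j)
  have hVd : ∀ i j, MemLp (fun z => spaceConv ρ (b j) z * fderiv ℝ (Φ j) z (0, planeBasis i)) 2
      (μ.prod volume) := fun i j => (hV j).mul_bdd (hΦ.aesm_fderiv _ i j) (hD2 i j)
  have hi1 : ∀ i j, Integrable (fun z => spaceConv ρ (b i) z *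
      (spaceConv ρ (b j) z * fderiv ℝ (Φ j) z (0, planeBasis i))) (μ.prod volume) := fun i j =>
    (hV i).integrable_mul_two (hVd i j)
  have hΦ2 := fun j => (hΦ.test j).memLp (μ.prod volume) 2
  have hg : Integrable (fun z => spaceConv ρ (b 0) z * Φ 1 z - spaceConv ρ (b 1) z * Φ 0 z)
      (μ.prod volume) :=
    ((hV 0).integrable_mul_two (hΦ2 1)).sub ((hV 1).integrable_mul_two (hΦ2 0))
  have hi2 : Integrable (fun z => curlConv ρ b z *
        (spaceConv ρ (b 0) z * Φ 1 z - spaceConv ρ (b 1) z * Φ 0 z)) (μ.prod volume) :=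
    hg.bdd_mul (stronglyMeasurable_curlConv hρ hbm).aestronglyMeasurable (hM b hb hB)
  -- The hypothesis is applied to the kernel centred at `x`, and its exceptional set of times
  -- depends on `x`. Measurability of the set of good points allows the two quantifiers to be
  -- exchanged.
  have hdiv' : ∀ᵐ t ∂μ, ∀ᵐ x, x ∈ K →
      ∑ i, spaceConv (fun y => fderiv ℝ ρ y (planeBasis i)) (b i) (t, x) = 0 := by
    have hmeas : MeasurableSet {p : ℝ × Plane | p.2 ∈ K →
        ∑ i, spaceConv (fun y => fderiv ℝ ρ y (planeBasis i)) (b i) (p.1, p.2) = 0} := by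
      have h1 : Measurable (fun p : ℝ × Plane =>
          ∑ i, spaceConv (fun y => fderiv ℝ ρ y (planeBasis i)) (b i) (p.1, p.2)) :=
        Finset.measurable_fun_sum _ fun i _ =>
          (stronglyMeasurable_spaceConv (continuous_fderiv_mollifier hρ i) (hbm i)).measurable
      exact (hK.measurableSet.preimage measurable_snd).imp (measurableSet_eq_fun h1 measurable_const)
    rw [Measure.ae_ae_comm (p := fun (t : ℝ) (x : Plane) => x ∈ K →
      ∑ i, spaceConv (fun y => fderiv ℝ ρ y (planeBasis i)) (b i) (t, x) = 0) hmeas]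
    refine ae_of_all _ fun x => ?_
    by_cases hx : x ∈ K
    · filter_upwards [hdiv x hx _ (hρ.isTestFunction_sub hεδ x)] with t ht _
      simp only [hρ.fderiv_sub, mul_neg, integral_neg, Finset.sum_neg_distrib, neg_eq_zero] at ht
      exact ht
    · exact ae_of_all _ fun t h => absurd h hx
  unfold convForm
  simp_rw [fun i j => integral_prod _ (hi1 i j)]
  rw [integral_prod _ hi2, ← integral_neg]
  have hi3 : ∀ i j, Integrable (fun t => ∫ x, spaceConv ρ (b i) (t, x) *
      (spaceConv ρ (b j) (t, x) * fderiv ℝ (Φ j) (t, x) (0, planeBasis i))) μ := fun i j =>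
    (hi1 i j).integral_prod_left
  simp_rw [← integral_finsetSum _ fun j _ => hi3 _ j]
  rw [← integral_finsetSum _ fun i _ => integrable_finsetSum _ fun j _ => hi3 i j]
  refine integral_congr_ae ?_
  have hs : ∀ᵐ t ∂μ, ∀ j, MemLp (fun y => b j (t, y)) 2 volume :=
    ae_all_iff.2 fun j => (hb j).ae_slice
  filter_upwards [hs, hdiv'] with t hst hdt
  have hloc : ∀ j, LocallyIntegrable (fun y => b j (t, y)) volume := fun j =>
    (hst j).locallyIntegrable one_le_two
  have hρ1 : ContDiff ℝ 1 ρ := hρ.contDiff.of_le (by simp)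
  have hφs : ∀ j, IsTestFunction univ (fun x => Φ j (t, x)) := fun j =>
    ((hΦ.test j).mono (V := spaceTime 0 univ ∪ univ) (by simp)).1.comp
      (contDiff_const.prodMk contDiff_id) |> fun h => ⟨h, by
        refine ((hΦ.compact j).isCompact.image continuous_snd).of_isClosed_subset
          (isClosed_tsupport _) ?_
        refine closure_minimal (fun x hx => ⟨(t, x), subset_tsupport _ hx, rfl⟩)
          ((hΦ.compact j).isCompact.image continuous_snd).isClosed, subset_univ _⟩
  have hfd : ∀ j i x, fderiv ℝ (fun x => Φ j (t, x)) x (planeBasis i)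
      = fderiv ℝ (Φ j) (t, x) (0, planeBasis i) := fun j i x =>
    fderiv_slice (z := (t, x)) ((hΦ.test j).differentiable _) _
  have key := sum_integral_mul_mul_fderiv_eq
    (V := fun j => kconv ρ (fun y => b j (t, y))) (Φ := fun j x => Φ j (t, x))
    (fun j => contDiff_kconv hρ1 hρ.hasCompactSupport (hloc j))
    (fun j => (hφs j).1.of_le (by simp)) (fun j => (hφs j).2.1)
    (fun x => by simp only [hfd]; exact hΦ.div (t, x)) ?_
  · simp only [hfd, fun j x v => fderiv_kconv hρ1 hρ.hasCompactSupport (hloc j) x v,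
      mul_assoc] at key
    exact key
  · filter_upwards [hdt] with x hx j
    by_cases hxK : x ∈ K
    · right
      simp only [fun j x v => fderiv_kconv hρ1 hρ.hasCompactSupport (hloc j) x v]
      exact hx hxK
    · exact Or.inl (hΦ.eq_zero j (t, x) hxK)

/-- Distributional divergence constraints pass to weak limits. -/
theorem WeakL2.div_limit {a : ℕ → Fin 2 → ℝ × Plane → ℝ} {b : Fin 2 → ℝ × Plane → ℝ}
    (hw : ∀ j, WeakL2 (μ.prod volume) atTop (fun n => a n j) (b j)) {ψ : Plane → ℝ}
    (hψ : IsTestFunction univ ψ)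
    (h : ∀ n, ∀ᵐ t ∂μ, ∑ i, ∫ y, a n i (t, y) * fderiv ℝ ψ y (planeBasis i) = 0) :
    ∀ᵐ t ∂μ, ∑ i, ∫ y, b i (t, y) * fderiv ℝ ψ y (planeBasis i) = 0 := by
  have hk := fun i => (hψ.fderiv_apply (planeBasis i)).memLp volume 2
  have hmem : ∀ A, MeasurableSet A → ∀ i, MemLp (fun z : ℝ × Plane =>
      (A.indicator (fun _ => (1 : ℝ)) z.1) * fderiv ℝ ψ z.2 (planeBasis i)) 2 (μ.prod volume) := by
    intro A hA i
    have h1 : MemLp (fun z : ℝ × Plane => fderiv ℝ ψ z.2 (planeBasis i)) 2 (μ.prod volume) :=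
      (hk i).comp_snd μ
    have h2 := h1.indicator (hA.prod (MeasurableSet.univ (α := Plane)))
    refine h2.ae_eq (ae_of_all _ fun z => ?_)
    by_cases hz : z.1 ∈ A <;> simp [hz, indicator]
  have hfub : ∀ (f : Fin 2 → ℝ × Plane → ℝ), (∀ i, MemLp (f i) 2 (μ.prod volume)) →
      ∀ A, MeasurableSet A → ∑ i, ∫ z, f i z * ((A.indicator (fun _ => (1 : ℝ)) z.1)
        * fderiv ℝ ψ z.2 (planeBasis i)) ∂(μ.prod volume)
      = ∫ t in A, (∑ i, ∫ y, f i (t, y) * fderiv ℝ ψ y (planeBasis i)) ∂μ := by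
    intro f hf A hA
    have hi := fun i => (hf i).integrable_mul_two (hmem A hA i)
    simp_rw [fun i => integral_prod _ (hi i)]
    rw [← integral_finsetSum _ fun i _ => (hi i).integral_prod_left, ← integral_indicator hA]
    congr 1 with t
    by_cases ht : t ∈ A <;> simp [ht]
  have hint : Integrable (fun t => ∑ i, ∫ y, b i (t, y) * fderiv ℝ ψ y (planeBasis i)) μ := by
    refine integrable_finsetSum _ fun i _ => ?_
    have := ((hw i).2.1.integrable_mul_two (hmem univ MeasurableSet.univ i)).integral_prod_left
    simpa using this
  -- The constraint is integrated over an arbitrary set `A` of times, which amounts to testing weak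
  -- convergence with the indicator of `A` in time multiplied by a derivative of `ψ`.
  refine hint.ae_eq_zero_of_forall_setIntegral_eq_zero fun A hA _ => ?_
  rw [← hfub b (fun i => (hw i).2.1) A hA]
  refine tendsto_nhds_unique (tendsto_finsetSum _ fun i _ => (hw i).2.2 _ (hmem A hA i))
    (tendsto_const_nhds.congr fun n => ?_)
  rw [hfub (a n) (fun i => (hw i).1 n) A hA]
  symm
  refine integral_eq_zero_of_ae (ae_restrict_of_ae ?_)
  filter_upwards [h n] with t ht
  exact ht

/-- **Compensated compactness**: the quadratic form `∫∫ (a ⊗ a) : ∇Φ` passes to the limit if the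
divergences vanish, the curls are compact in time, and the fields are bounded in a space of
differentiable functions. -/
theorem tendsto_convForm (hK : IsCompact K) (hδ : 0 < δ)
    {a : ℕ → Fin 2 → ℝ × Plane → ℝ} {b : Fin 2 → ℝ × Plane → ℝ}
    (ham : ∀ n j, StronglyMeasurable (a n j)) (hbm : ∀ j, StronglyMeasurable (b j))
    (hw : ∀ j, WeakL2 (μ.prod volume) atTop (fun n => a n j) (b j)) {B C : ℝ≥0}
    (haB : ∀ n j, ∀ᵐ t ∂μ, eLpNorm (fun x => a n j (t, x)) 2 volume ≤ B)
    (hbB : ∀ j, ∀ᵐ t ∂μ, eLpNorm (fun x => b j (t, x)) 2 volume ≤ B)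
    (haC : ∀ n j (h : Plane),
      eLpNorm (fun z => a n j (z.1, z.2 - h) - a n j z) 2 (μ.prod volume) ≤ C * ‖h‖ₑ)
    (hbC : ∀ j (h : Plane),
      eLpNorm (fun z => b j (z.1, z.2 - h) - b j z) 2 (μ.prod volume) ≤ C * ‖h‖ₑ)
    (hdiv : ∀ x ∈ K, ∀ ψ, IsTestFunction (Metric.ball x δ) ψ → ∀ n,
      ∀ᵐ t ∂μ, ∑ i, ∫ y, a n i (t, y) * fderiv ℝ ψ y (planeBasis i) = 0)
    (hcurl : ∀ x ∈ K, ∀ ψ, IsTestFunction (Metric.ball x δ) ψ → ∀ᵐ t ∂μ,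
      Tendsto (fun n => (∫ y, a n 1 (t, y) * fderiv ℝ ψ y (planeBasis 0))
        - ∫ y, a n 0 (t, y) * fderiv ℝ ψ y (planeBasis 1)) atTop
        (𝓝 ((∫ y, b 1 (t, y) * fderiv ℝ ψ y (planeBasis 0))
        - ∫ y, b 0 (t, y) * fderiv ℝ ψ y (planeBasis 1))))
    {Φ : Fin 2 → ℝ × Plane → ℝ} (hΦ : IsSolenoidalTest K Φ) :
    Tendsto (fun n => convForm (μ.prod volume) Φ (a n)) atTop
      (𝓝 (convForm (μ.prod volume) Φ b)) := by
  obtain ⟨D, hD1, hD2⟩ := hΦ.exists_bound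
  obtain ⟨N, hN⟩ : ∃ N : ℝ≥0, ∀ f : ℝ × Plane → ℝ, AEStronglyMeasurable f (μ.prod volume) →
      (∀ᵐ t ∂μ, eLpNorm (fun x => f (t, x)) 2 volume ≤ B) →
      eLpNorm f 2 (μ.prod volume) ≤ N := by
    obtain ⟨q, hq⟩ : ∃ q : ℝ≥0, μ univ = q :=
      ⟨(μ univ).toNNReal, (ENNReal.coe_toNNReal (measure_ne_top _ _)).symm⟩
    -- A crude substitute for a square root: the square of this number is at least `B²q`.
    refine ⟨B * q + B, fun f hf hfB => ?_⟩
    have h1 := eLpNorm_le_of_slice hf hfB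
    rw [hq] at h1
    refine (ENNReal.pow_le_pow_left_iff two_ne_zero).1 (h1.trans ?_)
    norm_cast
    have : (B * q + B) ^ 2 = B ^ 2 * q + (B ^ 2 * q ^ 2 + B ^ 2 * q + B ^ 2) := by ring
    rw [this]
    exact le_self_add
  have hdivb : ∀ x ∈ K, ∀ ψ, IsTestFunction (Metric.ball x δ) ψ →
      ∀ᵐ t ∂μ, ∑ i, ∫ y, b i (t, y) * fderiv ℝ ψ y (planeBasis i) = 0 := fun x hx ψ hψ =>
    WeakL2.div_limit hw (hψ.mono (subset_univ _)) (hdiv x hx ψ hψ)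
  -- convergence of the mollified quadratic forms
  have hmoll : ∀ (ε : ℝ) (ρ : Plane → ℝ), ε < δ → IsMollifier ρ ε →
      Tendsto (fun n => convForm (μ.prod volume) Φ (fun j => spaceConv ρ (a n j))) atTop
        (𝓝 (convForm (μ.prod volume) Φ (fun j => spaceConv ρ (b j)))) := by
    intro ε ρ hεδ hρ
    rw [convForm_spaceConv_eq hK hρ hεδ hbm (fun j => (hw j).2.1) hbB hdivb hΦ]
    simp_rw [fun n => convForm_spaceConv_eq hK hρ hεδ (ham n) (fun j => (hw j).1 n) (haB n)
      (fun x hx ψ hψ => hdiv x hx ψ hψ n) hΦ]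
    refine Tendsto.neg ?_
    obtain ⟨M, hM⟩ := exists_curlConv_bound (μ := μ) hρ B
    have hM0 : ∀ᵐ z ∂(μ.prod (volume : Measure Plane)), |curlConv ρ b z| ≤ M :=
      hM b (fun j => (hw j).2.1) hbB
    -- For each fixed `x` in `K` the curl hypothesis is applied to the kernel centred at `x`; the
    -- null set of times again depends on `x`, and the quantifiers are exchanged by Fubini.
    have hconv : ∀ᵐ z ∂(μ.prod (volume : Measure Plane)), z.2 ∈ K →
        Tendsto (fun n => curlConv ρ (a n) z) atTop (𝓝 (curlConv ρ b z)) := by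
      have hmeas : MeasurableSet {z : ℝ × Plane | z.2 ∈ K →
          Tendsto (fun n => curlConv ρ (a n) z) atTop (𝓝 (curlConv ρ b z))} := by
        refine (hK.measurableSet.preimage measurable_snd).imp ?_
        have h1 : {z : ℝ × Plane | Tendsto (fun n => curlConv ρ (a n) z) atTop (𝓝 (curlConv ρ b z))}
            = {z | Tendsto (fun n => curlConv ρ (a n) z - curlConv ρ b z) atTop (𝓝 0)} := by
          ext z
          exact tendsto_sub_nhds_zero_iff.symm
        rw [h1]
        exact measurableSet_tendsto (𝓝 0) fun n =>
          ((stronglyMeasurable_curlConv hρ (ham n)).sub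
            (stronglyMeasurable_curlConv hρ hbm)).measurable
      rw [Measure.ae_prod_iff_ae_ae hmeas]
      rw [Measure.ae_ae_comm (p := fun (t : ℝ) (x : Plane) => x ∈ K →
        Tendsto (fun n => curlConv ρ (a n) (t, x)) atTop (𝓝 (curlConv ρ b (t, x)))) hmeas]
      refine ae_of_all _ fun x => ?_
      by_cases hx : x ∈ K
      · filter_upwards [hcurl x hx _ (hρ.isTestFunction_sub hεδ x)] with t ht _
        simp only [hρ.fderiv_sub, mul_neg, integral_neg] at ht
        have h2 := ht.neg
        simp only [neg_sub_neg, neg_sub] at h2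
        exact h2
      · exact ae_of_all _ fun t h => absurd h hx
    have hstrong : ∀ j, L2Tendsto (μ.prod volume) (fun n z => curlConv ρ (a n) z * Φ j z)
        (fun z => curlConv ρ b z * Φ j z) := by
      intro j
      refine L2Tendsto.of_dominated (G := fun z => M * |Φ j z|) (fun n => ?_) ?_ ?_ (fun n => ?_) ?_
      · exact (stronglyMeasurable_curlConv hρ (ham n)).aestronglyMeasurable.mul
          ((hΦ.test j).aesm _)
      · exact (stronglyMeasurable_curlConv hρ hbm).aestronglyMeasurable.mul ((hΦ.test j).aesm _)
      · exact (((hΦ.test j).memLp _ 2).abs).const_mul M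
      · filter_upwards [hM (a n) (fun j => (hw j).1 n) (haB n)] with z hz
        rw [abs_mul]
        exact mul_le_mul_of_nonneg_right hz (abs_nonneg _)
      · filter_upwards [hconv] with z hz
        by_cases hzK : z.2 ∈ K
        · exact (hz hzK).mul_const _
        · simp [hΦ.eq_zero j z hzK]
    have hwV := fun j => (hw j).spaceConv hρ (fun n => ham n j) (hbm j)
    have hVN : ∀ n j, eLpNorm (spaceConv ρ (a n j)) 2 (μ.prod volume) ≤ N := fun n j =>
      (eLpNorm_spaceConv_le hρ (ham n j)).trans (hN _ (ham n j).aestronglyMeasurable (haB n j))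
    -- The heart of the matter: mollified velocities converge weakly, mollified curls times `Φ`
    -- converge strongly, so the integral of their product converges.
    have hlim := ((hwV 0).mul_strong (hstrong 1) (fun n => hVN n 0)).sub
      ((hwV 1).mul_strong (hstrong 0) (fun n => hVN n 1))
    have e : ∀ (c : ℝ × Plane → ℝ) (v : Fin 2 → ℝ × Plane → ℝ),
        (∀ j, MemLp (v j) 2 (μ.prod volume)) →
        (∀ j, MemLp (fun z => c z * Φ j z) 2 (μ.prod volume)) →
        (∫ z, v 0 z * (c z * Φ 1 z) ∂(μ.prod volume))
          - ∫ z, v 1 z * (c z * Φ 0 z) ∂(μ.prod volume)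
        = ∫ z, c z * (v 0 z * Φ 1 z - v 1 z * Φ 0 z) ∂(μ.prod volume) := by
      intro c v hv hc
      rw [← integral_sub ((hv 0).integrable_mul_two (hc 1)) ((hv 1).integrable_mul_two (hc 0))]
      congr 1 with z
      ring
    rw [e _ (fun j => spaceConv ρ (b j)) (fun j => (hwV j).2.1) (fun j => (hstrong j).2.1)] at hlim
    refine hlim.congr fun n => ?_
    exact e _ (fun j => spaceConv ρ (a n j)) (fun j => (hwV j).1 n) (fun j => (hstrong j).1 n)
  -- the mollification error is uniformly small
  rw [Metric.tendsto_atTop]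
  intro η hη
  -- The scale is chosen before `n`: the mollification error is below `η/3` for all `a n` and for
  -- `b` at once, since the translation constant `C` is common to them. The bound `ε < δ` keeps the
  -- kernels inside the balls on which divergence and curl are known.
  obtain ⟨ε, hε0, hεδ, hεη⟩ : ∃ ε : ℝ, 0 < ε ∧ ε < δ ∧ 8 * (N * D * (C * ε)) < η / 3 := by
    set q : ℝ := 8 * (N * D * C) with hq
    have hq0 : 0 ≤ q := by positivity
    refine ⟨min (δ / 2) (η / (6 * (q + 1))), by positivity,
      (min_le_left _ _).trans_lt (by linarith), ?_⟩
    have h1 : 8 * (N * D * (C * min (δ / 2) (η / (6 * (q + 1)))))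
        = q * min (δ / 2) (η / (6 * (q + 1))) := by rw [hq]; ring
    rw [h1]
    calc q * min (δ / 2) (η / (6 * (q + 1))) ≤ q * (η / (6 * (q + 1))) :=
          mul_le_mul_of_nonneg_left (min_le_right _ _) hq0
      _ = η / 6 * (q / (q + 1)) := by field_simp
      _ ≤ η / 6 * 1 := by
          refine mul_le_mul_of_nonneg_left ((div_le_one (by positivity)).2 (by linarith))
            (by positivity)
      _ < η / 3 := by linarith
  obtain ⟨ρ, hρ⟩ := exists_isMollifier hε0
  have hCε : (C : ℝ≥0∞) * ENNReal.ofReal ε = ((C * ε.toNNReal : ℝ≥0) : ℝ≥0∞) := by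
    rw [ENNReal.coe_mul]; rfl
  have herr : ∀ f : Fin 2 → ℝ × Plane → ℝ, (∀ j, StronglyMeasurable (f j)) →
      (∀ j, MemLp (f j) 2 (μ.prod volume)) →
      (∀ j, ∀ᵐ t ∂μ, eLpNorm (fun x => f j (t, x)) 2 volume ≤ B) →
      (∀ j (h : Plane),
        eLpNorm (fun z => f j (z.1, z.2 - h) - f j z) 2 (μ.prod volume) ≤ C * ‖h‖ₑ) →
      |convForm (μ.prod volume) Φ (fun j => spaceConv ρ (f j)) - convForm (μ.prod volume) Φ f|
        < η / 3 := by
    intro f hfm hf hfB hfC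
    refine (abs_convForm_sub_le hΦ hD2 (fun j => memLp_spaceConv hρ (hfm j) (hf j)) hf
      (fun j => (eLpNorm_spaceConv_le hρ (hfm j)).trans
        (hN _ (hfm j).aestronglyMeasurable (hfB j)))
      (fun j => hN _ (hfm j).aestronglyMeasurable (hfB j))
      (fun j => (eLpNorm_spaceConv_sub_le hρ (hfm j) (hf j) (hfC j)).trans_eq hCε)).trans_lt ?_
    push_cast
    rw [Real.coe_toNNReal _ hε0.le]
    exact hεη
  obtain ⟨n0, hn0⟩ := Metric.tendsto_atTop.1 (hmoll ε ρ hεδ hρ) (η / 3) (by positivity)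
  refine ⟨n0, fun n hn => ?_⟩
  have h1 := hn0 n hn
  have h2 := herr (a n) (ham n) (fun j => (hw j).1 n) (haB n) (haC n)
  have h3 := herr b hbm (fun j => (hw j).2.1) hbB hbC
  rw [Real.dist_eq] at h1 ⊢
  rw [abs_lt] at h1 h2 h3 ⊢
  constructor <;> linarith [h1.1, h1.2, h2.1, h2.2, h3.1, h3.2]

end CompensatedCompactness

/-! ### The quadratic form of a field with square integrable local curl -/

section CurlIdentity

variable {μ : Measure ℝ} [IsFiniteMeasure μ] {δ : ℝ} {K : Set Plane}

theorem l2Tendsto_spaceConv {ρ : ℕ → Plane → ℝ} {ε : ℕ → ℝ} (hρ : ∀ k, IsMollifier (ρ k) (ε k))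
    (hε : Tendsto ε atTop (𝓝 0)) {a : ℝ × Plane → ℝ} (ha : StronglyMeasurable a)
    (ha2 : MemLp a 2 (μ.prod volume)) {C : ℝ≥0}
    (hC : ∀ h : Plane, eLpNorm (fun z => a (z.1, z.2 - h) - a z) 2 (μ.prod volume) ≤ C * ‖h‖ₑ) :
    L2Tendsto (μ.prod volume) (fun k => spaceConv (ρ k) a) a := by
  refine ⟨fun k => memLp_spaceConv (hρ k) ha ha2, ha2, ?_⟩
  have h0 : Tendsto (fun k => (C : ℝ≥0∞) * ENNReal.ofReal (ε k)) atTop (𝓝 0) := by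
    have := ENNReal.Tendsto.const_mul (a := (C : ℝ≥0∞)) (ENNReal.tendsto_ofReal hε)
      (Or.inr ENNReal.coe_ne_top)
    simpa using this
  exact tendsto_of_tendsto_of_tendsto_of_le_of_le tendsto_const_nhds h0 (fun _ => zero_le)
    (fun k => eLpNorm_spaceConv_sub_le (hρ k) ha ha2 hC)

theorem L2Tendsto.convForm {m : Measure (ℝ × Plane)} {Φ : Fin 2 → ℝ × Plane → ℝ}
    (hΦ : IsSolenoidalTest K Φ) {a : ℕ → Fin 2 → ℝ × Plane → ℝ} {b : Fin 2 → ℝ × Plane → ℝ}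
    (h : ∀ j, L2Tendsto m (fun n => a n j) (b j)) :
    Tendsto (fun n => _root_.convForm m Φ (a n)) atTop (𝓝 (_root_.convForm m Φ b)) := by
  obtain ⟨D, -, hD⟩ := hΦ.exists_bound
  exact tendsto_finsetSum _ fun i _ => tendsto_finsetSum _ fun j _ =>
    (h i).integral_mul ((h j).mul_bdd (hΦ.aesm_fderiv m i j) (hD i j))

theorem IsSolenoidalTest.exists_lipschitz {Φ : Fin 2 → ℝ × Plane → ℝ}
    (hΦ : IsSolenoidalTest K Φ) : ∃ L : ℝ≥0, ∀ j (z : ℝ × Plane) (h : Plane),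
      |Φ j (z.1, z.2 - h) - Φ j z| ≤ L * ‖h‖ := by
  have : ∀ j, ∃ L, LipschitzWith L (Φ j) := fun j =>
    ((hΦ.contDiff j).of_le (by simp)).lipschitzWith_of_hasCompactSupport (hΦ.compact j) one_ne_zero
  choose L hL using this
  refine ⟨∑ j, L j, fun j z h => ?_⟩
  have h1 := (hL j).dist_le_mul (z.1, z.2 - h) z
  rw [Real.dist_eq] at h1
  refine h1.trans (mul_le_mul ?_ ?_ dist_nonneg (NNReal.coe_nonneg _))
  · exact_mod_cast Finset.single_le_sum (f := L) (fun _ _ => zero_le) (Finset.mem_univ j)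
  · rw [Prod.dist_eq, dist_self, dist_eq_norm]
    simp

/-- A discrete Leibniz rule: multiplication by a bounded Lipschitz function preserves the
translation rate, so products such as `b 0 * Φ 1` can be mollified with strong convergence. -/
theorem eLpNorm_translate_mul_sub_le {b φ : ℝ × Plane → ℝ} (hb : MemLp b 2 (μ.prod volume))
    {C D L : ℝ≥0} (hφm : AEStronglyMeasurable φ (μ.prod volume))
    (hC : ∀ h : Plane, eLpNorm (fun z => b (z.1, z.2 - h) - b z) 2 (μ.prod volume) ≤ C * ‖h‖ₑ)
    (hD : ∀ z, |φ z| ≤ D) (hL : ∀ (z : ℝ × Plane) (h : Plane),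
      |φ (z.1, z.2 - h) - φ z| ≤ L * ‖h‖) (h : Plane) :
    eLpNorm (fun z => b (z.1, z.2 - h) * φ (z.1, z.2 - h) - b z * φ z) 2 (μ.prod volume)
      ≤ ((D * C + L * (eLpNorm b 2 (μ.prod volume)).toNNReal : ℝ≥0) : ℝ≥0∞) * ‖h‖ₑ := by
  have hmp := measurePreserving_translate μ h
  have hbt : MemLp (fun z : ℝ × Plane => b (z.1, z.2 - h)) 2 (μ.prod volume) :=
    hb.comp_measurePreserving hmp
  have hφt : AEStronglyMeasurable (fun z : ℝ × Plane => φ (z.1, z.2 - h)) (μ.prod volume) :=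
    hφm.comp_measurePreserving hmp
  have e : (fun z : ℝ × Plane => b (z.1, z.2 - h) * φ (z.1, z.2 - h) - b z * φ z)
      = (fun z => (b (z.1, z.2 - h) - b z) * φ (z.1, z.2 - h))
        + fun z => b z * (φ (z.1, z.2 - h) - φ z) := by
    ext z
    simp only [Pi.add_apply]
    ring
  rw [e]
  refine (eLpNorm_add_le ((hbt.sub hb).1.mul hφt) (hb.1.mul (hφt.sub hφm)) one_le_two).trans ?_
  have h1 := eLpNorm_mul_bdd_le (m := μ.prod volume) (a := fun z => b (z.1, z.2 - h) - b z)
    (g := fun z => φ (z.1, z.2 - h)) (C := D) fun z => hD _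
  have h2 := eLpNorm_mul_bdd_le (m := μ.prod volume) (a := b)
    (g := fun z => φ (z.1, z.2 - h) - φ z) (C := L * ‖h‖₊) fun z => by simpa using hL z h
  refine (add_le_add (h1.trans (mul_le_mul_right (hC h) _)) h2).trans (le_of_eq ?_)
  rw [ENNReal.coe_add, ENNReal.coe_mul, ENNReal.coe_mul, ENNReal.coe_mul,
    ENNReal.coe_toNNReal hb.2.ne]
  change _ = _ * (‖h‖₊ : ℝ≥0∞)
  rw [show (‖h‖ₑ : ℝ≥0∞) = (‖h‖₊ : ℝ≥0∞) from rfl]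
  ring

/-- `∫∫ (b ⊗ b) : ∇Φ = -∫∫ w (b₀Φ₁ - b₁Φ₀)` for divergence-free `b` with curl `w`. -/
theorem convForm_eq_neg_integral_curl (hK : IsCompact K) (hδ : 0 < δ)
    {b : Fin 2 → ℝ × Plane → ℝ} {w : ℝ × Plane → ℝ}
    (hbm : ∀ j, StronglyMeasurable (b j)) (hb : ∀ j, MemLp (b j) 2 (μ.prod volume)) {B C : ℝ≥0}
    (hB : ∀ j, ∀ᵐ t ∂μ, eLpNorm (fun x => b j (t, x)) 2 volume ≤ B)
    (hC : ∀ j (h : Plane),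
      eLpNorm (fun z => b j (z.1, z.2 - h) - b j z) 2 (μ.prod volume) ≤ C * ‖h‖ₑ)
    (hdiv : ∀ x ∈ K, ∀ ψ, IsTestFunction (Metric.ball x δ) ψ →
      ∀ᵐ t ∂μ, ∑ i, ∫ y, b i (t, y) * fderiv ℝ ψ y (planeBasis i) = 0)
    (hwm : StronglyMeasurable w) (hw : MemLp w 2 (μ.prod volume))
    (hcurl : ∀ x ∈ K, ∀ ψ, IsTestFunction (Metric.ball x δ) ψ → ∀ᵐ t ∂μ,
      (∫ y, b 1 (t, y) * fderiv ℝ ψ y (planeBasis 0))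
        - ∫ y, b 0 (t, y) * fderiv ℝ ψ y (planeBasis 1) = - ∫ y, w (t, y) * ψ y)
    {Φ : Fin 2 → ℝ × Plane → ℝ} (hΦ : IsSolenoidalTest K Φ) :
    convForm (μ.prod volume) Φ b
      = - ∫ z, w z * (b 0 z * Φ 1 z - b 1 z * Φ 0 z) ∂(μ.prod volume) := by
  set ε : ℕ → ℝ := fun k => δ / ((k : ℝ) + 2) with hε
  have hε0 : ∀ k, 0 < ε k := fun k => by positivity
  have hεδ : ∀ k, ε k < δ := fun k => by
    refine div_lt_self hδ ?_
    have : (0 : ℝ) ≤ k := Nat.cast_nonneg k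
    linarith
  have hεl : Tendsto ε atTop (𝓝 0) := by
    refine Tendsto.div_atTop tendsto_const_nhds ?_
    exact tendsto_atTop_add_const_right _ _ tendsto_natCast_atTop_atTop
  choose ρ hρ using fun k => exists_isMollifier (hε0 k)
  obtain ⟨D, hD, -⟩ := hΦ.exists_bound
  obtain ⟨L, hL⟩ := hΦ.exists_lipschitz
  have hΦsm : ∀ j, StronglyMeasurable (Φ j) := fun j => (hΦ.contDiff j).continuous.stronglyMeasurable
  have hΦm : ∀ j, AEStronglyMeasurable (Φ j) (μ.prod volume) := fun j =>
    (hΦsm j).aestronglyMeasurable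
  have hV := fun j => l2Tendsto_spaceConv hρ hεl (hbm j) (hb j) (hC j)
  have hV1 : L2Tendsto (μ.prod volume) (fun k z => spaceConv (ρ k) (b 0) z * Φ 1 z)
      (fun z => b 0 z * Φ 1 z) := (hV 0).mul_bdd (hΦm 1) (hD 1)
  have hV2 : L2Tendsto (μ.prod volume) (fun k z => spaceConv (ρ k) (b 1) z * Φ 0 z)
      (fun z => b 1 z * Φ 0 z) := (hV 1).mul_bdd (hΦm 0) (hD 0)
  have hg := hV1.sub hV2
  have hgs1 : L2Tendsto (μ.prod volume) (fun k => spaceConv (ρ k) (fun z => b 0 z * Φ 1 z))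
      (fun z => b 0 z * Φ 1 z) := l2Tendsto_spaceConv hρ hεl ((hbm 0).mul (hΦsm 1)) hV1.2.1
    (eLpNorm_translate_mul_sub_le (hb 0) (hΦm 1) (hC 0) (hD 1) (hL 1))
  have hgs2 : L2Tendsto (μ.prod volume) (fun k => spaceConv (ρ k) (fun z => b 1 z * Φ 0 z))
      (fun z => b 1 z * Φ 0 z) := l2Tendsto_spaceConv hρ hεl ((hbm 1).mul (hΦsm 0)) hV2.2.1
    (eLpNorm_translate_mul_sub_le (hb 1) (hΦm 0) (hC 1) (hD 0) (hL 0))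
  -- Testing the curl relation with the kernel centred at `x` says that, over `K`, the curl of the
  -- mollified field is the mollification of `w`.
  have hcw : ∀ k, ∀ᵐ z ∂(μ.prod (volume : Measure Plane)), z.2 ∈ K →
      curlConv (ρ k) b z = spaceConv (ρ k) w z := by
    intro k
    have hmeas : MeasurableSet {z : ℝ × Plane | z.2 ∈ K →
        curlConv (ρ k) b z = spaceConv (ρ k) w z} :=
      (hK.measurableSet.preimage measurable_snd).imp (measurableSet_eq_fun
        (stronglyMeasurable_curlConv (hρ k) hbm).measurable
        (stronglyMeasurable_spaceConv (hρ k).contDiff.continuous hwm).measurable)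
    rw [Measure.ae_prod_iff_ae_ae hmeas]
    rw [Measure.ae_ae_comm (p := fun (t : ℝ) (x : Plane) => x ∈ K →
      curlConv (ρ k) b (t, x) = spaceConv (ρ k) w (t, x)) hmeas]
    refine ae_of_all _ fun x => ?_
    by_cases hx : x ∈ K
    · filter_upwards [hcurl x hx _ ((hρ k).isTestFunction_sub (hεδ k) x)] with t ht _
      simp only [(hρ k).fderiv_sub, mul_neg, integral_neg] at ht
      change (∫ y, b 1 (t, y) * _) - (∫ y, b 0 (t, y) * _) = ∫ y, w (t, y) * _
      linarith
    · exact ae_of_all _ fun t h => absurd h hx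
  have hsw := fun k => memLp_spaceConv (μ := μ) (hρ k) hwm hw
  refine tendsto_nhds_unique (L2Tendsto.convForm hΦ hV) ?_
  -- No translation rate is available for `w`, so strong convergence of its mollifications is
  -- avoided. Their norm bound handles the difference of the velocity factors, and self-adjointness
  -- moves the mollifier from `w` onto the products `b i * Φ j`, which do have a rate.
  have e : ∀ k, _root_.convForm (μ.prod volume) Φ (fun j => spaceConv (ρ k) (b j))
      = -((∫ z, spaceConv (ρ k) w z * ((spaceConv (ρ k) (b 0) z * Φ 1 z
          - spaceConv (ρ k) (b 1) z * Φ 0 z) - (b 0 z * Φ 1 z - b 1 z * Φ 0 z)) ∂(μ.prod volume))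
        + ((∫ z, w z * spaceConv (ρ k) (fun z => b 0 z * Φ 1 z) z ∂(μ.prod volume))
          - ∫ z, w z * spaceConv (ρ k) (fun z => b 1 z * Φ 0 z) z ∂(μ.prod volume))) := by
    intro k
    have i1 : Integrable (fun z => spaceConv (ρ k) w z * ((spaceConv (ρ k) (b 0) z * Φ 1 z
          - spaceConv (ρ k) (b 1) z * Φ 0 z) - (b 0 z * Φ 1 z - b 1 z * Φ 0 z))) (μ.prod volume) :=
      (hsw k).integrable_mul_two ((hg.1 k).sub hg.2.1)
    have i2 : Integrable (fun z => spaceConv (ρ k) w z * (b 0 z * Φ 1 z)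
          - spaceConv (ρ k) w z * (b 1 z * Φ 0 z)) (μ.prod volume) :=
      ((hsw k).integrable_mul_two hV1.2.1).sub ((hsw k).integrable_mul_two hV2.2.1)
    rw [convForm_spaceConv_eq hK (hρ k) (hεδ k) hbm hb hB hdiv hΦ,
      ← integral_spaceConv_mul (g := fun z => b 0 z * Φ 1 z) (hρ k) hwm hw
        ((hbm 0).mul (hΦsm 1)) hV1.2.1,
      ← integral_spaceConv_mul (g := fun z => b 1 z * Φ 0 z) (hρ k) hwm hw
        ((hbm 1).mul (hΦsm 0)) hV2.2.1,
      ← integral_sub ((hsw k).integrable_mul_two hV1.2.1) ((hsw k).integrable_mul_two hV2.2.1),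
      ← integral_add i1 i2]
    congr 1
    refine integral_congr_ae ?_
    filter_upwards [hcw k] with z hz
    by_cases hzK : z.2 ∈ K
    · rw [hz hzK]
      ring
    · simp [hΦ.eq_zero _ z hzK]
  simp_rw [e]
  refine Tendsto.neg ?_
  have l1 : Tendsto (fun k => ∫ z, spaceConv (ρ k) w z * ((spaceConv (ρ k) (b 0) z * Φ 1 z
      - spaceConv (ρ k) (b 1) z * Φ 0 z) - (b 0 z * Φ 1 z - b 1 z * Φ 0 z)) ∂(μ.prod volume))
      atTop (𝓝 0) := by
    have h0 := ((ENNReal.tendsto_toReal ENNReal.zero_ne_top).comp hg.2.2).const_mul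
      (eLpNorm w 2 (μ.prod volume)).toReal
    rw [ENNReal.toReal_zero, mul_zero] at h0
    refine squeeze_zero_norm (fun k => ?_) h0
    refine (abs_integral_mul_le (hsw k) ((hg.1 k).sub hg.2.1)).trans ?_
    exact mul_le_mul_of_nonneg_right (ENNReal.toReal_mono hw.2.ne
      (eLpNorm_spaceConv_le (hρ k) hwm)) ENNReal.toReal_nonneg
  have l2 := ((L2Tendsto.const hw).integral_mul hgs1).sub ((L2Tendsto.const hw).integral_mul hgs2)
  have := l1.add l2
  rw [zero_add, ← integral_sub (hw.integrable_mul_two hV1.2.1) (hw.integrable_mul_two hV2.2.1)]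
    at this
  simpa only [← mul_sub] using this

end CurlIdentity

/-! ### Weak time derivatives of curves in `L²(Ω)` -/

section TimeDerivative

variable {X : Type*} [MeasurableSpace X] {m : Measure X}

theorem integral_inner_eq {a b : X → Plane} (ha : MemLp a 2 m) (hb : MemLp b 2 m) :
    ∫ x, inner ℝ (a x) (b x) ∂m = inner ℝ (ha.toLp a) (hb.toLp b) := by
  rw [L2.inner_def]
  apply integral_congr_ae
  filter_upwards [ha.coeFn_toLp, hb.coeFn_toLp] with x h1 h2
  rw [h1, h2]

theorem MeasureTheory.MemLp.integrable_inner_two {a b : X → Plane} (ha : MemLp a 2 m)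
    (hb : MemLp b 2 m) : Integrable (fun x => inner ℝ (a x) (b x)) m := by
  refine (L2.integrable_inner (𝕜 := ℝ) (ha.toLp a) (hb.toLp b)).congr ?_
  filter_upwards [ha.coeFn_toLp, hb.coeFn_toLp] with x h1 h2
  rw [h1, h2]

theorem integral_inner_eq_sum {a b : X → Plane} (ha : MemLp a 2 m) (hb : MemLp b 2 m) :
    ∫ x, inner ℝ (a x) (b x) ∂m = ∑ j, ∫ x, a x j * b x j ∂m := by
  rw [← integral_finsetSum _ fun j _ => (ha.component j).integrable_mul_two (hb.component j)]
  congr 1 with x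
  simp [PiLp.inner_apply, mul_comm]

theorem abs_integral_inner_le {a b : X → Plane} (ha : MemLp a 2 m) (hb : MemLp b 2 m) :
    |∫ x, inner ℝ (a x) (b x) ∂m| ≤ (eLpNorm a 2 m).toReal * (eLpNorm b 2 m).toReal := by
  rw [integral_inner_eq ha hb, ← Lp.norm_toLp a ha, ← Lp.norm_toLp b hb]
  exact abs_real_inner_le_norm _ _

/-- The norm of a slice is the square root of a Fubini integral, which gives measurability;
integrability follows from `√y ≤ 1 + y` on a finite measure space. -/
theorem integrable_eLpNorm_slice {Y : Type*} [MeasurableSpace Y] {lam : Measure Y} [SFinite lam]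
    [IsFiniteMeasure m] {a : X × Y → Plane} (ha : MemLp a 2 (m.prod lam)) :
    Integrable (fun t => (eLpNorm (fun y => a (t, y)) 2 lam).toReal) m := by
  have h1 : Integrable (fun t => ∫ y, ‖a (t, y)‖ ^ 2 ∂lam) m :=
    ((memLp_two_iff_integrable_sq_norm ha.1).1 ha).integral_prod_left
  have h2 : Integrable (fun t => √(∫ y, ‖a (t, y)‖ ^ 2 ∂lam)) m := by
    refine ((integrable_const (1 : ℝ)).add h1).mono' (Real.continuous_sqrt.comp_aestronglyMeasurable
      h1.1) (ae_of_all _ fun t => ?_)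
    have h0 : 0 ≤ ∫ y, ‖a (t, y)‖ ^ 2 ∂lam := integral_nonneg fun _ => sq_nonneg _
    rw [Real.norm_of_nonneg (Real.sqrt_nonneg _)]
    simp only [Pi.add_apply]
    refine Real.sqrt_le_iff.2 ⟨by linarith, by nlinarith⟩
  refine h2.congr ?_
  filter_upwards [ha.ae_slice] with t ht
  rw [← Lp.norm_toLp _ ht, Real.sqrt_eq_iff_eq_sq (integral_nonneg fun _ => sq_nonneg _)
    (norm_nonneg _), ← real_inner_self_eq_norm_sq, ← integral_inner_eq ht ht]
  simp only [real_inner_self_eq_norm_sq]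

theorem volume_restrict_spaceTime (T : ℝ) (Ω : Set Plane) :
    volume.restrict (spaceTime T Ω) = (volume.restrict (Ioo 0 T)).prod (volume.restrict Ω) := by
  rw [Measure.prod_restrict]
  rfl

variable {Ω : Set Plane} {T : ℝ}

theorem MeasureTheory.MemLp.locallyIntegrableOn {X F : Type*} [TopologicalSpace X]
    [MeasurableSpace X] [LocallyCompactSpace X]
    [BorelSpace X] [NormedAddCommGroup F] {m : Measure X}
    [IsFiniteMeasureOnCompacts m] {U : Set X} {a : X → F} (ha : MemLp a 2 (m.restrict U))
    (hU : IsOpen U) : LocallyIntegrableOn a U m := by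
  rw [locallyIntegrableOn_iff hU.isLocallyClosed]
  intro K hK hKc
  have : IsFiniteMeasure (m.restrict K) := ⟨by simpa using hKc.measure_lt_top⟩
  exact (ha.mono_measure (Measure.restrict_mono hK le_rfl)).integrable one_le_two

/-- A continuous functional on `L²(Ω; ℝ²)` that vanishes on smooth compactly supported fields
is zero. -/
theorem clm_eq_zero_of_test (hΩ : IsOpen Ω) (l : Lp Plane 2 (volume.restrict Ω) →L[ℝ] ℝ)
    (h : ∀ (φ : Plane → ℝ) (j : Fin 2), IsTestFunction Ω φ →
      ∀ g : Lp Plane 2 (volume.restrict Ω),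
        (g =ᵐ[volume.restrict Ω] fun x => φ x • planeBasis j) → l g = 0) : l = 0 := by
  obtain ⟨w, rfl⟩ := (InnerProductSpace.toDual ℝ (Lp Plane 2 (volume.restrict Ω))).surjective l
  have hw : MemLp w 2 (volume.restrict Ω) := Lp.memLp w
  have h0 : ∀ j, ∀ᵐ x ∂volume.restrict Ω, w x j = 0 := by
    intro j
    rw [ae_restrict_iff' hΩ.measurableSet]
    have hloc := (hw.component j).locallyIntegrableOn hΩ
    refine hΩ.ae_eq_zero_of_integral_contDiff_smul_eq_zero hloc fun φ hφ hc hs => ?_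
    have hφt : IsTestFunction Ω φ := ⟨hφ, hc, hs⟩
    have hm : MemLp (fun x => φ x • planeBasis j) 2 (volume.restrict Ω) := by
      refine (hφt.memLp (volume.restrict Ω) 2).mono
        (hφ.continuous.smul continuous_const).aestronglyMeasurable (ae_of_all _ fun x => ?_)
      simp [planeBasis, norm_smul]
    have h1 := h φ j hφt (hm.toLp _) hm.coeFn_toLp
    rw [InnerProductSpace.toDual_apply_apply, L2.inner_def] at h1
    rw [← h1, ← setIntegral_eq_integral_of_forall_compl_eq_zero (s := Ω)
      fun x hx => by simp [hφt.eq_zero hx]]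
    refine integral_congr_ae ?_
    filter_upwards [hm.coeFn_toLp] with x hx
    rw [hx]
    simp [planeBasis, inner_smul_right, PiLp.inner_apply]
  have hw0 : w = 0 := by
    rw [Lp.eq_zero_iff_ae_eq_zero]
    filter_upwards [h0 0, h0 1] with x h1 h2
    ext j
    fin_cases j
    · exact h1
    · exact h2
  rw [hw0, map_zero]

theorem integral_tprod_mul_component {v : ℝ → Plane → Plane}
    (hv : MemLp (fun z : ℝ × Plane => v z.1 z.2) 2
      ((volume.restrict (Ioo 0 T)).prod (volume.restrict Ω))) {φ : Plane → ℝ}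
    (hφ2 : MemLp φ 2 (volume.restrict Ω)) {c : ℝ → ℝ} (hc : Continuous c)
    (hcs : HasCompactSupport c) (j : Fin 2) :
    ∫ z, c z.1 * φ z.2 * v z.1 z.2 j ∂((volume.restrict (Ioo 0 T)).prod (volume.restrict Ω))
      = ∫ r in Ioo 0 T, c r * ∫ x in Ω, v r x j * φ x := by
  obtain ⟨C, hC⟩ := hcs.exists_bound_of_continuous hc
  have hi : Integrable (fun z : ℝ × Plane => (v z.1 z.2 j * c z.1) * φ z.2)
      ((volume.restrict (Ioo 0 T)).prod (volume.restrict Ω)) :=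
    ((hv.component j).mul_bdd (hc.comp continuous_fst).aestronglyMeasurable
      fun z => hC z.1).integrable_mul_two (hφ2.comp_snd _)
  have e : ∀ z : ℝ × Plane, c z.1 * φ z.2 * v z.1 z.2 j = (v z.1 z.2 j * c z.1) * φ z.2 :=
    fun z => by ring
  simp only [e]
  rw [integral_prod _ hi]
  congr 1 with r
  rw [← integral_const_mul]
  congr 1 with x
  ring

/-- Testing the weak time derivative with `θ(t)φ(x)` shows that the continuous function `t ↦ (u(t)
j, φ)` has an integrable weak derivative, hence is its primitive. -/
theorem integral_mul_test_sub_eq {u ut : ℝ → Plane → Plane}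
    (hus : ∀ t ∈ Icc 0 T, MemLp (u t) 2 (volume.restrict Ω))
    (huc : ∀ t ∈ Icc 0 T, Tendsto (fun s => eLpNorm (fun x => u s x - u t x) 2 (volume.restrict Ω))
      (𝓝[Icc 0 T] t) (𝓝 0))
    (hu : MemLp (fun z : ℝ × Plane => u z.1 z.2) 2 (volume.restrict (spaceTime T Ω)))
    (hut : MemLp (fun z : ℝ × Plane => ut z.1 z.2) 2 (volume.restrict (spaceTime T Ω)))
    (hw : HasWeakDeriv (spaceTime T Ω) ((1 : ℝ), (0 : Plane)) (fun z => u z.1 z.2)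
      (fun z => ut z.1 z.2)) {φ : Plane → ℝ} (hφ : IsTestFunction Ω φ) (j : Fin 2)
    {s t : ℝ} (hs : s ∈ Icc 0 T) (ht : t ∈ Icc 0 T) :
    (∫ x in Ω, u t x j * φ x) - ∫ x in Ω, u s x j * φ x
      = ∫ r in s..t, ∫ x in Ω, ut r x j * φ x := by
  have hφ2 : MemLp φ 2 (volume.restrict Ω) := hφ.memLp _ 2
  have hu' := hu
  have hut' := hut
  rw [volume_restrict_spaceTime] at hu' hut'
  refine sub_eq_integral_of_weak_deriv (a := fun r => ∫ x in Ω, u r x j * φ x) ?_ ?_ ?_ hs ht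
  · intro r hr
    rw [ContinuousWithinAt, tendsto_iff_norm_sub_tendsto_zero]
    have h0 := ((ENNReal.tendsto_toReal ENNReal.zero_ne_top).comp (huc r hr)).mul_const
      (eLpNorm φ 2 (volume.restrict Ω)).toReal
    rw [ENNReal.toReal_zero, zero_mul] at h0
    refine squeeze_zero' (Eventually.of_forall fun _ => norm_nonneg _) ?_ h0
    filter_upwards [self_mem_nhdsWithin] with q hq
    have hd : MemLp (fun x => u q x - u r x) 2 (volume.restrict Ω) := (hus q hq).sub (hus r hr)
    rw [← integral_sub (((hus q hq).component j).integrable_mul_two hφ2)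
      (((hus r hr).component j).integrable_mul_two hφ2)]
    simp only [← sub_mul]
    refine (abs_integral_mul_le (hd.component j) hφ2).trans ?_
    refine mul_le_mul_of_nonneg_right (ENNReal.toReal_mono hd.2.ne ?_) ENNReal.toReal_nonneg
    exact eLpNorm_mono fun x => PiLp.norm_apply_le _ j
  · exact ((hut'.component j).integrable_mul_two (hφ2.comp_snd _)).integral_prod_left
  · intro θ hθ
    have h1 := hw.integral_component hu hut (hθ.tprod hφ) j
    simp only [fderiv_tprod hθ.differentiable hφ.differentiable, map_zero, mul_zero, add_zero,
      mul_one] at h1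
    have hθ' : MemLp (deriv θ) 2 (volume.restrict (Ioo 0 T)) :=
      (hθ.1.continuous_deriv (by simp)).memLp_of_hasCompactSupport hθ.2.1.deriv
    have hθ2 : MemLp θ 2 (volume.restrict (Ioo 0 T)) := hθ.memLp _ 2
    rw [volume_restrict_spaceTime] at h1
    rw [integral_tprod_mul_component hu' hφ2 (hθ.1.continuous_deriv (by simp)) hθ.2.1.deriv,
      integral_tprod_mul_component hut' hφ2 hθ.1.continuous hθ.2.1] at h1
    exact h1

theorem ae_uIoc_of_ae_Ioo {s t : ℝ} (hs : s ∈ Icc 0 T) (ht : t ∈ Icc 0 T) {p : ℝ → Prop}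
    (hp : ∀ᵐ r ∂volume.restrict (Ioo 0 T), p r) : ∀ᵐ r, r ∈ uIoc s t → p r := by
  rw [ae_restrict_iff' measurableSet_Ioo] at hp
  have hne : ∀ᵐ r : ℝ, r ≠ T := by simp [ae_iff, measure_singleton]
  filter_upwards [hp, hne] with r h1 h2 h3
  rw [mem_uIoc] at h3
  refine h1 ⟨?_, lt_of_le_of_ne ?_ h2⟩
  · rcases h3 with h | h
    · exact hs.1.trans_lt h.1
    · exact ht.1.trans_lt h.1
  · rcases h3 with h | h
    · exact h.2.trans ht.2
    · exact h.2.trans hs.2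

/-- The functional is bounded because the slice norms of `ut` are integrable in time. It replaces a
Bochner integral of `ut` with values in `L²`. -/
theorem exists_clm_integral_inner {ut : ℝ → Plane → Plane}
    (hut' : MemLp (fun z : ℝ × Plane => ut z.1 z.2) 2
      ((volume.restrict (Ioo 0 T)).prod (volume.restrict Ω)))
    {s t : ℝ} (hs : s ∈ Icc 0 T) (ht : t ∈ Icc 0 T) :
    ∃ R : Lp Plane 2 (volume.restrict Ω) →L[ℝ] ℝ,
      ∀ b, R b = ∫ r in s..t, ∫ x in Ω, inner ℝ (ut r x) (b x) := by
  have hT : 0 ≤ T := hs.1.trans hs.2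
  have hii : ∀ {f : ℝ → ℝ}, IntegrableOn f (Ioo 0 T) → IntervalIntegrable f volume s t := by
    intro f hf
    have h1 : IntervalIntegrable f volume 0 T := by
      rw [intervalIntegrable_iff_integrableOn_Ioo_of_le hT]; exact hf
    exact h1.mono_set (by rw [uIcc_of_le hT]; exact uIcc_subset_Icc hs ht)
  have hmem : ∀ b : Plane → Plane, MemLp b 2 (volume.restrict Ω) →
      IntegrableOn (fun r => ∫ x in Ω, inner ℝ (ut r x) (b x)) (Ioo 0 T) := by
    intro b hb
    exact (hut'.integrable_inner_two (hb.comp_snd _)).integral_prod_left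
  obtain ⟨n, hn, hnr⟩ : ∃ n : ℝ → ℝ, IntegrableOn n (Ioo 0 T) volume ∧
      ∀ r, n r = (eLpNorm (ut r) 2 (volume.restrict Ω)).toReal :=
    ⟨fun r => (eLpNorm (ut r) 2 (volume.restrict Ω)).toReal,
      integrable_eLpNorm_slice (m := volume.restrict (Ioo 0 T)) (lam := volume.restrict Ω)
        (a := fun z : ℝ × Plane => ut z.1 z.2) hut', fun _ => rfl⟩
  have hsl : ∀ᵐ r ∂volume.restrict (Ioo 0 T), MemLp (ut r) 2 (volume.restrict Ω) :=
    MemLp.ae_slice (a := fun z : ℝ × Plane => ut z.1 z.2) hut'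
  have hadd : ∀ b c : Lp Plane 2 (volume.restrict Ω),
      (∫ r in s..t, ∫ x in Ω, inner ℝ (ut r x) ((b + c : Lp Plane 2 (volume.restrict Ω)) x))
      = (∫ r in s..t, ∫ x in Ω, inner ℝ (ut r x) (b x))
        + ∫ r in s..t, ∫ x in Ω, inner ℝ (ut r x) (c x) := by
    intro b c
    rw [← intervalIntegral.integral_add (hii (hmem b (Lp.memLp b))) (hii (hmem c (Lp.memLp c)))]
    refine intervalIntegral.integral_congr_ae ?_
    filter_upwards [ae_uIoc_of_ae_Ioo hs ht hsl] with r hr hr'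
    rw [← integral_add ((hr hr').integrable_inner_two (Lp.memLp b))
      ((hr hr').integrable_inner_two (Lp.memLp c))]
    refine integral_congr_ae ?_
    filter_upwards [Lp.coeFn_add b c] with x hx
    rw [hx, Pi.add_apply, inner_add_right]
  have hsmul : ∀ (k : ℝ) (b : Lp Plane 2 (volume.restrict Ω)),
      (∫ r in s..t, ∫ x in Ω, inner ℝ (ut r x) ((k • b : Lp Plane 2 (volume.restrict Ω)) x))
      = k • ∫ r in s..t, ∫ x in Ω, inner ℝ (ut r x) (b x) := by
    intro k b
    rw [smul_eq_mul, ← intervalIntegral.integral_const_mul]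
    refine intervalIntegral.integral_congr_ae (ae_of_all _ fun r _ => ?_)
    rw [← integral_const_mul]
    refine integral_congr_ae ?_
    filter_upwards [Lp.coeFn_smul k b] with x hx
    rw [hx, Pi.smul_apply, inner_smul_right]
  have hbd : ∀ b : Lp Plane 2 (volume.restrict Ω),
      ‖∫ r in s..t, ∫ x in Ω, inner ℝ (ut r x) (b x)‖ ≤ |∫ r in s..t, n r| * ‖b‖ := by
    intro b
    have h1 : ‖∫ r in s..t, ∫ x in Ω, inner ℝ (ut r x) (b x)‖ ≤ |∫ r in s..t, n r * ‖b‖| := by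
      refine intervalIntegral.norm_integral_le_abs_of_norm_le ?_ ((hii hn).mul_const _)
      rw [ae_restrict_iff' measurableSet_uIoc]
      filter_upwards [ae_uIoc_of_ae_Ioo hs ht hsl] with r hr hr'
      rw [Lp.norm_def, hnr]
      exact abs_integral_inner_le (hr hr') (Lp.memLp b)
    rwa [intervalIntegral.integral_mul_const, abs_mul, abs_of_nonneg (norm_nonneg b)] at h1
  exact ⟨(IsLinearMap.mk' _ ⟨hadd, hsmul⟩).mkContinuous _ hbd, fun b => rfl⟩

/-- `(u(t), g) - (u(s), g) = ∫ₛᵗ (∂ₜu, g)` for `u ∈ C([0,T]; L²)` with weak time derivative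
in `L²`. -/
theorem integral_inner_sub_eq (hΩ : IsOpen Ω) {u ut : ℝ → Plane → Plane}
    (hus : ∀ t ∈ Icc 0 T, MemLp (u t) 2 (volume.restrict Ω))
    (huc : ∀ t ∈ Icc 0 T, Tendsto (fun s => eLpNorm (fun x => u s x - u t x) 2 (volume.restrict Ω))
      (𝓝[Icc 0 T] t) (𝓝 0))
    (hu : MemLp (fun z : ℝ × Plane => u z.1 z.2) 2 (volume.restrict (spaceTime T Ω)))
    (hut : MemLp (fun z : ℝ × Plane => ut z.1 z.2) 2 (volume.restrict (spaceTime T Ω)))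
    (hw : HasWeakDeriv (spaceTime T Ω) ((1 : ℝ), (0 : Plane)) (fun z => u z.1 z.2)
      (fun z => ut z.1 z.2)) {g : Plane → Plane} (hg : MemLp g 2 (volume.restrict Ω))
    {s t : ℝ} (hs : s ∈ Icc 0 T) (ht : t ∈ Icc 0 T) :
    (∫ x in Ω, inner ℝ (u t x) (g x)) - ∫ x in Ω, inner ℝ (u s x) (g x)
      = ∫ r in s..t, ∫ x in Ω, inner ℝ (ut r x) (g x) := by
  have hut' := hut
  rw [volume_restrict_spaceTime] at hut'
  obtain ⟨R, hR⟩ := exists_clm_integral_inner hut' hs ht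
  -- Both sides are continuous linear functionals of `g`, so their difference `l` needs to vanish
  -- only on test functions.
  let l : Lp Plane 2 (volume.restrict Ω) →L[ℝ] ℝ :=
    InnerProductSpace.toDual ℝ _ ((hus t ht).toLp - (hus s hs).toLp) - R
  have hl : ∀ b, l b = (inner ℝ (hus t ht).toLp b - inner ℝ (hus s hs).toLp b) - R b := by
    intro b
    simp [l, InnerProductSpace.toDual_apply_apply]
  have hl0 : l = 0 := by
    refine clm_eq_zero_of_test hΩ l fun φ j hφ b hb => ?_
    have hin : ∀ v : Plane → Plane, ∫ x in Ω, inner ℝ (v x) (b x) = ∫ x in Ω, v x j * φ x := by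
      intro v
      refine integral_congr_ae ?_
      filter_upwards [hb] with x hx
      rw [hx]
      simp [planeBasis, inner_smul_right, PiLp.inner_apply, mul_comm]
    have hinn : ∀ τ (hτ : τ ∈ Icc 0 T), inner ℝ (hus τ hτ).toLp b = ∫ x in Ω, u τ x j * φ x := by
      intro τ hτ
      rw [← hin, integral_inner_eq (hus τ hτ) (Lp.memLp b), Lp.toLp_coeFn]
    rw [hl, hinn t ht, hinn s hs, hR]
    simp_rw [hin]
    rw [sub_eq_zero]
    exact integral_mul_test_sub_eq hus huc hu hut hw hφ j hs ht
  have := hl (hg.toLp g)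
  rw [hl0, zero_apply, ← integral_inner_eq (hus t ht) hg,
    ← integral_inner_eq (hus s hs) hg] at this
  have hRg : R (hg.toLp g) = ∫ r in s..t, ∫ x in Ω, inner ℝ (ut r x) (g x) := by
    rw [hR]
    refine intervalIntegral.integral_congr fun r _ => ?_
    refine integral_congr_ae ?_
    filter_upwards [hg.coeFn_toLp] with x hx
    rw [hx]
  rw [hRg] at this
  linarith

end TimeDerivative

/-! ### The uniform energy estimate -/

section NavierStokes

variable {Ω : Set Plane} {T ν : ℝ} {f : Plane → Plane} {u : ℝ → Plane → Plane}

/-- Fubini collects all almost everywhere conditions into a single null set of times, off which the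
equation is available at fixed time with every term in `L²`. -/
theorem IsStrongNavierStokes.exists_slices (h : IsStrongNavierStokes Ω T ν f u)
    (hf : MemLp f 2 (volume.restrict Ω)) :
    ∃ (ut : ℝ → Plane → Plane) (Du : Fin 2 → ℝ → Plane → Plane)
      (D2u : Fin 2 → Fin 2 → ℝ → Plane → Plane) (p : ℝ → Plane → ℝ) (Dp : Fin 2 → ℝ → Plane → ℝ),
      MemLp (fun z : ℝ × Plane => ut z.1 z.2) 2 (volume.restrict (spaceTime T Ω)) ∧
      HasWeakDeriv (spaceTime T Ω) ((1 : ℝ), (0 : Plane)) (fun z => u z.1 z.2)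
        (fun z => ut z.1 z.2) ∧
      (∀ i, MemLp (fun z : ℝ × Plane => Du i z.1 z.2) 2 (volume.restrict (spaceTime T Ω))) ∧
      ∀ᵐ t ∂volume.restrict (Ioo 0 T), IsNavierStokesSlice Ω ν f (ut t) (u t) (fun i => Du i t)
        (fun i j => D2u i j t) (p t) (fun i => Dp i t) := by
  obtain ⟨ut, Du, D2u, p, Dp, hut, hwt, hDu, hH, -, hD2, hwD2, hp, hDp, hwp, hdiv, heq⟩ := h.equation
  refine ⟨ut, Du, D2u, p, Dp, hut, hwt, hDu, ?_⟩
  rw [volume_restrict_spaceTime] at hut hp hdiv heq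
  simp only [volume_restrict_spaceTime] at hDu hD2 hDp
  have h1 := MemLp.ae_slice (a := fun z : ℝ × Plane => ut z.1 z.2) hut
  have h2 : ∀ᵐ t ∂volume.restrict (Ioo 0 T), ∀ i j, MemLp (D2u i j t) 2 (volume.restrict Ω) :=
    ae_all_iff.2 fun i => ae_all_iff.2 fun j =>
      MemLp.ae_slice (a := fun z : ℝ × Plane => D2u i j z.1 z.2) (hD2 i j)
  have h3 := MemLp.ae_slice (a := fun z : ℝ × Plane => p z.1 z.2) hp
  have h4 : ∀ᵐ t ∂volume.restrict (Ioo 0 T), ∀ i, MemLp (Dp i t) 2 (volume.restrict Ω) :=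
    ae_all_iff.2 fun i => MemLp.ae_slice (a := fun z : ℝ × Plane => Dp i z.1 z.2) (hDp i)
  filter_upwards [h1, h2, h3, h4, hH, hwD2, hwp, Measure.ae_ae_of_ae_prod hdiv,
    Measure.ae_ae_of_ae_prod heq] with t g1 g2 g3 g4 g5 g6 g7 g8 g9
  exact ⟨g5, g1, hf, g2, g6, g3, g4, g7, g8, g9⟩

/-- The energy estimate, uniform in the viscosity. -/
theorem IsStrongNavierStokes.eLpNorm_le (h : IsStrongNavierStokes Ω T ν f u) (hΩ : IsOpen Ω)
    (hν : 0 ≤ ν) (hf : MemLp f 2 (volume.restrict Ω)) {a F : ℝ≥0}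
    (ha : eLpNorm (u 0) 2 (volume.restrict Ω) ≤ a) (hF : eLpNorm f 2 (volume.restrict Ω) ≤ F)
    {t : ℝ} (ht : t ∈ Icc 0 T) :
    eLpNorm (u t) 2 (volume.restrict Ω) ≤ ((a + 2 * T.toNNReal * F : ℝ≥0) : ℝ≥0∞) := by
  classical
  have hT : 0 ≤ T := ht.1.trans ht.2
  have h0 : (0 : ℝ) ∈ Icc 0 T := ⟨le_rfl, hT⟩
  obtain ⟨ut, Du, D2u, p, Dp, hut, hwt, -, hsl⟩ := h.exists_slices hf
  have hu := h.memLp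
  have hut' := hut
  have hu' := hu
  rw [volume_restrict_spaceTime] at hu' hut'
  obtain ⟨U, hU⟩ : ∃ U : ℝ → Lp Plane 2 (volume.restrict Ω),
      ∀ τ (hτ : τ ∈ Icc 0 T), U τ = (h.memLp_slice τ hτ).toLp := by
    refine ⟨fun τ => if hτ : τ ∈ Icc 0 T then (h.memLp_slice τ hτ).toLp else 0, fun τ hτ => ?_⟩
    simp [hτ]
  obtain ⟨V, hV⟩ : ∃ V : ℝ → Lp Plane 2 (volume.restrict Ω),
      ∀ r (hr : MemLp (ut r) 2 (volume.restrict Ω)), V r = hr.toLp := by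
    refine ⟨fun r => if hr : MemLp (ut r) 2 (volume.restrict Ω) then hr.toLp else 0,
      fun r hr => ?_⟩
    simp [hr]
  have hUU : ∀ τ (hτ : τ ∈ Icc 0 T) (g : Plane → Plane) (hg : MemLp g 2 (volume.restrict Ω)),
      inner ℝ (U τ) hg.toLp = ∫ x in Ω, inner ℝ (u τ x) (g x) := fun τ hτ g hg => by
    rw [hU τ hτ, ← integral_inner_eq]
  have hVg : ∀ (g : Plane → Plane) (hg : MemLp g 2 (volume.restrict Ω)),
      ∀ᵐ r ∂volume.restrict (Ioo 0 T),
        inner ℝ (V r) hg.toLp = ∫ x in Ω, inner ℝ (ut r x) (g x) := fun g hg => by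
    filter_upwards [hsl] with r hr
    rw [hV r hr.memLp_ut, ← integral_inner_eq]
  have hIoo : ∀ᵐ r ∂volume.restrict (Ioo 0 T), r ∈ Icc 0 T := by
    filter_upwards [ae_restrict_mem measurableSet_Ioo] with r hr using ⟨hr.1.le, hr.2.le⟩
  have hVU : ∀ᵐ r ∂volume.restrict (Ioo 0 T),
      inner ℝ (V r) (U r) = ∫ x in Ω, inner ℝ (ut r x) (u r x) := by
    filter_upwards [hsl, hIoo] with r hr hr'
    rw [hV r hr.memLp_ut, hU r hr', ← integral_inner_eq]
  have hFU : ∀ᵐ r ∂volume.restrict (Ioo 0 T), inner ℝ (V r) (U r) ≤ inner ℝ hf.toLp (U r) := by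
    filter_upwards [hsl, hIoo, hVU] with r hr hr' h1
    rw [h1, hU r hr', ← integral_inner_eq, integral_inner_eq_sum hr.memLp_ut (h.memLp_slice r hr'),
      integral_inner_eq_sum hf (h.memLp_slice r hr')]
    exact hr.sum_integral_ut_mul_self_le hΩ hν
  have hUc : ContinuousOn U (Icc 0 T) := by
    intro r hr
    rw [ContinuousWithinAt, tendsto_iff_edist_tendsto_0]
    refine (h.continuous_time r hr).congr' ?_
    filter_upwards [self_mem_nhdsWithin] with q hq
    rw [hU q hq, hU r hr, Lp.edist_toLp_toLp]
    rfl
  have hiVU : IntegrableOn (fun r => inner ℝ (V r) (U r)) (Ioo 0 T) volume := by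
    have h1 : IntegrableOn (fun r => ∫ x in Ω, inner ℝ (ut r x) (u r x)) (Ioo 0 T) volume :=
      (hut'.integrable_inner_two hu').integral_prod_left
    refine Integrable.congr h1 ?_
    filter_upwards [hVU] with r hr using hr.symm
  have key : ∀ t ∈ Icc 0 T, ‖U t‖ ^ 2 - ‖U 0‖ ^ 2 = 2 * ∫ r in (0 : ℝ)..t, inner ℝ (V r) (U r) := by
    intro t ht
    refine norm_sq_sub_eq_integral (T := T)
      (n := fun r => (eLpNorm (ut r) 2 (volume.restrict Ω)).toReal) hUc ?_ ?_ ?_ hiVU ?_ ht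
    · exact integrable_eLpNorm_slice (m := volume.restrict (Ioo 0 T)) (lam := volume.restrict Ω)
        (a := fun z : ℝ × Plane => ut z.1 z.2) hut'
    · filter_upwards [hsl] with r hr
      rw [hV r hr.memLp_ut, Lp.norm_toLp]
    · intro τ hτ
      have h1 : IntegrableOn (fun r => ∫ x in Ω, inner ℝ (ut r x) (u τ x)) (Ioo 0 T) volume :=
        (hut'.integrable_inner_two ((h.memLp_slice τ hτ).comp_snd _)).integral_prod_left
      refine Integrable.congr h1 ?_
      rw [hU τ hτ]
      filter_upwards [hVg _ (h.memLp_slice τ hτ)] with r hr using hr.symm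
    · intro τ hτ s hs t ht
      have h1 := integral_inner_sub_eq hΩ h.memLp_slice h.continuous_time hu hut hwt
        (h.memLp_slice τ hτ) hs ht
      rw [hU τ hτ, hUU t ht, hUU s hs, h1]
      refine intervalIntegral.integral_congr_ae ?_
      filter_upwards [ae_uIoc_of_ae_Ioo hs ht (hVg _ (h.memLp_slice τ hτ))] with r hr hr'
      exact (hr hr').symm
  -- At a time of maximal norm `S` the energy inequality reads `S² ≤ a² + 2TFS`, which forces `S ≤ a
  -- + 2TF`; Gronwall's lemma is not needed.
  obtain ⟨τ, hτ, hmax⟩ := isCompact_Icc.exists_isMaxOn ⟨0, h0⟩ hUc.norm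
  have hmax' : ∀ r ∈ Icc 0 T, ‖U r‖ ≤ ‖U τ‖ := fun r hr => hmax hr
  have hFn : ‖hf.toLp‖ ≤ F := by
    rw [Lp.norm_toLp]; exact ENNReal.toReal_le_coe_of_le_coe hF
  have hU0 : ‖U 0‖ ≤ a := by
    rw [hU 0 h0, Lp.norm_toLp]; exact ENNReal.toReal_le_coe_of_le_coe ha
  have hb : ∫ r in (0 : ℝ)..τ, inner ℝ (V r) (U r) ≤ T * (F * ‖U τ‖) := by
    have h2 : ∫ r in (0 : ℝ)..τ, inner ℝ (V r) (U r) ≤ ∫ _ in (0 : ℝ)..τ, F * ‖U τ‖ := by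
      refine intervalIntegral.integral_mono_ae_restrict hτ.1 ?_ (by simp) ?_
      · have h1 : IntervalIntegrable (fun r => inner ℝ (V r) (U r)) volume 0 T := by
          rw [intervalIntegrable_iff_integrableOn_Ioo_of_le hT]; exact hiVU
        exact h1.mono_set (by rw [uIcc_of_le hT]; exact uIcc_subset_Icc h0 hτ)
      · have h3 := ae_uIoc_of_ae_Ioo h0 hτ (hFU.and hIoo)
        rw [← restrict_Ioc_eq_restrict_Icc] 
        rw [EventuallyLE, ae_restrict_iff' measurableSet_Ioc]
        filter_upwards [h3] with r hr hr'
        rw [uIoc_of_le hτ.1] at hr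
        refine (hr hr').1.trans ((real_inner_le_norm _ _).trans ?_)
        exact mul_le_mul hFn (hmax' r (hr hr').2) (norm_nonneg _) F.2
    rw [intervalIntegral.integral_const, sub_zero, smul_eq_mul] at h2
    exact h2.trans (mul_le_mul_of_nonneg_right hτ.2 (by positivity))
  have hS : ‖U τ‖ ≤ a + 2 * T * F := by
    have h1 := key τ hτ
    by_contra! hc
    have hF0 : (0 : ℝ) ≤ F := F.2
    have ha0 : (0 : ℝ) ≤ a := a.2
    have hTF : 0 ≤ T * F := mul_nonneg hT hF0
    have h4 : ‖U 0‖ ^ 2 ≤ (a : ℝ) ^ 2 := pow_le_pow_left₀ (norm_nonneg _) hU0 2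
    have h5 : ‖U τ‖ * (‖U τ‖ - 2 * T * F) ≤ (a : ℝ) ^ 2 := by nlinarith
    have h6 : (a : ℝ) < ‖U τ‖ - 2 * T * F := by linarith
    have h7 : (a : ℝ) < ‖U τ‖ := by nlinarith
    nlinarith
  have hfin := (hmax' t ht).trans hS
  rw [hU t ht, Lp.norm_toLp] at hfin
  rw [← ENNReal.ofReal_toReal (h.memLp_slice t ht).2.ne]
  refine (ENNReal.ofReal_le_ofReal hfin).trans (le_of_eq ?_)
  rw [← ENNReal.ofReal_coe_nnreal]
  congr 1
  push_cast
  rw [Real.coe_toNNReal T hT]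

end NavierStokes

/-! ### Equicontinuity in time, the weak form and the vorticity of solutions -/

section NavierStokes

variable {Ω : Set Plane} {T ν : ℝ} {f : Plane → Plane} {u : ℝ → Plane → Plane}

theorem sum_sum_integral_le {X : Type*} [MeasurableSpace X] {m : Measure X}
    {a b : Fin 2 → Fin 2 → X → ℝ} (ha : ∀ i j, MemLp (a i j) 2 m) (hb : ∀ i j, MemLp (b i j) 2 m)
    {A B : ℝ≥0} (hA : ∀ i j, eLpNorm (a i j) 2 m ≤ A) (hB : ∀ i j, eLpNorm (b i j) 2 m ≤ B) :
    |∑ i, ∑ j, ∫ x, a i j x * b i j x ∂m| ≤ 4 * (A * B) := by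
  refine (Finset.abs_sum_le_sum_abs _ _).trans ((Finset.sum_le_sum fun i _ =>
    (Finset.abs_sum_le_sum_abs _ _).trans (Finset.sum_le_sum fun j _ =>
      abs_integral_mul_le_of_le (ha i j) (hb i j) (hA i j) (hB i j))).trans (le_of_eq ?_))
  simp
  ring

theorem eLpNorm_component_le {X : Type*} [MeasurableSpace X] {m : Measure X} (v : X → Plane)
    (j : Fin 2) : eLpNorm (fun x => v x j) 2 m ≤ eLpNorm v 2 m :=
  eLpNorm_mono fun _ => PiLp.norm_apply_le _ j

theorem exists_common_bound {α : Type*} {m : α → ℝ≥0∞} [Finite α] (h : ∀ i, m i < ⊤) :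
    ∃ C : ℝ≥0, ∀ i, m i ≤ C := by
  have := Fintype.ofFinite α
  refine ⟨∑ i, (m i).toNNReal, fun i => ?_⟩
  rw [← ENNReal.coe_toNNReal (h i).ne]
  exact ENNReal.coe_le_coe.2
    (Finset.single_le_sum (f := fun i => (m i).toNNReal) (fun _ _ => zero_le) (Finset.mem_univ i))

/-- Pairings with divergence-free test fields are Lipschitz in time, uniformly in the viscosity. -/
theorem exists_lipschitz_of_isStrongNavierStokes {ψ : Fin 2 → Plane → ℝ}
    (hψ : ∀ j, IsTestFunction Ω (ψ j))
    (hdivψ : ∀ x, ∑ i, fderiv ℝ (ψ i) x (planeBasis i) = 0) (T : ℝ) (E F N : ℝ≥0) :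
    ∃ L : ℝ, ∀ (ν : ℝ) (f : Plane → Plane) (u : ℝ → Plane → Plane), |ν| ≤ N →
      MemLp f 2 (volume.restrict Ω) → eLpNorm f 2 (volume.restrict Ω) ≤ F →
      IsStrongNavierStokes Ω T ν f u →
      (∀ t ∈ Icc 0 T, eLpNorm (u t) 2 (volume.restrict Ω) ≤ E) →
      ∀ s ∈ Icc 0 T, ∀ t ∈ Icc 0 T,
        |∑ j, (∫ x in Ω, u t x j * ψ j x) - ∑ j, ∫ x in Ω, u s x j * ψ j x| ≤ L * |t - s| := by
  have hdd : ∀ i j, IsTestFunction Ω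
      (fun x => fderiv ℝ (fun y => fderiv ℝ (ψ j) y (planeBasis i)) x (planeBasis i)) := fun i j =>
    ((hψ j).fderiv_apply _).fderiv_apply _
  have hddm := fun i j => (hdd i j).memLp (volume.restrict Ω) 2
  have hψm := fun j => (hψ j).memLp (volume.restrict Ω) 2
  obtain ⟨C1, hC1⟩ := exists_common_bound (m := fun p : Fin 2 × Fin 2 => eLpNorm (fun x =>
    fderiv ℝ (fun y => fderiv ℝ (ψ p.2) y (planeBasis p.1)) x (planeBasis p.1)) 2
      (volume.restrict Ω)) fun p => (hddm p.1 p.2).2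
  obtain ⟨C2, hC2⟩ := exists_common_bound (m := fun j => eLpNorm (ψ j) 2
      (volume.restrict Ω)) fun j => (hψm j).2
  choose D' hD' using fun i j => ((hψ j).fderiv_apply (planeBasis i)).abs_le
  set D := ∑ i, ∑ j, D' i j with hDdef
  have hD : ∀ i j x, |fderiv ℝ (ψ j) x (planeBasis i)| ≤ D := fun i j x =>
    (hD' i j x).trans (NNReal.coe_le_coe.2
      ((Finset.single_le_sum (f := D' i) (fun _ _ => zero_le) (Finset.mem_univ j)).trans
      (Finset.single_le_sum (f := fun i => ∑ j, D' i j) (fun _ _ => zero_le) (Finset.mem_univ i))))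
  -- The three contributions are viscosity and convection, with four pairs of indices each, and the
  -- force, with two components. `C1` bounds second derivatives of `ψ` in `L²`, `D` its first
  -- derivatives uniformly and `C2` the field in `L²`; no gradient of the velocity enters.
  refine ⟨N * (4 * (E * C1)) + 4 * (E * (D * E)) + 2 * (F * C2),
    fun ν f u hν hf hF h hE s hs t ht => ?_⟩
  obtain ⟨ut, Du, D2u, p, Dp, hut, hwt, -, hsl⟩ := h.exists_slices hf
  have hut' := hut
  rw [volume_restrict_spaceTime] at hut'
  rw [← Finset.sum_sub_distrib]
  simp_rw [fun j => integral_mul_test_sub_eq h.memLp_slice h.continuous_time h.memLp hut hwt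
    (hψ j) j hs ht]
  have hii : ∀ j, IntervalIntegrable (fun r => ∫ x in Ω, ut r x j * ψ j x) volume s t := by
    intro j
    have hT : 0 ≤ T := hs.1.trans hs.2
    have h1 : IntervalIntegrable (fun r => ∫ x in Ω, ut r x j * ψ j x) volume 0 T := by
      rw [intervalIntegrable_iff_integrableOn_Ioo_of_le hT]
      exact ((hut'.component j).integrable_mul_two ((hψm j).comp_snd _)).integral_prod_left
    exact h1.mono_set (by rw [uIcc_of_le hT]; exact uIcc_subset_Icc hs ht)
  rw [← intervalIntegral.integral_finsetSum fun j _ => hii j]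
  rw [← Real.norm_eq_abs]
  refine intervalIntegral.norm_integral_le_of_norm_le_const_ae ?_
  have hIoo : ∀ᵐ r ∂volume.restrict (Ioo 0 T), r ∈ Icc 0 T := by
    filter_upwards [ae_restrict_mem measurableSet_Ioo] with r hr using ⟨hr.1.le, hr.2.le⟩
  filter_upwards [ae_uIoc_of_ae_Ioo hs ht (hsl.and hIoo)] with r hr hr'
  obtain ⟨hr, hrT⟩ := hr hr'
  have hur : ∀ j, MemLp (fun x => u r x j) 2 (volume.restrict Ω) := fun j =>
    (h.memLp_slice r hrT).component j
  have hurE : ∀ j, eLpNorm (fun x => u r x j) 2 (volume.restrict Ω) ≤ E := fun j =>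
    (eLpNorm_component_le (u r) j).trans (hE r hrT)
  rw [Real.norm_eq_abs, hr.sum_integral_ut_mul_test hψ hdivψ]
  refine (abs_add_le _ _).trans (add_le_add ((abs_add_le _ _).trans (add_le_add ?_ ?_)) ?_)
  · rw [abs_mul]
    refine mul_le_mul hν ?_ (abs_nonneg _) N.2
    exact sum_sum_integral_le (fun j _ => hur j) (fun j i => hddm i j) (fun j _ => hurE j)
      fun j i => hC1 (i, j)
  · have hm := fun i j => ((hψ j).fderiv_apply (planeBasis i)).aesm (volume.restrict Ω)
    have h1 := sum_sum_integral_le (a := fun _ i x => u r x i)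
      (b := fun j i x => u r x j * fderiv ℝ (ψ j) x (planeBasis i)) (B := D * E)
      (fun j i => hur i) (fun j i => (hur j).mul_bdd (hm i j) (hD i j)) (fun _ i => hurE i)
      fun j i => by
        rw [ENNReal.coe_mul]
        exact (eLpNorm_mul_bdd_le (hD i j)).trans (mul_le_mul_right (hurE j) _)
    exact_mod_cast h1
  · refine (Finset.abs_sum_le_sum_abs _ _).trans ((Finset.sum_le_sum fun j _ =>
      abs_integral_mul_le_of_le (hf.component j) (hψm j)
        ((eLpNorm_component_le f j).trans hF) (hC2 j)).trans (le_of_eq ?_))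
    simp

theorem integral_add_three {X : Type*} [MeasurableSpace X] {m : Measure X} {a b c : X → ℝ}
    (ha : Integrable a m) (hb : Integrable b m) (hc : Integrable c m) :
    ∫ x, (a x + b x + c x) ∂m = (∫ x, a x ∂m) + (∫ x, b x ∂m) + ∫ x, c x ∂m := by
  have hab : Integrable (fun x => a x + b x) m := ha.add hb
  rw [integral_add hab hc, integral_add ha hb]

/-- The weak form of the Navier–Stokes equations. -/
theorem IsStrongNavierStokes.weak_form (h : IsStrongNavierStokes Ω T ν f u)
    (hf : MemLp f 2 (volume.restrict Ω)) {Φ : Fin 2 → ℝ × Plane → ℝ}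
    (hΦ : ∀ j, IsTestFunction (spaceTime T Ω) (Φ j))
    (hdiv : ∀ z, ∑ i, fderiv ℝ (Φ i) z (0, planeBasis i) = 0) :
    (∑ j, ∫ z in spaceTime T Ω, fderiv ℝ (Φ j) z (1, 0) * u z.1 z.2 j)
      + ν * (∑ j, ∑ i, ∫ z in spaceTime T Ω, u z.1 z.2 j
          * fderiv ℝ (fun w => fderiv ℝ (Φ j) w (0, planeBasis i)) z (0, planeBasis i))
      + (∑ j, ∑ i, ∫ z in spaceTime T Ω, u z.1 z.2 i
          * (u z.1 z.2 j * fderiv ℝ (Φ j) z (0, planeBasis i)))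
      + ∑ j, ∫ z in spaceTime T Ω, f z.2 j * Φ j z = 0 := by
  obtain ⟨ut, Du, D2u, p, Dp, hut, hwt, -, hsl⟩ := h.exists_slices hf
  have hu := h.memLp
  simp_rw [fun j => hwt.integral_component hu hut (hΦ j) j]
  rw [volume_restrict_spaceTime] at hu hut ⊢
  have hΦm := fun j => (hΦ j).memLp
    ((volume.restrict (Ioo 0 T)).prod (volume.restrict Ω)) 2
  have hdd := fun i j => (((hΦ j).fderiv_apply (0, planeBasis i)).fderiv_apply
    (0, planeBasis i)).memLp
    ((volume.restrict (Ioo 0 T)).prod (volume.restrict Ω)) 2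
  choose D hD using fun i j => ((hΦ j).fderiv_apply (0, planeBasis i)).abs_le
  have hdm := fun i j => ((hΦ j).fderiv_apply (0, planeBasis i)).aesm
    ((volume.restrict (Ioo 0 T)).prod (volume.restrict Ω))
  have i0 := fun j => (hΦm j).integrable_mul_two (hut.component j)
  have i1 := fun i j => (hu.component j).integrable_mul_two (hdd i j)
  have i2 := fun i j => (hu.component i).integrable_mul_two ((hu.component j).mul_bdd (hdm i j) (hD i j))
  have i3 := fun j => ((hf.comp_snd (volume.restrict (Ioo 0 T))).component j).integrable_mul_two (hΦm j)
  simp_rw [fun j => integral_prod _ (i0 j), fun i j => integral_prod _ (i1 i j),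
    fun i j => integral_prod _ (i2 i j), fun j => integral_prod _ (i3 j)]
  have j0 := fun j => (i0 j).integral_prod_left
  have j1 := fun i j => (i1 i j).integral_prod_left
  have j2 := fun i j => (i2 i j).integral_prod_left
  have j3 := fun j => (i3 j).integral_prod_left
  simp only [Finset.sum_neg_distrib]
  have s1 := fun j => integral_finsetSum Finset.univ fun i _ => j1 i j
  have s2 := fun j => integral_finsetSum Finset.univ fun i _ => j2 i j
  simp only [← s1, ← s2]
  have k1 := fun j => integrable_finsetSum Finset.univ fun i _ => j1 i j
  have k2 := fun j => integrable_finsetSum Finset.univ fun i _ => j2 i j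
  rw [← integral_finsetSum _ fun j _ => j0 j, ← integral_finsetSum _ fun j _ => k1 j,
    ← integral_finsetSum _ fun j _ => k2 j, ← integral_finsetSum _ fun j _ => j3 j,
    ← integral_const_mul, add_assoc, add_assoc, neg_add_eq_zero, ← add_assoc,
    ← integral_add_three ((integrable_finsetSum Finset.univ fun j _ => k1 j).const_mul ν)
      (integrable_finsetSum Finset.univ fun j _ => k2 j)
      (integrable_finsetSum Finset.univ fun j _ => j3 j)]
  refine integral_congr_ae ?_
  filter_upwards [hsl] with t ht
  have hfd : ∀ j i, (fun x => fderiv ℝ (fun x => Φ j (t, x)) x (planeBasis i))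
      = fun x => fderiv ℝ (Φ j) (t, x) (0, planeBasis i) := fun j i => by
    ext x
    exact fderiv_slice (z := (t, x)) ((hΦ j).differentiable _) _
  have hfd2 : ∀ j i x, fderiv ℝ (fun x => fderiv ℝ (Φ j) (t, x) (0, planeBasis i)) x (planeBasis i)
      = fderiv ℝ (fun w => fderiv ℝ (Φ j) w (0, planeBasis i)) (t, x) (0, planeBasis i) :=
    fun j i x => fderiv_slice (φ := fun w => fderiv ℝ (Φ j) w (0, planeBasis i)) (z := (t, x))
      (((hΦ j).fderiv_apply (0, planeBasis i)).differentiable _) _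
  have key := ht.sum_integral_ut_mul_test (ψ := fun j x => Φ j (t, x)) (fun j => (hΦ j).slice t)
    (fun x => by simp only [fun j i => congrFun (hfd j i) x]; exact hdiv (t, x))
  simp only [hfd2, fun j i x => congrFun (hfd j i) x] at key
  simp only [mul_comm (Φ _ _) (ut _ _ _)]
  exact key

theorem IsNavierStokesSlice.sum_integral_mul_fderiv {ut v : Plane → Plane}
    {Dv : Fin 2 → Plane → Plane} {D2v : Fin 2 → Fin 2 → Plane → Plane} {p : Plane → ℝ}
    {Dp : Fin 2 → Plane → ℝ} (h : IsNavierStokesSlice Ω ν f ut v Dv D2v p Dp) {ψ : Plane → ℝ}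
    (hψ : IsTestFunction Ω ψ) : ∑ i, ∫ x in Ω, v x i * fderiv ℝ ψ x (planeBasis i) = 0 := by
  have hψm : MemLp ψ 2 (volume.restrict Ω) := hψ.memLp _ 2
  have h1 : ∀ i, ∫ x in Ω, v x i * fderiv ℝ ψ x (planeBasis i) = - ∫ x in Ω, ψ x * Dv i x i :=
    fun i => by
      rw [← (h.memH10.1.2 i).2.integral_component h.memH10.1.1 (h.memH10.1.2 i).1 hψ i]
      simp only [mul_comm]
  simp only [h1]
  rw [Finset.sum_neg_distrib, ← integral_finsetSum _ fun i _ =>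
    hψm.integrable_mul_two ((h.memH10.1.2 i).1.component i), neg_eq_zero]
  refine integral_eq_zero_of_ae ?_
  filter_upwards [h.div] with x hx
  rw [← Finset.mul_sum, hx, mul_zero, Pi.zero_apply]

theorem isOpen_spaceTime (hΩ : IsOpen Ω) : IsOpen (spaceTime T Ω) := isOpen_Ioo.prod hΩ

/-- The distributional vorticity is the curl of the weak gradient. -/
theorem IsVorticity.ae_eq (hΩ : IsOpen Ω) {om : ℝ → Plane → ℝ} (hom : IsVorticity Ω T u om)
    {Du : Fin 2 → ℝ → Plane → Plane}
    (hu : MemLp (fun z : ℝ × Plane => u z.1 z.2) 2 (volume.restrict (spaceTime T Ω)))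
    (hDu : ∀ i, MemLp (fun z : ℝ × Plane => Du i z.1 z.2) 2 (volume.restrict (spaceTime T Ω)))
    (hw : ∀ᵐ t ∂volume.restrict (Ioo 0 T), ∀ i, HasWeakDeriv Ω (planeBasis i) (u t) (Du i t)) :
    ∀ᵐ z ∂volume.restrict (spaceTime T Ω), om z.1 z.2 = Du 0 z.1 z.2 1 - Du 1 z.1 z.2 0 := by
  have hO := isOpen_spaceTime (T := T) hΩ
  have hc : MemLp (fun z : ℝ × Plane => Du 0 z.1 z.2 1 - Du 1 z.1 z.2 0) 2
      (volume.restrict (spaceTime T Ω)) := ((hDu 0).component 1).sub ((hDu 1).component 0)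
  have hloc := hc.locallyIntegrableOn hO
  have key : ∀ᵐ z : ℝ × Plane, z ∈ spaceTime T Ω →
      om z.1 z.2 - (Du 0 z.1 z.2 1 - Du 1 z.1 z.2 0) = 0 := by
    refine hO.ae_eq_zero_of_integral_contDiff_smul_eq_zero (hom.1.sub hloc) fun φ hφ hφc hφs => ?_
    have ht : IsTestFunction (spaceTime T Ω) φ := ⟨hφ, hφc, hφs⟩
    have hφm := ht.memLp (volume.restrict (spaceTime T Ω)) 2
    have hint : ∀ a : ℝ × Plane → ℝ, LocallyIntegrableOn a (spaceTime T Ω) volume →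
        IntegrableOn (fun z => φ z * a z) (spaceTime T Ω) volume := by
      intro a ha
      have h1 : IntegrableOn a (tsupport φ) volume := ha.integrableOn_compact_subset hφs hφc
      have h2 : IntegrableOn (fun z => φ z * a z) (tsupport φ) volume := by
        obtain ⟨C, hC⟩ := ht.exists_bound
        exact h1.bdd_mul hφ.continuous.aestronglyMeasurable (ae_of_all _ hC)
      refine (integrableOn_iff_integrable_of_support_subset ?_).2
        ((integrableOn_iff_integrable_of_support_subset (s := tsupport φ) ?_).1 h2)
      · exact fun z hz => hφs (subset_tsupport φ (left_ne_zero_of_mul hz))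
      · exact fun z hz => subset_tsupport φ (left_ne_zero_of_mul hz)
    have e1 : ∫ z, φ z • (om z.1 z.2 - (Du 0 z.1 z.2 1 - Du 1 z.1 z.2 0))
        = (∫ z in spaceTime T Ω, φ z * om z.1 z.2)
        - ∫ z in spaceTime T Ω, φ z * (Du 0 z.1 z.2 1 - Du 1 z.1 z.2 0) := by
      rw [← integral_sub (hint _ hom.1) (hint _ hloc),
        ← setIntegral_eq_integral_of_forall_compl_eq_zero (s := spaceTime T Ω)
        fun z hz => by simp [ht.eq_zero hz]]
      congr 1 with z
      simp [mul_sub]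
    refine e1.trans ?_
    rw [hom.2 φ ht, sub_eq_zero, neg_eq_iff_eq_neg]
    have hcomp : ∀ i j, ∫ z in spaceTime T Ω, fderiv ℝ φ z (0, planeBasis i) * u z.1 z.2 j
        = - ∫ z in spaceTime T Ω, φ z * Du i z.1 z.2 j := by
      intro i j
      have hu' := hu
      have hDu' := hDu
      have hφm' := hφm
      simp only [volume_restrict_spaceTime] at hu' hDu' hφm' ⊢
      rw [integral_prod _ (((ht.fderiv_apply (0, planeBasis i)).memLp _ 2).integrable_mul_two
        (hu'.component j)), integral_prod _ (hφm'.integrable_mul_two ((hDu' i).component j)),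
        ← integral_neg]
      refine integral_congr_ae ?_
      filter_upwards [hw, MemLp.ae_slice (a := fun z : ℝ × Plane => u z.1 z.2) hu',
        MemLp.ae_slice (a := fun z : ℝ × Plane => Du i z.1 z.2) (hDu' i)] with t h1 h2 h3
      have := (h1 i).integral_component h2 h3 (ht.slice t) j
      simp only [fun x => fderiv_slice (z := (t, x)) (ht.differentiable _) (planeBasis i)] at this
      exact this
    rw [integral_sub (((ht.fderiv_apply (0, planeBasis 0)).memLp _ 2).integrable_mul_two
      (hu.component 1)) (((ht.fderiv_apply (0, planeBasis 1)).memLp _ 2).integrable_mul_two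
      (hu.component 0)), hcomp, hcomp]
    simp only [mul_sub]
    rw [integral_sub (hφm.integrable_mul_two ((hDu 0).component 1))
      (hφm.integrable_mul_two ((hDu 1).component 0))]
    ring
  rw [ae_restrict_iff' hO.measurableSet]
  filter_upwards [key] with z hz hz'
  exact sub_eq_zero.1 (hz hz')

end NavierStokes

/-! ### Operations on weak limits; cut-offs and exhaustions -/

section WeakConvergence

namespace WeakL2

variable {X Y ι : Type*} [MeasurableSpace X] [MeasurableSpace Y] {m : Measure X} {l : Filter ι}
  {a a' : ι → X → ℝ} {b b' : X → ℝ}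

theorem congr (h : WeakL2 m l a b) (ha : ∀ n, a n =ᵐ[m] a' n) (hb : b =ᵐ[m] b') :
    WeakL2 m l a' b' := by
  refine ⟨fun n => (h.1 n).ae_eq (ha n), h.2.1.ae_eq hb, fun g hg => ?_⟩
  have h1 := h.2.2 g hg
  have e : ∀ {c c' : X → ℝ}, c =ᵐ[m] c' → ∫ x, c x * g x ∂m = ∫ x, c' x * g x ∂m := fun hc =>
    integral_congr_ae (by filter_upwards [hc] with x hx; rw [hx])
  rw [← e hb]
  exact h1.congr fun n => e (ha n)

theorem sub (h : WeakL2 m l a b) (h' : WeakL2 m l a' b') :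
    WeakL2 m l (fun n x => a n x - a' n x) (fun x => b x - b' x) := by
  refine ⟨fun n => (h.1 n).sub (h'.1 n), h.2.1.sub h'.2.1, fun g hg => ?_⟩
  simp only [sub_mul]
  rw [integral_sub (h.2.1.integrable_mul_two hg) (h'.2.1.integrable_mul_two hg)]
  refine ((h.2.2 g hg).sub (h'.2.2 g hg)).congr fun n => ?_
  rw [integral_sub ((h.1 n).integrable_mul_two hg) ((h'.1 n).integrable_mul_two hg)]

theorem finsetSum {κ : Type*} (s : Finset κ) {a : κ → ι → X → ℝ} {b : κ → X → ℝ}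
    (h : ∀ i ∈ s, WeakL2 m l (a i) (b i)) :
    WeakL2 m l (fun n x => ∑ i ∈ s, a i n x) (fun x => ∑ i ∈ s, b i x) := by
  refine ⟨fun n => memLp_finsetSum _ fun i hi => (h i hi).1 n,
    memLp_finsetSum _ fun i hi => (h i hi).2.1, fun g hg => ?_⟩
  simp only [Finset.sum_mul]
  rw [integral_finsetSum _ fun i hi => (h i hi).2.1.integrable_mul_two hg]
  refine (tendsto_finsetSum s fun i hi => (h i hi).2.2 g hg).congr fun n => ?_
  rw [integral_finsetSum _ fun i hi => ((h i hi).1 n).integrable_mul_two hg]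

theorem of_restrict {S : Set X} (hS : MeasurableSet S) (h : WeakL2 (m.restrict S) l a b)
    (ha : ∀ n, ∀ x ∉ S, a n x = 0) (hb : ∀ x ∉ S, b x = 0) : WeakL2 m l a b := by
  refine ⟨fun n => memLp_of_restrict hS (h.1 n) (ha n), memLp_of_restrict hS h.2.1 hb,
    fun g hg => ?_⟩
  have e : ∀ {c : X → ℝ}, (∀ x ∉ S, c x = 0) → ∫ x in S, c x * g x ∂m = ∫ x, c x * g x ∂m :=
    fun hc => setIntegral_eq_integral_of_forall_compl_eq_zero fun x hx => by simp [hc x hx]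
  rw [← e hb]
  exact (h.2.2 g (hg.restrict S)).congr fun n => e (ha n)

theorem translate {μ : Measure ℝ} [SFinite μ] {a : ι → ℝ × Plane → ℝ} {b : ℝ × Plane → ℝ}
    (H : WeakL2 (μ.prod volume) l a b) (h : Plane) :
    WeakL2 (μ.prod volume) l (fun n z => a n (z.1, z.2 - h)) (fun z => b (z.1, z.2 - h)) := by
  have hmp := measurePreserving_translate μ h
  have hmp' := measurePreserving_translate μ (-h)
  refine ⟨fun n => (H.1 n).comp_measurePreserving hmp, H.2.1.comp_measurePreserving hmp,
    fun g hg => ?_⟩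
  have hg' : MemLp (fun z : ℝ × Plane => g (z.1, z.2 - -h)) 2 (μ.prod volume) :=
    hg.comp_measurePreserving hmp'
  have e : ∀ {c : ℝ × Plane → ℝ}, MemLp c 2 (μ.prod volume) →
      ∫ z, c z * g (z.1, z.2 - -h) ∂(μ.prod volume)
        = ∫ z, c (z.1, z.2 - h) * g z ∂(μ.prod volume) := by
    intro c hc
    have h1 := integral_map (μ := μ.prod (volume : Measure Plane)) hmp.aemeasurable
      (f := fun z => c z * g (z.1, z.2 - -h)) (by
        rw [hmp.map_eq]; exact hc.1.mul hg'.1)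
    rw [hmp.map_eq] at h1
    rw [h1]
    simp
  rw [← e H.2.1]
  exact (H.2.2 _ hg').congr fun n => e (H.1 n)

/-- Cauchy–Schwarz in the first variable against the constant 1, on a space of finite measure. -/
theorem memLp_integral_fst {μ : Measure X} {lam : Measure Y} [IsFiniteMeasure μ] [SFinite lam]
    {g : X × Y → ℝ} (hg : MemLp g 2 (μ.prod lam)) : MemLp (fun y => ∫ x, g (x, y) ∂μ) 2 lam := by
  have hg' : MemLp (fun p : Y × X => g (p.2, p.1)) 2 (lam.prod μ) :=
    hg.comp_measurePreserving Measure.measurePreserving_swap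
  have hm : AEStronglyMeasurable (fun y => ∫ x, g (x, y) ∂μ) lam := hg'.1.integral_prod_right'
  rw [memLp_two_iff_integrable_sq hm]
  have hsq : Integrable (fun y => ∫ x, g (x, y) ^ 2 ∂μ) lam := hg'.integrable_sq.integral_prod_left
  refine (hsq.const_mul (μ.real univ)).mono' (hm.pow 2) ?_
  filter_upwards [hg'.ae_slice] with y hy
  have h1 := abs_integral_mul_le (memLp_const (1 : ℝ) (μ := μ) (p := 2)) hy
  simp only [one_mul] at h1
  rw [Real.norm_of_nonneg (sq_nonneg _), ← sq_abs]
  refine (pow_le_pow_left₀ (abs_nonneg _) h1 2).trans (le_of_eq ?_)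
  have e : ∀ {c : X → ℝ}, MemLp c 2 μ → (eLpNorm c 2 μ).toReal ^ 2 = ∫ x, c x ^ 2 ∂μ := by
    intro c hc
    rw [← Lp.norm_toLp c hc, ← real_inner_self_eq_norm_sq, ← integral_mul_eq_inner hc hc]
    simp only [pow_two]
  rw [mul_pow, e (memLp_const 1), e hy]
  simp

/-- For time-independent functions the test function can be integrated in time first. This is how
the forces enter the space-time formulation. -/
theorem comp_snd {μ : Measure X} {lam : Measure Y} [IsFiniteMeasure μ] [SFinite lam]
    {a : ι → Y → ℝ} {b : Y → ℝ} (h : WeakL2 lam l a b) :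
    WeakL2 (μ.prod lam) l (fun n z => a n z.2) (fun z => b z.2) := by
  refine ⟨fun n => (h.1 n).comp_snd μ, h.2.1.comp_snd μ, fun g hg => ?_⟩
  have e : ∀ {c : Y → ℝ}, MemLp c 2 lam →
      ∫ y, c y * ∫ x, g (x, y) ∂μ ∂lam = ∫ z, c z.2 * g z ∂(μ.prod lam) := by
    intro c hc
    rw [integral_prod_symm _ ((hc.comp_snd μ).integrable_mul_two hg)]
    simp only [integral_const_mul]
  rw [← e h.2.1]
  exact (h.2.2 _ (memLp_integral_fst hg)).congr fun n => e (h.1 n)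

end WeakL2

theorem WeakTendstoL2.component {X : Type*} [MeasureSpace X] {U : Set X} {v : ℕ → X → Plane}
    {w : X → Plane} (h : WeakTendstoL2 U v w) (j : Fin 2) :
    WeakL2 (volume.restrict U) atTop (fun n x => v n x j) (fun x => w x j) := by
  refine ⟨fun n => (h.1 n).component j, h.2.1.component j, fun g hg => ?_⟩
  have hm : MemLp (fun x => g x • planeBasis j) 2 (volume.restrict U) := by
    refine hg.mono (hg.1.smul aestronglyMeasurable_const) (ae_of_all _ fun x => ?_)
    simp [planeBasis, norm_smul]
  have e : ∀ (c : X → Plane) x, inner ℝ (c x) (g x • planeBasis j) = c x j * g x := fun c x => by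
    simp [planeBasis, inner_smul_right, PiLp.inner_apply, mul_comm]
  simpa only [e] using h.2.2 _ hm

theorem eLpNorm_prod_le_of_slice {μ : Measure ℝ} [IsFiniteMeasure μ] {b : ℝ × Plane → ℝ} {B : ℝ≥0}
    (hb : AEStronglyMeasurable b (μ.prod volume))
    (hB : ∀ᵐ t ∂μ, eLpNorm (fun x => b (t, x)) 2 volume ≤ B) :
    eLpNorm b 2 (μ.prod volume) ≤ ((B * ((μ univ).toNNReal + 1) : ℝ≥0) : ℝ≥0∞) := by
  obtain ⟨q, hq⟩ : ∃ q : ℝ≥0, μ univ = q :=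
    ⟨(μ univ).toNNReal, (ENNReal.coe_toNNReal (measure_ne_top _ _)).symm⟩
  have h1 := eLpNorm_le_of_slice hb hB
  rw [hq] at h1 ⊢
  refine (ENNReal.pow_le_pow_left_iff two_ne_zero).1 (h1.trans ?_)
  rw [ENNReal.toNNReal_coe]
  norm_cast
  have : (B * (q + 1)) ^ 2 = B ^ 2 * q + (B ^ 2 * q ^ 2 + B ^ 2 * q + B ^ 2) := by ring
  rw [this]
  exact le_self_add

/-- A cut-off function equal to one on a uniform neighbourhood of a compact set. -/
theorem exists_cutoff {Ω K : Set Plane} (hΩ : IsOpen Ω) (hK : IsCompact K) (hKΩ : K ⊆ Ω) :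
    ∃ (δ : ℝ) (χ : Plane → ℝ), 0 < δ ∧ IsTestFunction Ω χ ∧
      ∀ x ∈ K, Metric.ball x δ ⊆ Ω ∧ ∀ y ∈ Metric.ball x δ, χ y = 1 := by
  obtain ⟨r, hr, hrΩ⟩ := hK.exists_cthickening_subset_open hΩ hKΩ
  have hsub : Metric.cthickening (r / 2) K ⊆ Metric.thickening r K :=
    Metric.cthickening_subset_thickening' hr (by linarith) K
  obtain ⟨g, h0, h1, -⟩ := exists_contMDiffMap_zero_one_of_isClosed (n := ⊤)
    (modelWithCornersSelf ℝ Plane) (s := (Metric.thickening r K)ᶜ) (t := Metric.cthickening (r / 2) K)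
    Metric.isOpen_thickening.isClosed_compl Metric.isClosed_cthickening
    (disjoint_compl_left_iff_subset.2 hsub)
  have hs : tsupport g ⊆ Metric.cthickening r K := by
    refine closure_minimal (fun x hx => ?_) Metric.isClosed_cthickening
    by_contra hx'
    exact hx (h0 fun hx2 => hx' (Metric.thickening_subset_cthickening r K hx2))
  have hball : ∀ x ∈ K, Metric.ball x (r / 2) ⊆ Metric.cthickening (r / 2) K := fun x hx =>
    (Metric.ball_subset_thickening hx _).trans (Metric.thickening_subset_cthickening _ _)
  refine ⟨r / 2, g, by positivity, ⟨g.contMDiff.contDiff, ?_, hs.trans hrΩ⟩, fun x hx =>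
    ⟨((hball x hx).trans (Metric.cthickening_mono (by linarith) K)).trans hrΩ,
      fun y hy => h1 (hball x hx hy)⟩⟩
  exact hK.cthickening.of_isClosed_subset (isClosed_tsupport _) hs

/-- Exhaustion of an open set by an increasing sequence of compact sets. -/
theorem exists_compact_exhaustion {Ω : Set Plane} (hΩ : IsOpen Ω) :
    ∃ K : ℕ → Set Plane, (∀ i, IsCompact (K i)) ∧ (∀ i, K i ⊆ Ω) ∧ Monotone K ∧
      ∀ L, IsCompact L → L ⊆ Ω → ∃ i, L ⊆ K i := by
  have : LocallyCompactSpace Ω := hΩ.locallyCompactSpace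
  let E : CompactExhaustion Ω := default
  refine ⟨fun i => Subtype.val '' E i, fun i => (E.isCompact i).image continuous_subtype_val,
    fun i => by rintro _ ⟨x, -, rfl⟩; exact x.2, fun i j hij => image_mono (E.subset hij),
    fun L hL hLΩ => ?_⟩
  have hc : IsCompact ((Subtype.val : Ω → Plane) ⁻¹' L) :=
    Topology.IsInducing.subtypeVal.isCompact_preimage' hL (by simpa using hLΩ)
  obtain ⟨i, hi⟩ := E.exists_superset_of_isCompact hc
  exact ⟨i, fun x hx => ⟨⟨x, hLΩ hx⟩, hi hx, rfl⟩⟩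

end WeakConvergence

/-! ### Localization by a cut-off -/

section Localization

variable {Ω : Set Plane} {T : ℝ}

theorem volume_restrict_spaceTime_eq_restrict (T : ℝ) (Ω : Set Plane) :
    volume.restrict (spaceTime T Ω)
      = ((volume.restrict (Ioo 0 T)).prod (volume : Measure Plane)).restrict (univ ×ˢ Ω) := by
  rw [volume_restrict_spaceTime, ← Measure.prod_restrict, Measure.restrict_univ]

theorem ae_prod_of_ae_spaceTime (hΩ : IsOpen Ω) {p : ℝ × Plane → Prop}
    (h : ∀ᵐ z ∂volume.restrict (spaceTime T Ω), p z) :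
    ∀ᵐ z ∂((volume.restrict (Ioo 0 T)).prod (volume : Measure Plane)), z.2 ∈ Ω → p z := by
  rw [volume_restrict_spaceTime_eq_restrict,
    ae_restrict_iff' (MeasurableSet.univ.prod hΩ.measurableSet)] at h
  filter_upwards [h] with z hz hz'
  exact hz ⟨mem_univ _, hz'⟩

variable {χ : Plane → ℝ}

/-- Joint measurability of the slicewise convolutions is derived from strong measurability, so
localized fields are replaced by such representatives on the whole space. -/
theorem exists_stronglyMeasurable_localization (hΩ : IsOpen Ω) (hχ : IsTestFunction Ω χ)
    {g : ℝ × Plane → ℝ} (hg : AEStronglyMeasurable g (volume.restrict (spaceTime T Ω))) :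
    ∃ W : ℝ × Plane → ℝ, StronglyMeasurable W ∧
      W =ᵐ[(volume.restrict (Ioo 0 T)).prod volume] fun z => χ z.2 * g z := by
  refine ⟨fun z => χ z.2 * hg.mk g z,
    (hχ.1.continuous.comp continuous_snd).stronglyMeasurable.mul hg.stronglyMeasurable_mk, ?_⟩
  filter_upwards [ae_prod_of_ae_spaceTime hΩ hg.ae_eq_mk] with z hz
  by_cases h : z.2 ∈ Ω
  · simp only [hz h]
  · simp [hχ.eq_zero h]

theorem memLp_localize (hΩ : IsOpen Ω) (hχ : IsTestFunction Ω χ) {g : ℝ × Plane → ℝ}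
    (hg : MemLp g 2 (volume.restrict (spaceTime T Ω))) :
    MemLp (fun z => χ z.2 * g z) 2 ((volume.restrict (Ioo 0 T)).prod volume) := by
  obtain ⟨C, hC⟩ := hχ.abs_le
  rw [volume_restrict_spaceTime_eq_restrict] at hg
  have h1 := hg.mul_bdd (hχ.1.continuous.comp continuous_snd).aestronglyMeasurable fun z => hC z.2
  simp only [Function.comp, mul_comm (g _)] at h1
  exact memLp_of_restrict (MeasurableSet.univ.prod hΩ.measurableSet) h1
    fun z hz => by simp [hχ.eq_zero fun h => hz ⟨mem_univ _, h⟩]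

theorem WeakL2.localize {ι : Type*} {l : Filter ι} (hΩ : IsOpen Ω) (hχ : IsTestFunction Ω χ)
    {a : ι → ℝ × Plane → ℝ} {b : ℝ × Plane → ℝ}
    (h : WeakL2 (volume.restrict (spaceTime T Ω)) l a b) :
    WeakL2 ((volume.restrict (Ioo 0 T)).prod volume) l (fun n z => χ z.2 * a n z)
      (fun z => χ z.2 * b z) := by
  obtain ⟨C, hC⟩ := hχ.abs_le
  rw [volume_restrict_spaceTime_eq_restrict] at h
  have h1 := h.mul_bdd (hχ.1.continuous.comp continuous_snd).aestronglyMeasurable fun z => hC z.2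
  simp only [Function.comp, mul_comm _ (χ _)] at h1
  exact h1.of_restrict (MeasurableSet.univ.prod hΩ.measurableSet)
    (fun n z hz => by simp [hχ.eq_zero fun h => hz ⟨mem_univ _, h⟩])
    fun z hz => by simp [hχ.eq_zero fun h => hz ⟨mem_univ _, h⟩]

theorem eLpNorm_localize_le (hχ : IsTestFunction Ω χ) {C : ℝ≥0} (hC : ∀ x, |χ x| ≤ C)
    (v : Plane → ℝ) : eLpNorm (fun x => χ x * v x) 2 volume ≤ C * eLpNorm v 2 (volume.restrict Ω) := by
  have hs : Function.support (fun x => χ x * v x) ⊆ Ω := fun x hx => by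
    by_contra h
    exact hx (by simp [hχ.eq_zero h])
  rw [← eLpNorm_restrict_eq_of_support_subset hs]
  simp only [mul_comm (χ _)]
  exact eLpNorm_mul_bdd_le hC

/-- A kernel living where `χ = 1` does not see the cut-off, so divergence and curl of the localized
field agree near `K` with those of the original. -/
theorem integral_localize_mul {W v k : Plane → ℝ}
    (hW : W =ᵐ[volume] fun x => χ x * v x) (hk : ∀ x, k x ≠ 0 → x ∈ Ω ∧ χ x = 1) :
    ∫ x, W x * k x = ∫ x in Ω, v x * k x := by
  rw [← setIntegral_eq_integral_of_forall_compl_eq_zero (s := Ω) fun x hx => by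
    by_cases h : k x = 0
    · simp [h]
    · exact absurd (hk x h).1 hx]
  refine integral_congr_ae (ae_restrict_of_ae ?_)
  filter_upwards [hW] with x hx
  by_cases h : k x = 0
  · simp [h]
  · simp [hx, (hk x h).2]

theorem IsSolenoidalTest.fderiv_eq_zero {K : Set Plane} (hK : IsCompact K)
    {Φ : Fin 2 → ℝ × Plane → ℝ} (hΦ : IsSolenoidalTest K Φ) (j : Fin 2) {z : ℝ × Plane}
    (hz : z.2 ∉ K) : fderiv ℝ (Φ j) z = 0 := by
  have h1 : Φ j =ᶠ[𝓝 z] fun _ => 0 := by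
    filter_upwards [(hK.isClosed.isOpen_compl.preimage continuous_snd).mem_nhds hz] with w hw
    exact hΦ.eq_zero j w hw
  rw [h1.fderiv_eq]
  simp

theorem convForm_localize {K : Set Plane} (hK : IsCompact K)
    (hχK : ∀ x ∈ K, x ∈ Ω ∧ χ x = 1) {Φ : Fin 2 → ℝ × Plane → ℝ} (hΦ : IsSolenoidalTest K Φ)
    {W : Fin 2 → ℝ × Plane → ℝ} {v : ℝ → Plane → Plane}
    (hW : ∀ j, W j =ᵐ[(volume.restrict (Ioo 0 T)).prod volume] fun z => χ z.2 * v z.1 z.2 j) :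
    convForm ((volume.restrict (Ioo 0 T)).prod volume) Φ W
      = ∑ i, ∑ j, ∫ z in spaceTime T Ω, v z.1 z.2 i
        * (v z.1 z.2 j * fderiv ℝ (Φ j) z (0, planeBasis i)) := by
  refine Finset.sum_congr rfl fun i _ => Finset.sum_congr rfl fun j _ => ?_
  rw [volume_restrict_spaceTime_eq_restrict,
    ← setIntegral_eq_integral_of_forall_compl_eq_zero (s := univ ×ˢ Ω) fun z hz => by
      rw [hΦ.fderiv_eq_zero hK j fun h => hz ⟨mem_univ _, (hχK _ h).1⟩]; simp]
  refine integral_congr_ae (ae_restrict_of_ae ?_)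
  filter_upwards [hW i, hW j] with z hi hj
  by_cases h : z.2 ∈ K
  · rw [hi, hj, (hχK _ h).2, one_mul, one_mul]
  · rw [hΦ.fderiv_eq_zero hK j h]; simp

theorem eLpNorm_le_of_integral_sq_le {X : Type*} [MeasurableSpace X] {m : Measure X} {a : X → ℝ}
    (ha : MemLp a 2 m) {q : ℝ≥0} (h : ∫ x, a x ^ 2 ∂m ≤ (q : ℝ) ^ 2) : eLpNorm a 2 m ≤ q := by
  refine eLpNorm_two_le_of_lintegral_le ?_
  rw [← ofReal_integral_sq ha]
  refine (ENNReal.ofReal_le_ofReal h).trans (le_of_eq ?_)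
  rw [ENNReal.ofReal_pow (NNReal.coe_nonneg q), ENNReal.ofReal_coe_nnreal]

theorem lintegral_localize_sq_le {C : ℝ≥0} (hC : ∀ x, |χ x| ≤ C)
    (w : Plane → ℝ) : ∫⁻ x in Ω, ‖χ x * w x‖ₑ ^ 2 ≤ C ^ 2 * ∫⁻ x in tsupport χ, ‖w x‖ₑ ^ 2 := by
  calc ∫⁻ x in Ω, ‖χ x * w x‖ₑ ^ 2
      ≤ ∫⁻ x, ‖χ x * w x‖ₑ ^ 2 := setLIntegral_le_lintegral _ _
    _ = ∫⁻ x in tsupport χ, ‖χ x * w x‖ₑ ^ 2 := by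
        refine (setLIntegral_eq_of_support_subset fun x hx => subset_tsupport _ fun h => hx ?_).symm
        simp [h]
    _ ≤ ∫⁻ x in tsupport χ, (C : ℝ≥0∞) ^ 2 * ‖w x‖ₑ ^ 2 := by
        refine lintegral_mono fun x => ?_
        rw [enorm_mul, mul_pow]
        refine mul_le_mul_left (pow_le_pow_left₀ zero_le ?_ 2) _
        have : ‖χ x‖₊ ≤ C := NNReal.coe_le_coe.1 (hC x)
        exact ENNReal.coe_le_coe.2 this
    _ = _ := lintegral_const_mul' _ _ (by simp)

/-- The translation estimate for solutions with bounded energy and local enstrophy. -/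
theorem exists_localized_translate_bound (hΩ : IsOpen Ω) (hχ : IsTestFunction Ω χ) (T : ℝ)
    (E S : ℝ≥0) :
    ∃ C : ℝ≥0, ∀ (ν : ℝ) (f : Plane → Plane) (u : ℝ → Plane → Plane) (om : ℝ → Plane → ℝ),
      MemLp f 2 (volume.restrict Ω) → IsStrongNavierStokes Ω T ν f u →
      (∀ t ∈ Icc 0 T, eLpNorm (u t) 2 (volume.restrict Ω) ≤ E) → IsVorticity Ω T u om →
      (∀ᵐ t ∂volume.restrict (Ioo 0 T), ∫⁻ x in tsupport χ, ‖om t x‖ₑ ^ 2 ≤ S) →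
      ∀ (j : Fin 2) (h : Plane),
        eLpNorm (fun z : ℝ × Plane => χ (z.2 - h) * u z.1 (z.2 - h) j - χ z.2 * u z.1 z.2 j) 2
          ((volume.restrict (Ioo 0 T)).prod volume) ≤ C * ‖h‖ₑ := by
  obtain ⟨A, hA⟩ := exists_translate_bound hΩ hχ
  obtain ⟨D, hD⟩ := hχ.abs_le
  -- The right side of `exists_translate_bound` with energy at most `E²` and enstrophy at most `S`
  -- on the support of `χ`, where `|χ| ≤ D`. The factor accompanying `√Q` below dominates the square
  -- root of the length of the time interval.
  set Q : ℝ≥0 := A * (E * E) + 2 * (D ^ 2 * S) with hQ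
  refine ⟨NNReal.sqrt Q * ((volume.restrict (Ioo 0 T) univ).toNNReal + 1),
    fun ν f u om hf hns hE hom hS j h => ?_⟩
  obtain ⟨ut, Du, D2u, p, Dp, -, -, hDu, hsl⟩ := hns.exists_slices hf
  have hcurl := hom.ae_eq hΩ hns.memLp hDu (by
    filter_upwards [hsl] with t ht i using (ht.memH10.1.2 i).2)
  rw [volume_restrict_spaceTime] at hcurl
  have hV := memLp_localize hΩ hχ (hns.memLp.component j)
  have hVt : MemLp (fun z : ℝ × Plane => χ (z.2 - h) * u z.1 (z.2 - h) j) 2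
      ((volume.restrict (Ioo 0 T)).prod volume) :=
    hV.comp_measurePreserving (measurePreserving_translate _ h)
  have hd := hVt.sub hV
  have hslice : ∀ᵐ t ∂volume.restrict (Ioo 0 T), eLpNorm (fun x : Plane =>
      χ (x - h) * u t (x - h) j - χ x * u t x j) 2 volume
        ≤ ((NNReal.sqrt Q * ‖h‖₊ : ℝ≥0) : ℝ≥0∞) := by
    filter_upwards [hsl, hS, Measure.ae_ae_of_ae_prod hcurl, hVt.ae_slice, hV.ae_slice,
      ae_restrict_mem measurableSet_Ioo] with t ht hSt hct h1 h2 htT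
    have htI : t ∈ Icc 0 T := Ioo_subset_Icc_self htT
    have hdt := h1.sub h2
    refine eLpNorm_le_of_integral_sq_le hdt ?_
    have key := hA (u t) (fun i => Du i t) ht.memH10 ht.div h
    have hut := ht.memH10.1.1
    have b1 : ∑ j, ∫ x in Ω, u t x j ^ 2 ≤ E * E := by
      have e := integral_inner_eq_sum hut hut
      simp only [← pow_two] at e
      rw [← e]
      refine (le_abs_self _).trans ((abs_integral_inner_le hut hut).trans ?_)
      have := ENNReal.toReal_le_coe_of_le_coe (hE t htI)
      exact mul_le_mul this this ENNReal.toReal_nonneg E.2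
    have b2 : ∫ x in Ω, (χ x * (Du 0 t x 1 - Du 1 t x 0)) ^ 2 ≤ ((D ^ 2 * S : ℝ≥0) : ℝ) := by
      have hm : MemLp (fun x => χ x * (Du 0 t x 1 - Du 1 t x 0)) 2 (volume.restrict Ω) := by
        have h3 := (((ht.memH10.1.2 0).1.component 1).sub
          ((ht.memH10.1.2 1).1.component 0)).mul_bdd (hχ.aesm _) hD
        simpa only [mul_comm, Pi.sub_apply] using h3
      refine integral_sq_le_of_lintegral_le hm ?_
      have e : ∫⁻ x in Ω, ‖χ x * (Du 0 t x 1 - Du 1 t x 0)‖ₑ ^ 2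
          = ∫⁻ x in Ω, ‖χ x * om t x‖ₑ ^ 2 := by
        refine lintegral_congr_ae ?_
        filter_upwards [hct] with x hx
        rw [hx]
      rw [e, ENNReal.coe_mul, ENNReal.coe_pow]
      exact (lintegral_localize_sq_le hD _).trans (mul_le_mul_right hSt _)
    have hle : ∫ x, (χ (x - h) * u t (x - h) j - χ x * u t x j) ^ 2
        ≤ ∑ j, ∫ x, (χ (x - h) * u t (x - h) j - χ x * u t x j) ^ 2 :=
      Finset.single_le_sum (f := fun j => ∫ x, (χ (x - h) * u t (x - h) j - χ x * u t x j) ^ 2)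
        (fun j _ => integral_nonneg fun _ => sq_nonneg _) (Finset.mem_univ j)
    refine hle.trans (key.trans ?_)
    have e : ((NNReal.sqrt Q * ‖h‖₊ : ℝ≥0) : ℝ) ^ 2 = ‖h‖ ^ 2 * Q := by
      rw [← NNReal.coe_pow, mul_pow, NNReal.sq_sqrt]
      push_cast
      ring
    rw [e]
    refine mul_le_mul_of_nonneg_left ?_ (sq_nonneg _)
    rw [hQ]
    push_cast at b2 ⊢
    refine add_le_add (mul_le_mul_of_nonneg_left b1 A.2) (mul_le_mul_of_nonneg_left b2 zero_le_two)
  refine (eLpNorm_prod_le_of_slice hd.1 hslice).trans (le_of_eq ?_)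
  rw [show (‖h‖ₑ : ℝ≥0∞) = (‖h‖₊ : ℝ≥0∞) from rfl, ← ENNReal.coe_mul]
  congr 1
  ring

end Localization

/-! ### Convergence of the localized velocities and of the quadratic term -/

section InviscidLimit

/-- Strong solutions with vanishing viscosities, bounded energies and locally bounded enstrophies,
converging weakly. -/
structure IsInviscidSequence (Ω : Set Plane) (T : ℝ) (ν : ℕ → ℝ) (f : ℕ → Plane → Plane)
    (u : ℕ → ℝ → Plane → Plane) (om : ℕ → ℝ → Plane → ℝ) (finf : Plane → Plane)
    (uinf : ℝ → Plane → Plane) (E F : ℝ≥0) : Prop where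
  isOpen : IsOpen Ω
  tendsto_visc : Tendsto ν atTop (𝓝 0)
  solution : ∀ n, IsStrongNavierStokes Ω T (ν n) (f n) (u n)
  memLp_force : ∀ n, MemLp (f n) 2 (volume.restrict Ω)
  force_le : ∀ n, eLpNorm (f n) 2 (volume.restrict Ω) ≤ F
  energy_le : ∀ n, ∀ t ∈ Icc 0 T, eLpNorm (u n t) 2 (volume.restrict Ω) ≤ E
  force : WeakTendstoL2 Ω f finf
  weak : WeakTendstoL2 (spaceTime T Ω) (fun n z => u n z.1 z.2) (fun z => uinf z.1 z.2)
  vorticity : ∀ n, IsVorticity Ω T (u n) (om n)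
  enstrophy : ∀ K : Set Plane, IsCompact K → K ⊆ Ω → ∃ C : ℝ≥0, ∀ n,
    ∀ᵐ t ∂volume.restrict (Ioo 0 T), ∫⁻ x in K, ‖om n t x‖ₑ ^ 2 ≤ C

namespace IsInviscidSequence

variable {Ω : Set Plane} {T : ℝ} {ν : ℕ → ℝ} {f : ℕ → Plane → Plane} {u : ℕ → ℝ → Plane → Plane}
  {om : ℕ → ℝ → Plane → ℝ} {finf : Plane → Plane} {uinf : ℝ → Plane → Plane} {E F : ℝ≥0}
  (h : IsInviscidSequence Ω T ν f u om finf uinf E F)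
include h

theorem weak_prod (j : Fin 2) : WeakL2 ((volume.restrict (Ioo 0 T)).prod (volume.restrict Ω)) atTop
    (fun n z => u n z.1 z.2 j) (fun z => uinf z.1 z.2 j) := by
  have := h.weak.component j
  rwa [volume_restrict_spaceTime] at this

/-- Pairings with divergence-free test fields converge at almost every time. -/
theorem ae_tendsto_test {ψ : Fin 2 → Plane → ℝ} (hψ : ∀ j, IsTestFunction Ω (ψ j))
    (hdivψ : ∀ x, ∑ i, fderiv ℝ (ψ i) x (planeBasis i) = 0) :
    ∀ᵐ t ∂volume.restrict (Ioo 0 T), Tendsto (fun n => ∑ j, ∫ x in Ω, u n t x j * ψ j x) atTop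
      (𝓝 (∑ j, ∫ x in Ω, uinf t x j * ψ j x)) := by
  obtain ⟨N, hN⟩ := h.tendsto_visc.abs.bddAbove_range
  obtain ⟨L, hL⟩ := exists_lipschitz_of_isStrongNavierStokes hψ hdivψ T E F N.toNNReal
  have hψm := fun j => (hψ j).memLp (volume.restrict Ω) 2
  have hint : ∀ (v : ℝ → Plane → Plane), (∀ j, MemLp (fun z : ℝ × Plane => v z.1 z.2 j) 2
      ((volume.restrict (Ioo 0 T)).prod (volume.restrict Ω))) → ∀ j,
      IntegrableOn (fun t => ∫ x in Ω, v t x j * ψ j x) (Ioo 0 T) volume := fun v hv j =>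
    ((hv j).integrable_mul_two ((hψm j).comp_snd _)).integral_prod_left
  have hu := fun n j => (h.weak_prod j).1 n
  have hui := fun j => (h.weak_prod j).2.1
  -- Convergence of the integrals over `[s, t]` is weak convergence tested with the indicator of
  -- `[s, t]` in time multiplied by `ψ j`.
  refine ae_tendsto_of_lipschitz_of_weak (L := L) (fun n s hs t ht => ?_) ?_ fun s t hst => ?_
  · exact hL (ν n) (f n) (u n) ((hN ⟨n, rfl⟩).trans (Real.le_coe_toNNReal N)) (h.memLp_force n)
      (h.force_le n) (h.solution n) (h.energy_le n) s hs t ht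
  · exact integrable_finsetSum _ fun j _ => hint uinf hui j
  · have hg : ∀ j, MemLp (fun z : ℝ × Plane => (Icc s t).indicator (fun _ => (1 : ℝ)) z.1 * ψ j z.2)
        2 ((volume.restrict (Ioo 0 T)).prod (volume.restrict Ω)) := by
      intro j
      have h1 := ((hψm j).comp_snd (volume.restrict (Ioo 0 T))).indicator
        (measurableSet_Icc (a := s) (b := t) |>.prod (MeasurableSet.univ (α := Plane)))
      refine h1.ae_eq (ae_of_all _ fun z => ?_)
      by_cases hz : z.1 ∈ Icc s t <;> simp [hz, indicator, -mem_Icc]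
    have e : ∀ (v : ℝ → Plane → Plane), (∀ j, MemLp (fun z : ℝ × Plane => v z.1 z.2 j) 2
        ((volume.restrict (Ioo 0 T)).prod (volume.restrict Ω))) →
        ∑ j, ∫ z, v z.1 z.2 j * ((Icc s t).indicator (fun _ => (1 : ℝ)) z.1 * ψ j z.2)
          ∂((volume.restrict (Ioo 0 T)).prod (volume.restrict Ω))
        = ∫ r in Icc s t, ∑ j, ∫ x in Ω, v r x j * ψ j x := by
      intro v hv
      rw [integral_finsetSum _ fun j _ => (hint v hv j).mono_set hst]
      refine Finset.sum_congr rfl fun j _ => ?_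
      rw [integral_prod _ ((hv j).integrable_mul_two (hg j)),
        ← integral_indicator measurableSet_Icc, ← setIntegral_eq_integral_of_forall_compl_eq_zero
          (s := Ioo 0 T) (f := (Icc s t).indicator _) fun r hr => by
            rw [indicator_of_notMem fun h' => hr (hst h')]]
      congr 1 with r
      by_cases hr : r ∈ Icc s t
      · simp [hr, -mem_Icc]
      · simp [hr, -mem_Icc]
    rw [← e uinf hui]
    simp_rw [← fun n => e (u n) (hu n)]
    exact tendsto_finsetSum _ fun j _ => (h.weak_prod j).2.2 _ (hg j)

theorem ae_integral_div {ψ : Plane → ℝ} (hψ : IsTestFunction Ω ψ) (n : ℕ) :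
    ∀ᵐ t ∂volume.restrict (Ioo 0 T), ∑ i, ∫ x in Ω, u n t x i * fderiv ℝ ψ x (planeBasis i) = 0 := by
  obtain ⟨ut, Du, D2u, p, Dp, -, -, -, hsl⟩ := (h.solution n).exists_slices (h.memLp_force n)
  filter_upwards [hsl] with t ht using ht.sum_integral_mul_fderiv hψ

/-- The weak limit, localized near a compact set, and convergence of the quadratic terms. -/
theorem exists_localized_limit {K : Set Plane} (hK : IsCompact K) (hKΩ : K ⊆ Ω) :
    ∃ (δ : ℝ) (χ : Plane → ℝ) (b : Fin 2 → ℝ × Plane → ℝ) (B C : ℝ≥0), 0 < δ ∧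
      IsTestFunction Ω χ ∧
      (∀ x ∈ K, Metric.ball x δ ⊆ Ω ∧ ∀ y ∈ Metric.ball x δ, χ y = 1) ∧
      (∀ j, StronglyMeasurable (b j)) ∧
      (∀ j, b j =ᵐ[(volume.restrict (Ioo 0 T)).prod volume] fun z => χ z.2 * uinf z.1 z.2 j) ∧
      (∀ j, MemLp (b j) 2 ((volume.restrict (Ioo 0 T)).prod volume)) ∧
      (∀ j, ∀ᵐ t ∂volume.restrict (Ioo 0 T), eLpNorm (fun x => b j (t, x)) 2 volume ≤ B) ∧
      (∀ j (y : Plane), eLpNorm (fun z => b j (z.1, z.2 - y) - b j z) 2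
        ((volume.restrict (Ioo 0 T)).prod volume) ≤ C * ‖y‖ₑ) ∧
      (∀ x ∈ K, ∀ ψ, IsTestFunction (Metric.ball x δ) ψ → ∀ᵐ t ∂volume.restrict (Ioo 0 T),
        ∑ i, ∫ y, b i (t, y) * fderiv ℝ ψ y (planeBasis i) = 0) ∧
      ∀ Φ, IsSolenoidalTest K Φ →
        Tendsto (fun n => ∑ i, ∑ j, ∫ z in spaceTime T Ω, u n z.1 z.2 i
          * (u n z.1 z.2 j * fderiv ℝ (Φ j) z (0, planeBasis i))) atTop
          (𝓝 (convForm ((volume.restrict (Ioo 0 T)).prod volume) Φ b)) := by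
  have hΩ := h.isOpen
  obtain ⟨δ, χ, hδ, hχ, hχK⟩ := exists_cutoff hΩ hK hKΩ
  obtain ⟨D, hD⟩ := hχ.abs_le
  -- The enstrophy bound is used on the support of the cut-off, a compact subset of `Ω` larger than
  -- `K`.
  obtain ⟨S, hS⟩ := h.enstrophy _ hχ.2.1 hχ.2.2
  obtain ⟨C, hC⟩ := exists_localized_translate_bound hΩ hχ T E S
  have hwu := fun j => h.weak.component j
  choose W hWm hW using fun n j =>
    exists_stronglyMeasurable_localization hΩ hχ ((hwu j).1 n).1
  choose b hbm hb using fun j => exists_stronglyMeasurable_localization hΩ hχ (hwu j).2.1.1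
  have hw : ∀ j, WeakL2 ((volume.restrict (Ioo 0 T)).prod volume) atTop (fun n => W n j) (b j) :=
    fun j => ((hwu j).localize hΩ hχ).congr (fun n => (hW n j).symm) (hb j).symm
  have hWB : ∀ n j, ∀ᵐ t ∂volume.restrict (Ioo 0 T),
      eLpNorm (fun x => W n j (t, x)) 2 volume ≤ ((D * E : ℝ≥0) : ℝ≥0∞) := by
    intro n j
    filter_upwards [Measure.ae_ae_of_ae_prod (hW n j), ae_restrict_mem measurableSet_Ioo]
      with t ht htT
    rw [eLpNorm_congr_ae ht, ENNReal.coe_mul]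
    refine (eLpNorm_localize_le hχ hD _).trans (mul_le_mul_right ?_ _)
    exact (eLpNorm_component_le _ j).trans (h.energy_le n t (Ioo_subset_Icc_self htT))
  have hbB : ∀ j, ∀ᵐ t ∂volume.restrict (Ioo 0 T),
      eLpNorm (fun x => b j (t, x)) 2 volume ≤ ((D * E : ℝ≥0) : ℝ≥0∞) := by
    intro j
    have h1 := (hw j).slice_bound (C := (D * E) ^ 2) fun n => by
      filter_upwards [hWB n j] with t ht
      rw [lintegral_enorm_sq_eq, ENNReal.coe_pow]
      exact pow_le_pow_left₀ zero_le ht 2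
    filter_upwards [h1] with t ht
    rw [ENNReal.coe_pow] at ht
    exact eLpNorm_two_le_of_lintegral_le ht
  have hWC : ∀ n j (y : Plane), eLpNorm (fun z => W n j (z.1, z.2 - y) - W n j z) 2
      ((volume.restrict (Ioo 0 T)).prod volume) ≤ C * ‖y‖ₑ := by
    intro n j y
    have h1 := hC (ν n) (f n) (u n) (om n) (h.memLp_force n) (h.solution n) (h.energy_le n)
      (h.vorticity n) (hS n) j y
    refine (eLpNorm_congr_ae ?_).trans_le h1
    filter_upwards [hW n j, (measurePreserving_translate (volume.restrict (Ioo 0 T))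
      y).quasiMeasurePreserving.ae (hW n j)] with z h2 h3
    rw [h2, h3]
  have hbC : ∀ j (y : Plane), eLpNorm (fun z => b j (z.1, z.2 - y) - b j z) 2
      ((volume.restrict (Ioo 0 T)).prod volume) ≤ C * ‖y‖ₑ := by
    intro j y
    rw [show (‖y‖ₑ : ℝ≥0∞) = (‖y‖₊ : ℝ≥0∞) from rfl, ← ENNReal.coe_mul]
    refine (((hw j).translate y).sub (hw j)).eLpNorm_le fun n => ?_
    rw [ENNReal.coe_mul]
    exact hWC n j y
  have hpair : ∀ x ∈ K, ∀ ψ, IsTestFunction (Metric.ball x δ) ψ → ∀ (i : Fin 2) (w v : Plane → ℝ),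
      (w =ᵐ[volume] fun y => χ y * v y) → ∫ y, w y * fderiv ℝ ψ y (planeBasis i)
        = ∫ y in Ω, v y * fderiv ℝ ψ y (planeBasis i) := by
    intro x hx ψ hψ i w v hwv
    refine integral_localize_mul hwv fun y hy => ?_
    have hy' : y ∈ Metric.ball x δ := by
      by_contra h'
      exact hy ((hψ.fderiv_apply (planeBasis i)).eq_zero h')
    exact ⟨(hχK x hx).1 hy', (hχK x hx).2 y hy'⟩
  have hdiv : ∀ x ∈ K, ∀ ψ, IsTestFunction (Metric.ball x δ) ψ → ∀ n,
      ∀ᵐ t ∂volume.restrict (Ioo 0 T), ∑ i, ∫ y, W n i (t, y) * fderiv ℝ ψ y (planeBasis i) = 0 := by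
    intro x hx ψ hψ n
    filter_upwards [Measure.ae_ae_of_ae_prod (hW n 0), Measure.ae_ae_of_ae_prod (hW n 1),
      h.ae_integral_div (hψ.mono (hχK x hx).1) n] with t h0 h1 ht
    rw [Fin.sum_univ_two] at ht ⊢
    rw [hpair x hx ψ hψ 0 _ _ h0, hpair x hx ψ hψ 1 _ _ h1]
    exact ht
  have hcurl : ∀ x ∈ K, ∀ ψ, IsTestFunction (Metric.ball x δ) ψ →
      ∀ᵐ t ∂volume.restrict (Ioo 0 T), Tendsto (fun n =>
        (∫ y, W n 1 (t, y) * fderiv ℝ ψ y (planeBasis 0))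
        - ∫ y, W n 0 (t, y) * fderiv ℝ ψ y (planeBasis 1)) atTop
        (𝓝 ((∫ y, b 1 (t, y) * fderiv ℝ ψ y (planeBasis 0))
        - ∫ y, b 0 (t, y) * fderiv ℝ ψ y (planeBasis 1))) := by
    intro x hx ψ hψ
    have hψΩ := hψ.mono (hχK x hx).1
    -- The rotated gradient `(-∂₂ψ, ∂₁ψ)` is solenoidal by symmetry of second derivatives, and
    -- pairing the velocity with it is testing the curl with `ψ`, up to sign. Hence curls converge
    -- at almost every time despite the pressure.
    have key := h.ae_tendsto_test (ψ := ![fun y => -fderiv ℝ ψ y (planeBasis 1),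
      fun y => fderiv ℝ ψ y (planeBasis 0)]) (fun j => by
        fin_cases j
        · exact (hψΩ.fderiv_apply (planeBasis 1)).neg
        · exact hψΩ.fderiv_apply (planeBasis 0)) (fun y => by
        rw [Fin.sum_univ_two]
        simp only [Matrix.cons_val_zero, Matrix.cons_val_one, fderiv_fun_neg]
        rw [fderiv_fderiv_comm (contDiff_infty.1 hψ.1 2) y (planeBasis 0) (planeBasis 1)]
        simp)
    filter_upwards [key, ae_all_iff.2 fun n => Measure.ae_ae_of_ae_prod (hW n 0),
      ae_all_iff.2 fun n => Measure.ae_ae_of_ae_prod (hW n 1), Measure.ae_ae_of_ae_prod (hb 0),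
      Measure.ae_ae_of_ae_prod (hb 1)] with t ht g0 g1 g2 g3
    rw [hpair x hx ψ hψ 0 _ _ g3, hpair x hx ψ hψ 1 _ _ g2]
    simp_rw [fun n => hpair x hx ψ hψ 0 _ _ (g1 n), fun n => hpair x hx ψ hψ 1 _ _ (g0 n)]
    simp only [Fin.sum_univ_two, Matrix.cons_val_zero, Matrix.cons_val_one, mul_neg,
      integral_neg, neg_add_eq_sub] at ht
    exact ht
  refine ⟨δ, χ, b, D * E, C, hδ, hχ, hχK, hbm, hb, fun j => (hw j).2.1, hbB, hbC,
    fun x hx ψ hψ => WeakL2.div_limit hw (hψ.mono (subset_univ _)) (hdiv x hx ψ hψ),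
    fun Φ hΦ => ?_⟩
  have key := tendsto_convForm hK hδ hWm hbm hw hWB hbB hWC hbC hdiv hcurl hΦ
  refine key.congr fun n => ?_
  exact convForm_localize hK (fun x hx => ⟨hKΩ hx, (hχK x hx).2 x (Metric.mem_ball_self hδ)⟩) hΦ
    (hW n)

end IsInviscidSequence

end InviscidLimit

/-! ### The Euler equations, the energy bound and the limit vorticity -/

section InviscidLimit

theorem IsTestFunction.exists_compact {Ω : Set Plane} {T : ℝ} {φ : ℝ × Plane → ℝ}
    (hφ : IsTestFunction (spaceTime T Ω) φ) :
    ∃ K : Set Plane, IsCompact K ∧ K ⊆ Ω ∧ ∀ z : ℝ × Plane, z.2 ∉ K → z ∉ tsupport φ :=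
  ⟨Prod.snd '' tsupport φ, hφ.2.1.isCompact.image continuous_snd,
    by rintro _ ⟨z, hz, rfl⟩; exact (hφ.2.2 hz).2, fun z hz h => hz ⟨z, h, rfl⟩⟩

theorem exists_isSolenoidalTest {Ω : Set Plane} {T : ℝ} {Φ : Fin 2 → ℝ × Plane → ℝ}
    (hΦ : ∀ j, IsTestFunction (spaceTime T Ω) (Φ j))
    (hdiv : ∀ z, ∑ i, fderiv ℝ (Φ i) z (0, planeBasis i) = 0) :
    ∃ K : Set Plane, IsCompact K ∧ K ⊆ Ω ∧ IsSolenoidalTest K Φ := by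
  choose K hK hKΩ h0 using fun j => (hΦ j).exists_compact
  refine ⟨⋃ j, K j, isCompact_iUnion hK, iUnion_subset hKΩ, fun j => (hΦ j).1, fun j => (hΦ j).2.1,
    fun j z hz => ?_, hdiv⟩
  exact image_eq_zero_of_notMem_tsupport (h0 j z fun h' => hz (mem_iUnion.2 ⟨j, h'⟩))

theorem lintegral_indicator_mul_sq {Ω K : Set Plane} (hK : IsCompact K) (hKΩ : K ⊆ Ω)
    (w : Plane → ℝ) :
    ∫⁻ x in Ω, ‖K.indicator (fun _ => (1 : ℝ)) x * w x‖ₑ ^ 2 = ∫⁻ x in K, ‖w x‖ₑ ^ 2 := by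
  have e : ∀ x, ‖K.indicator (fun _ => (1 : ℝ)) x * w x‖ₑ ^ 2
      = K.indicator (fun x => ‖w x‖ₑ ^ 2) x := fun x => by
    by_cases hx : x ∈ K <;> simp [hx]
  simp only [e]
  rw [lintegral_indicator hK.measurableSet, Measure.restrict_restrict hK.measurableSet,
    inter_eq_left.2 hKΩ]

namespace IsInviscidSequence

variable {Ω : Set Plane} {T : ℝ} {ν : ℕ → ℝ} {f : ℕ → Plane → Plane} {u : ℕ → ℝ → Plane → Plane}
  {om : ℕ → ℝ → Plane → ℝ} {finf : Plane → Plane} {uinf : ℝ → Plane → Plane} {E F : ℝ≥0}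
  (h : IsInviscidSequence Ω T ν f u om finf uinf E F)
include h

theorem convForm_limit {Φ : Fin 2 → ℝ × Plane → ℝ}
    (hΦ : ∀ j, IsTestFunction (spaceTime T Ω) (Φ j))
    (hdiv : ∀ z, ∑ i, fderiv ℝ (Φ i) z (0, planeBasis i) = 0) :
    Tendsto (fun n => ∑ i, ∑ j, ∫ z in spaceTime T Ω, u n z.1 z.2 i
      * (u n z.1 z.2 j * fderiv ℝ (Φ j) z (0, planeBasis i))) atTop
      (𝓝 (∑ i, ∑ j, ∫ z in spaceTime T Ω, uinf z.1 z.2 i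
      * (uinf z.1 z.2 j * fderiv ℝ (Φ j) z (0, planeBasis i)))) := by
  obtain ⟨K, hK, hKΩ, hS⟩ := exists_isSolenoidalTest hΦ hdiv
  obtain ⟨δ, χ, b, B, C, hδ, hχ, hχK, -, hb, -, -, -, -, hlim⟩ := h.exists_localized_limit hK hKΩ
  have e := convForm_localize hK
    (fun x hx => ⟨hKΩ hx, (hχK x hx).2 x (Metric.mem_ball_self hδ)⟩) hS hb
  rw [← e]
  exact hlim Φ hS

/-- The weak form of the Euler equations. -/
theorem euler {Φ : Fin 2 → ℝ × Plane → ℝ} (hΦ : ∀ j, IsTestFunction (spaceTime T Ω) (Φ j))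
    (hdiv : ∀ z, ∑ i, fderiv ℝ (Φ i) z (0, planeBasis i) = 0) :
    (∑ j, ∫ z in spaceTime T Ω, uinf z.1 z.2 j * fderiv ℝ (Φ j) z (1, 0))
      + (∑ i, ∑ j, ∫ z in spaceTime T Ω, uinf z.1 z.2 i
          * (uinf z.1 z.2 j * fderiv ℝ (Φ j) z (0, planeBasis i)))
      + ∑ j, ∫ z in spaceTime T Ω, finf z.2 j * Φ j z = 0 := by
  have hw := fun j => h.weak.component j
  have l1 := tendsto_finsetSum Finset.univ fun j _ => (hw j).2.2 _
    (((hΦ j).fderiv_apply (1, 0)).memLp (volume.restrict (spaceTime T Ω)) 2)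
  -- With both derivatives on `Φ` the viscous pairing converges, so its product with the vanishing
  -- viscosity tends to zero.
  have l2 := h.tendsto_visc.mul (tendsto_finsetSum Finset.univ fun j _ =>
    tendsto_finsetSum Finset.univ fun i _ => (hw j).2.2 _
      ((((hΦ j).fderiv_apply (0, planeBasis i)).fderiv_apply (0, planeBasis i)).memLp
        (volume.restrict (spaceTime T Ω)) 2))
  rw [zero_mul] at l2
  have l3 := h.convForm_limit hΦ hdiv
  have hf : ∀ j, WeakL2 (volume.restrict (spaceTime T Ω)) atTop (fun n z => f n z.2 j)
      (fun z => finf z.2 j) := fun j => by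
    rw [volume_restrict_spaceTime]
    exact (h.force.component j).comp_snd
  have l4 := tendsto_finsetSum Finset.univ fun j _ => (hf j).2.2 _
    ((hΦ j).memLp (volume.restrict (spaceTime T Ω)) 2)
  have key := ((l1.add l2).add l3).add l4
  rw [add_zero] at key
  refine tendsto_nhds_unique key (tendsto_const_nhds.congr fun n => ?_)
  have := (h.solution n).weak_form (h.memLp_force n) hΦ hdiv
  simp only [mul_comm (fderiv ℝ (Φ _) _ (1, 0))] at this ⊢
  rw [Finset.sum_comm (f := fun j i => ∫ z in spaceTime T Ω, u n z.1 z.2 i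
    * (u n z.1 z.2 j * fderiv ℝ (Φ j) z (0, planeBasis i)))] at this
  exact this.symm

theorem integral_div {φ : ℝ × Plane → ℝ} (hφ : IsTestFunction (spaceTime T Ω) φ) :
    ∑ i, ∫ z in spaceTime T Ω, uinf z.1 z.2 i * fderiv ℝ φ z (0, planeBasis i) = 0 := by
  have hm := fun i => (hφ.fderiv_apply (0, planeBasis i)).memLp (volume.restrict (spaceTime T Ω)) 2
  have l1 := tendsto_finsetSum Finset.univ fun i _ => (h.weak.component i).2.2 _ (hm i)
  refine tendsto_nhds_unique l1 (tendsto_const_nhds.congr fun n => ?_)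
  obtain ⟨ut, Du, D2u, p, Dp, -, -, -, hsl⟩ := (h.solution n).exists_slices (h.memLp_force n)
  have hu := fun i => ((h.weak.component i).1 n).integrable_mul_two (hm i)
  simp only [volume_restrict_spaceTime] at hu ⊢
  simp_rw [fun i => integral_prod _ (hu i)]
  rw [← integral_finsetSum _ fun i _ => (hu i).integral_prod_left]
  symm
  refine integral_eq_zero_of_ae ?_
  filter_upwards [hsl] with t ht
  have := ht.sum_integral_mul_fderiv (hφ.slice t)
  simp only [fun x i => fderiv_slice (z := (t, x)) (hφ.differentiable _) (planeBasis i)] at this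
  exact this

/-- The limit has bounded energy. -/
theorem energy_limit : ∃ C : ℝ≥0, ∀ᵐ t ∂volume.restrict (Ioo 0 T),
    ∫⁻ x in Ω, ‖uinf t x‖ₑ ^ 2 ≤ C := by
  have h1 : ∀ j, ∀ᵐ t ∂volume.restrict (Ioo 0 T),
      ∫⁻ x in Ω, ‖uinf t x j‖ₑ ^ 2 ≤ ((E ^ 2 : ℝ≥0) : ℝ≥0∞) := by
    intro j
    refine (h.weak_prod j).slice_bound fun n => ?_
    filter_upwards [ae_restrict_mem measurableSet_Ioo] with t ht
    rw [lintegral_enorm_sq_eq, ENNReal.coe_pow]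
    exact pow_le_pow_left₀ zero_le ((eLpNorm_component_le (u n t) j).trans
      (h.energy_le n t (Ioo_subset_Icc_self ht))) 2
  have hm := h.weak.2.1
  rw [volume_restrict_spaceTime] at hm
  refine ⟨E ^ 2 + E ^ 2, ?_⟩
  filter_upwards [h1 0, h1 1, MemLp.ae_slice (a := fun z : ℝ × Plane => uinf z.1 z.2) hm]
    with t h0 h1 h2
  have e : ∀ v : Plane, ‖v‖ₑ ^ 2 = ‖v 0‖ₑ ^ 2 + ‖v 1‖ₑ ^ 2 := by
    intro v
    have hn : ‖v‖₊ ^ 2 = ‖v 0‖₊ ^ 2 + ‖v 1‖₊ ^ 2 := by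
      ext
      push_cast
      rw [EuclideanSpace.norm_sq_eq, Fin.sum_univ_two]
    simp only [enorm_eq_nnnorm]
    exact_mod_cast hn
  simp only [e]
  rw [lintegral_add_left' ((h2.component 0).1.enorm.pow_const 2), ENNReal.coe_add]
  exact add_le_add h0 h1

/-- Existence of the limit vorticity, as a local weak limit. -/
theorem exists_vorticity_limit : ∃ ominf : ℝ → Plane → ℝ,
    (∀ K, IsCompact K → K ⊆ Ω →
      WeakL2 ((volume.restrict (Ioo 0 T)).prod (volume.restrict Ω)) (hyperfilter ℕ : Filter ℕ)
        (fun n z => K.indicator (fun _ => (1 : ℝ)) z.2 * om n z.1 z.2)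
        (fun z => K.indicator (fun _ => (1 : ℝ)) z.2 * ominf z.1 z.2)) ∧
    ∀ K, IsCompact K → K ⊆ Ω → ∃ C : ℝ≥0, ∀ t, ∫⁻ x in K, ‖ominf t x‖ₑ ^ 2 ≤ C := by
  classical
  set m := (volume.restrict (Ioo 0 T)).prod (volume.restrict Ω) with hmdef
  have homm : ∀ n, AEStronglyMeasurable (fun z : ℝ × Plane => om n z.1 z.2) m := fun n => by
    have := (h.vorticity n).1.aestronglyMeasurable
    rwa [volume_restrict_spaceTime] at this
  have hind : ∀ K, IsCompact K → Measurable
      (fun z : ℝ × Plane => K.indicator (fun _ => (1 : ℝ)) z.2) := fun K hK =>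
    (measurable_const.indicator hK.measurableSet).comp measurable_snd
  have hind1 : ∀ (K : Set Plane) (z : ℝ × Plane), |K.indicator (fun _ => (1 : ℝ)) z.2| ≤ 1 := by
    intro K z
    by_cases hz : z.2 ∈ K <;> simp [hz]
  have hbd : ∀ K, IsCompact K → K ⊆ Ω → ∃ C : ℝ≥0, ∀ n,
      eLpNorm (fun z : ℝ × Plane => K.indicator (fun _ => (1 : ℝ)) z.2 * om n z.1 z.2) 2 m ≤ C := by
    intro K hK hKΩ
    obtain ⟨C, hC⟩ := h.enstrophy K hK hKΩ
    obtain ⟨q, hq⟩ : ∃ q : ℝ≥0, volume.restrict (Ioo 0 T) univ = q :=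
      ⟨_, (ENNReal.coe_toNNReal (measure_ne_top (volume.restrict (Ioo 0 T)) univ)).symm⟩
    refine ⟨C * q + 1, fun n => ?_⟩
    refine eLpNorm_two_le_of_lintegral_le ?_
    have hm2 : AEStronglyMeasurable
        (fun z : ℝ × Plane => K.indicator (fun _ => (1 : ℝ)) z.2 * om n z.1 z.2) m :=
      (hind K hK).aestronglyMeasurable.mul (homm n)
    rw [hmdef, lintegral_prod _ (hm2.enorm.pow_const 2)]
    have h1 : ∫⁻ t, (∫⁻ x, ‖K.indicator (fun _ => (1 : ℝ)) x * om n t x‖ₑ ^ 2 ∂volume.restrict Ω)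
        ∂volume.restrict (Ioo 0 T) ≤ ∫⁻ _, (C : ℝ≥0∞) ∂volume.restrict (Ioo 0 T) := by
      refine lintegral_mono_ae ?_
      filter_upwards [hC n] with t ht
      rwa [lintegral_indicator_mul_sq hK hKΩ]
    refine h1.trans ?_
    rw [lintegral_const, hq]
    norm_cast
    have : (C * q + 1) ^ 2 = C * q + ((C * q) ^ 2 + C * q + 1) := by ring
    rw [this]
    exact le_self_add
  have hmem : ∀ K, IsCompact K → K ⊆ Ω → ∀ n,
      MemLp (fun z : ℝ × Plane => K.indicator (fun _ => (1 : ℝ)) z.2 * om n z.1 z.2) 2 m := by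
    intro K hK hKΩ n
    obtain ⟨C, hC⟩ := hbd K hK hKΩ
    exact ⟨(hind K hK).aestronglyMeasurable.mul (homm n), (hC n).trans_lt ENNReal.coe_lt_top⟩
  obtain ⟨K, hK, hKΩ, hKmono, hKex⟩ := exists_compact_exhaustion h.isOpen
  have hex : ∀ i, ∃ b, WeakL2 m (hyperfilter ℕ : Filter ℕ)
      (fun n z => (K i).indicator (fun _ => (1 : ℝ)) z.2 * om n z.1 z.2) b := by
    intro i
    obtain ⟨C, hC⟩ := hbd (K i) (hK i) (hKΩ i)
    exact exists_weakL2_hyperfilter (hmem _ (hK i) (hKΩ i)) hC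
  choose b hb using hex
  -- Local limits are glued by using at `x` the limit belonging to the first compact set that
  -- contains `x`. The pieces `K i` minus the earlier sets are disjoint and measurable; the default
  -- value 0 is taken only outside all `K i`, hence off `Ω`.
  let idx : Plane → ℕ := fun x => if hx : ∃ i, x ∈ K i then Nat.find hx else 0
  have hidx : ∀ i x, x ∈ K i → x ∈ K (idx x) ∧ idx x ≤ i := by
    intro i x hx
    have hx' : ∃ i, x ∈ K i := ⟨i, hx⟩
    simp only [idx, hx', dif_pos]
    exact ⟨Nat.find_spec hx', Nat.find_min' hx' hx⟩
  have hidxm : ∀ i, MeasurableSet {x : Plane | x ∈ K i ∧ idx x = i} := by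
    intro i
    have e : {x : Plane | x ∈ K i ∧ idx x = i} = K i \ ⋃ k ∈ Finset.range i, K k := by
      ext x
      simp only [mem_ofPred_eq, Set.mem_sdiff, mem_iUnion, Finset.mem_range, not_exists]
      constructor
      · rintro ⟨h1, h2⟩
        refine ⟨h1, fun k hk hxk => ?_⟩
        have := (hidx k x hxk).2
        omega
      · rintro ⟨h1, h2⟩
        refine ⟨h1, le_antisymm (hidx i x h1).2 ?_⟩
        by_contra! hc
        exact h2 _ hc (hidx i x h1).1
    rw [e]
    exact (hK i).measurableSet.diff
      (Finset.measurableSet_biUnion _ fun k _ => (hK k).measurableSet)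
  let om0 : ℝ → Plane → ℝ := fun t x => b (idx x) (t, x)
  have hweak : ∀ L, IsCompact L → L ⊆ Ω → WeakL2 m (hyperfilter ℕ : Filter ℕ)
      (fun n z => L.indicator (fun _ => (1 : ℝ)) z.2 * om n z.1 z.2)
      (fun z => L.indicator (fun _ => (1 : ℝ)) z.2 * om0 z.1 z.2) := by
    intro L hL hLΩ
    obtain ⟨N, hN⟩ := hKex L hL hLΩ
    have hterm : ∀ i, WeakL2 m (hyperfilter ℕ : Filter ℕ)
        (fun n z => ((K i).indicator (fun _ => (1 : ℝ)) z.2 * om n z.1 z.2)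
          * (L ∩ {x : Plane | x ∈ K i ∧ idx x = i}).indicator (fun _ => (1 : ℝ)) z.2)
        (fun z => b i z
          * (L ∩ {x : Plane | x ∈ K i ∧ idx x = i}).indicator (fun _ => (1 : ℝ)) z.2) := by
      intro i
      refine (hb i).mul_bdd (((measurable_const.indicator
        (hL.measurableSet.inter (hidxm i))).comp measurable_snd).aestronglyMeasurable)
        (C := 1) fun z => hind1 _ z
    -- On `L ⊆ K N` the index is at most `N`, so `N + 1` pieces suffice and the gluing reduces to a
    -- finite sum of weak limits.
    have hsum := WeakL2.finsetSum (Finset.range (N + 1)) fun i _ => hterm i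
    have e : ∀ (z : ℝ × Plane) (c : ℕ → ℝ), ∑ i ∈ Finset.range (N + 1),
        c i * (L ∩ {x : Plane | x ∈ K i ∧ idx x = i}).indicator (fun _ => (1 : ℝ)) z.2
        = L.indicator (fun _ => (1 : ℝ)) z.2 * c (idx z.2) := by
      intro z c
      by_cases hz : z.2 ∈ L
      · have h1 := hidx N z.2 (hN hz)
        rw [Finset.sum_eq_single (idx z.2)]
        · simp [hz, h1.1]
        · intro i _ hi
          rw [indicator_of_notMem fun h' => hi h'.2.2.symm, mul_zero]
        · intro h'
          exact absurd (Finset.mem_range.2 (Nat.lt_succ_of_le h1.2)) h'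
      · simp [hz]
    refine hsum.congr (fun n => ae_of_all _ fun z => ?_) (ae_of_all _ fun z => e z fun i => b i z)
    simp only
    rw [e z fun i => (K i).indicator (fun _ => (1 : ℝ)) z.2 * om n z.1 z.2]
    by_cases hz : z.2 ∈ L
    · rw [indicator_of_mem (hidx N z.2 (hN hz)).1, one_mul]
    · simp [hz]
  choose C hC using fun i => h.enstrophy (K i) (hK i) (hKΩ i)
  have hslice : ∀ᵐ t ∂volume.restrict (Ioo 0 T), ∀ i, ∫⁻ x in K i, ‖om0 t x‖ₑ ^ 2 ≤ C i := by
    refine ae_all_iff.2 fun i => ?_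
    have h1 := (hweak (K i) (hK i) (hKΩ i)).slice_bound (C := C i) fun n => by
      filter_upwards [hC i n] with t ht
      rwa [lintegral_indicator_mul_sq (hK i) (hKΩ i)]
    filter_upwards [h1] with t ht
    rwa [lintegral_indicator_mul_sq (hK i) (hKΩ i)] at ht
  -- Setting the function to zero on the null set of bad times gives the representative for which
  -- the enstrophy bounds hold at every time; countably many compact sets are enough to test.
  let ominf : ℝ → Plane → ℝ := fun t x =>
    if ∀ i, ∫⁻ x in K i, ‖om0 t x‖ₑ ^ 2 ≤ C i then om0 t x else 0
  refine ⟨ominf, fun L hL hLΩ => (hweak L hL hLΩ).congr (fun n => Filter.EventuallyEq.rfl) ?_,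
    fun L hL hLΩ => ?_⟩
  · filter_upwards [Measure.quasiMeasurePreserving_fst.ae hslice] with z hz
    simp only [ominf, if_pos hz]
  · obtain ⟨i, hi⟩ := hKex L hL hLΩ
    refine ⟨C i, fun t => ?_⟩
    by_cases ht : ∀ i, ∫⁻ x in K i, ‖om0 t x‖ₑ ^ 2 ≤ C i
    · simp only [ominf, if_pos ht]
      exact (lintegral_mono_set hi).trans (ht i)
    · simp [ominf, if_neg ht]

end IsInviscidSequence

end InviscidLimit

/-! ### Local integrability of the limit vorticity and its slicewise curl relation -/

section LimitVorticity

variable {Ω : Set Plane} {T : ℝ}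

theorem IsTestFunction.indicator_mul {φ : ℝ × Plane → ℝ} {K : Set Plane}
    (hK : ∀ z : ℝ × Plane, z.2 ∉ K → z ∉ tsupport φ) (z : ℝ × Plane) (a : ℝ) :
    (K.indicator (fun _ => (1 : ℝ)) z.2 * a) * φ z = φ z * a := by
  by_cases hz : z.2 ∈ K
  · simp [hz, mul_comm]
  · simp [hz, image_eq_zero_of_notMem_tsupport (hK z hz)]

theorem memLp_restrict_of_memLp_indicator {w : ℝ × Plane → ℝ}
    (hw : ∀ K, IsCompact K → K ⊆ Ω → MemLp (fun z => K.indicator (fun _ => (1 : ℝ)) z.2 * w z) 2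
      (volume.restrict (spaceTime T Ω))) {k : Set (ℝ × Plane)} (hk : IsCompact k)
    (hkΩ : k ⊆ spaceTime T Ω) : MemLp w 2 (volume.restrict k) := by
  have h1 := (hw (Prod.snd '' k) (hk.image continuous_snd)
    (by rintro _ ⟨z, hz, rfl⟩; exact (hkΩ hz).2)).mono_measure (Measure.restrict_mono hkΩ le_rfl)
  refine h1.ae_eq ?_
  filter_upwards [ae_restrict_mem hk.measurableSet] with z hz
  rw [indicator_of_mem (mem_image_of_mem _ hz), one_mul]

theorem locallyIntegrableOn_of_memLp_indicator (hΩ : IsOpen Ω) {w : ℝ × Plane → ℝ}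
    (hw : ∀ K, IsCompact K → K ⊆ Ω → MemLp (fun z => K.indicator (fun _ => (1 : ℝ)) z.2 * w z) 2
      (volume.restrict (spaceTime T Ω))) : LocallyIntegrableOn w (spaceTime T Ω) := by
  rw [locallyIntegrableOn_iff (isOpen_spaceTime hΩ).isLocallyClosed]
  intro k hkΩ hk
  have : IsFiniteMeasure (volume.restrict k) := ⟨by simpa using hk.measure_lt_top⟩
  exact (memLp_restrict_of_memLp_indicator hw hk hkΩ).integrable one_le_two

theorem locallyIntegrableOn_smul_of_memLp_indicator (hΩ : IsOpen Ω) {w : ℝ × Plane → ℝ}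
    (hw : ∀ K, IsCompact K → K ⊆ Ω → MemLp (fun z => K.indicator (fun _ => (1 : ℝ)) z.2 * w z) 2
      (volume.restrict (spaceTime T Ω))) {v : ℝ × Plane → Plane}
    (hv : MemLp v 2 (volume.restrict (spaceTime T Ω))) :
    LocallyIntegrableOn (fun z => w z • v z) (spaceTime T Ω) := by
  rw [locallyIntegrableOn_iff (isOpen_spaceTime hΩ).isLocallyClosed]
  intro k hkΩ hk
  exact memLp_one_iff_integrable.1 (MemLp.smul (p := 2) (q := 2) (r := 1)
    (hv.mono_measure (Measure.restrict_mono hkΩ le_rfl))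
    (memLp_restrict_of_memLp_indicator hw hk hkΩ))

theorem integral_localize_mul_spaceTime {χ : Plane → ℝ} {W v k : ℝ × Plane → ℝ}
    (hW : W =ᵐ[(volume.restrict (Ioo 0 T)).prod volume] fun z => χ z.2 * v z)
    (hk : ∀ z, k z ≠ 0 → z.2 ∈ Ω ∧ χ z.2 = 1) :
    ∫ z, W z * k z ∂((volume.restrict (Ioo 0 T)).prod volume)
      = ∫ z in spaceTime T Ω, v z * k z := by
  rw [volume_restrict_spaceTime_eq_restrict,
    ← setIntegral_eq_integral_of_forall_compl_eq_zero (s := univ ×ˢ Ω) fun z hz => by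
      by_cases h : k z = 0
      · simp [h]
      · exact absurd ⟨mem_univ _, (hk z h).1⟩ hz]
  refine integral_congr_ae (ae_restrict_of_ae ?_)
  filter_upwards [hW] with z hz
  by_cases h : k z = 0
  · simp [h]
  · rw [hz, (hk z h).2, one_mul]

/-- The curl of a localization, on almost every time slice. -/
theorem IsVorticity.ae_integral_curl {v : ℝ → Plane → Plane} {w : ℝ → Plane → ℝ}
    (hw : IsVorticity Ω T v w) {χ : Plane → ℝ} {b : Fin 2 → ℝ × Plane → ℝ}
    {W : ℝ × Plane → ℝ} (hb : ∀ j, MemLp (b j) 2 ((volume.restrict (Ioo 0 T)).prod volume))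
    (hbv : ∀ j, b j =ᵐ[(volume.restrict (Ioo 0 T)).prod volume] fun z => χ z.2 * v z.1 z.2 j)
    (hW : MemLp W 2 ((volume.restrict (Ioo 0 T)).prod volume))
    (hWw : W =ᵐ[(volume.restrict (Ioo 0 T)).prod volume] fun z => χ z.2 * w z.1 z.2)
    {U : Set Plane} (hU : ∀ y ∈ U, y ∈ Ω ∧ χ y = 1) {ψ : Plane → ℝ} (hψ : IsTestFunction U ψ) :
    ∀ᵐ t ∂volume.restrict (Ioo 0 T), (∫ y, b 1 (t, y) * fderiv ℝ ψ y (planeBasis 0))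
      - ∫ y, b 0 (t, y) * fderiv ℝ ψ y (planeBasis 1) = -∫ y, W (t, y) * ψ y := by
  have hd := fun i => hψ.fderiv_apply (planeBasis i)
  have hI : ∀ {a : ℝ × Plane → ℝ} {g : Plane → ℝ},
      MemLp a 2 ((volume.restrict (Ioo 0 T)).prod volume) → IsTestFunction U g →
      Integrable (fun z : ℝ × Plane => a z * g z.2) ((volume.restrict (Ioo 0 T)).prod volume) :=
    fun ha hg => ha.integrable_mul_two ((hg.memLp volume 2).comp_snd _)
  have i1 := (hI (hb 1) (hd 0)).integral_prod_left
  have i2 := (hI (hb 0) (hd 1)).integral_prod_left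
  have i3 := (hI hW hψ).integral_prod_left
  -- The space-time curl relation is tested with `θ(t)ψ(x)`; a function of time whose integral
  -- against every `θ` vanishes is zero almost everywhere.
  have key := ae_eq_zero_of_forall_test (T := T)
    (b := fun t => ((∫ y, b 1 (t, y) * fderiv ℝ ψ y (planeBasis 0))
      - ∫ y, b 0 (t, y) * fderiv ℝ ψ y (planeBasis 1)) + ∫ y, W (t, y) * ψ y)
    ((i1.sub i2).add i3) ?_
  · filter_upwards [key] with t ht
    linarith
  intro θ hθ
  obtain ⟨C, hC⟩ := hθ.exists_bound
  have hthm : AEStronglyMeasurable (fun z : ℝ × Plane => θ z.1)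
      ((volume.restrict (Ioo 0 T)).prod volume) :=
    (hθ.1.continuous.comp continuous_fst).aestronglyMeasurable
  have hF : ∀ {a : ℝ × Plane → ℝ} {g : Plane → ℝ} {q : ℝ × Plane → ℝ},
      MemLp a 2 ((volume.restrict (Ioo 0 T)).prod volume) → IsTestFunction U g →
      a =ᵐ[(volume.restrict (Ioo 0 T)).prod volume] (fun z => χ z.2 * q z) →
      IntegrableOn (fun t => θ t * ∫ y, a (t, y) * g y) (Ioo 0 T) volume ∧
      ∫ t in Ioo 0 T, θ t * ∫ y, a (t, y) * g y
        = ∫ z in spaceTime T Ω, q z * (θ z.1 * g z.2) := by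
    intro a g q ha hg haq
    have h1 : Integrable (fun z : ℝ × Plane => a z * (θ z.1 * g z.2))
        ((volume.restrict (Ioo 0 T)).prod volume) := by
      have := (ha.mul_bdd hthm fun z => hC z.1).integrable_mul_two
        ((hg.memLp volume 2).comp_snd (volume.restrict (Ioo 0 T)))
      simpa only [mul_assoc] using this
    have e : ∀ t, ∫ y, a (t, y) * (θ t * g y) = θ t * ∫ y, a (t, y) * g y := fun t => by
      rw [← integral_const_mul]
      exact integral_congr_ae (ae_of_all _ fun y => by ring)
    have h2 := h1.integral_prod_left
    simp only [e] at h2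
    refine ⟨h2, ?_⟩
    rw [← integral_localize_mul_spaceTime haq fun z hz => hU _ ?_, integral_prod _ h1]
    · simp only [e]
    · by_contra hn
      exact hz (by rw [hg.eq_zero hn, mul_zero])
  obtain ⟨j1, e1⟩ := hF (hb 1) (hd 0) (hbv 1)
  obtain ⟨j2, e2⟩ := hF (hb 0) (hd 1) (hbv 0)
  obtain ⟨j3, e3⟩ := hF hW hψ hWw
  simp only [mul_add, mul_sub]
  have j12 : IntegrableOn (fun t => θ t * (∫ y, b 1 (t, y) * fderiv ℝ ψ y (planeBasis 0))
      - θ t * ∫ y, b 0 (t, y) * fderiv ℝ ψ y (planeBasis 1)) (Ioo 0 T) volume := j1.sub j2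
  rw [integral_add j12 j3, integral_sub j1 j2, e1, e2, e3]
  have hvort := hw.2 _ (hθ.tprod (hψ.mono fun y hy => (hU y hy).1))
  simp only [fderiv_tprod hθ.differentiable hψ.differentiable, mul_zero, zero_mul, zero_add]
    at hvort
  have hv : ∀ j {g : Plane → ℝ}, IsTestFunction U g →
      IntegrableOn (fun z : ℝ × Plane => v z.1 z.2 j * (θ z.1 * g z.2)) (spaceTime T Ω) volume := by
    intro j g hg
    have h1 : Integrable (fun z : ℝ × Plane => b j z * (θ z.1 * g z.2))
        ((volume.restrict (Ioo 0 T)).prod volume) := by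
      have := ((hb j).mul_bdd hthm fun z => hC z.1).integrable_mul_two
        ((hg.memLp volume 2).comp_snd (volume.restrict (Ioo 0 T)))
      simpa only [mul_assoc] using this
    rw [IntegrableOn, volume_restrict_spaceTime_eq_restrict]
    refine (h1.restrict (s := univ ×ˢ Ω)).congr (ae_restrict_of_ae ?_)
    filter_upwards [hbv j] with z hz
    by_cases hg0 : g z.2 = 0
    · simp [hg0]
    · rw [hz, (hU z.2 (by_contra fun hn => hg0 (hg.eq_zero hn))).2, one_mul]
  have e4 : ∫ z in spaceTime T Ω, (θ z.1 * fderiv ℝ ψ z.2 (planeBasis 0) * v z.1 z.2 1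
      - θ z.1 * fderiv ℝ ψ z.2 (planeBasis 1) * v z.1 z.2 0)
      = (∫ z in spaceTime T Ω, v z.1 z.2 1 * (θ z.1 * fderiv ℝ ψ z.2 (planeBasis 0)))
        - ∫ z in spaceTime T Ω, v z.1 z.2 0 * (θ z.1 * fderiv ℝ ψ z.2 (planeBasis 1)) := by
    rw [← integral_sub (hv 1 (hd 0)) (hv 0 (hd 1))]
    exact integral_congr_ae (ae_of_all _ fun z => by ring)
  have e5 : ∫ z in spaceTime T Ω, w z.1 z.2 * (θ z.1 * ψ z.2)
      = ∫ z in spaceTime T Ω, θ z.1 * ψ z.2 * w z.1 z.2 :=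
    integral_congr_ae (ae_of_all _ fun z => by ring)
  rw [e5, hvort, e4]
  ring

end LimitVorticity

/-! ### Equations satisfied by the limit -/

section LimitEquations

namespace IsInviscidSequence

variable {Ω : Set Plane} {T : ℝ} {ν : ℕ → ℝ} {f : ℕ → Plane → Plane} {u : ℕ → ℝ → Plane → Plane}
  {om : ℕ → ℝ → Plane → ℝ} {finf : Plane → Plane} {uinf : ℝ → Plane → Plane} {E F : ℝ≥0}
  (h : IsInviscidSequence Ω T ν f u om finf uinf E F)
include h

/-- The distributional curl is linear and passes to weak limits. Vorticities converge along
`hyperfilter ℕ` and velocities along `atTop`; the former filter is finer, so both limits may be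
compared along it. -/
theorem isVorticity_limit {ominf : ℝ → Plane → ℝ} (hom : ∀ K, IsCompact K → K ⊆ Ω →
      WeakL2 (volume.restrict (spaceTime T Ω)) (hyperfilter ℕ : Filter ℕ)
        (fun n z => K.indicator (fun _ => (1 : ℝ)) z.2 * om n z.1 z.2)
        (fun z => K.indicator (fun _ => (1 : ℝ)) z.2 * ominf z.1 z.2)) :
    IsVorticity Ω T uinf ominf := by
  refine ⟨locallyIntegrableOn_of_memLp_indicator h.isOpen fun K hK hKΩ => (hom K hK hKΩ).2.1,
    fun φ hφ => ?_⟩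
  obtain ⟨K, hK, hKΩ, h0⟩ := hφ.exists_compact
  have hφm := hφ.memLp (volume.restrict (spaceTime T Ω)) 2
  have hdm := fun i => (hφ.fderiv_apply (0, planeBasis i)).memLp (volume.restrict (spaceTime T Ω)) 2
  have l1 := (hom K hK hKΩ).2.2 _ hφm
  simp only [IsTestFunction.indicator_mul h0] at l1
  have l2 := (((h.weak.component 1).2.2 _ (hdm 0)).sub
    ((h.weak.component 0).2.2 _ (hdm 1))).neg.mono_left Nat.hyperfilter_le_atTop
  have e : ∀ v : ℝ × Plane → Plane, MemLp v 2 (volume.restrict (spaceTime T Ω)) →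
      -((∫ z in spaceTime T Ω, v z 1 * fderiv ℝ φ z (0, planeBasis 0))
        - ∫ z in spaceTime T Ω, v z 0 * fderiv ℝ φ z (0, planeBasis 1))
      = -∫ z in spaceTime T Ω, (fderiv ℝ φ z (0, planeBasis 0) * v z 1
          - fderiv ℝ φ z (0, planeBasis 1) * v z 0) := fun v hv => by
    rw [← integral_sub ((hv.component 1).integrable_mul_two (hdm 0))
      ((hv.component 0).integrable_mul_two (hdm 1))]
    simp only [mul_comm (v _ _)]
  rw [← e _ h.weak.2.1]
  refine tendsto_nhds_unique l1 (l2.congr fun n => ?_)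
  rw [(h.vorticity n).2 φ hφ]
  exact e _ (h.weak.1 n)

theorem isWeakEuler : IsWeakEuler Ω T finf uinf := by
  have hu := h.weak.2.1
  have hf : MemLp (fun z : ℝ × Plane => finf z.2) 2 (volume.restrict (spaceTime T Ω)) := by
    rw [volume_restrict_spaceTime]
    exact h.force.2.1.comp_snd _
  have hsum : ∀ {G : Type} [NormedAddCommGroup G] [NormedSpace ℝ G] (L : ℝ × Plane →L[ℝ] G)
      (v : Plane), L (0, v) = ∑ i, v i • L (0, planeBasis i) := by
    intro G _ _ L v
    have : ((0 : ℝ), v) = ∑ i, v i • ((0 : ℝ), planeBasis i) := by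
      refine Prod.ext (by simp) ?_
      ext j
      fin_cases j <;> simp [planeBasis]
    conv_lhs => rw [this]
    simp only [map_sum, map_smul]
  refine ⟨hu, fun φ hφ => ?_, fun Φ hΦ hdiv => ?_⟩
  · have hdm := fun i =>
      (hφ.fderiv_apply (0, planeBasis i)).memLp (volume.restrict (spaceTime T Ω)) 2
    simp only [fun z : ℝ × Plane => hsum (fderiv ℝ φ z) (uinf z.1 z.2), smul_eq_mul]
    rw [integral_finsetSum _ fun i _ => (hu.component i).integrable_mul_two (hdm i)]
    exact h.integral_div hφ
  · have hc := fun j => hΦ.component j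
    have hd : ∀ z v j, fderiv ℝ (fun z => Φ z j) z v = fderiv ℝ Φ z v j := fun z v j =>
      fderiv_component (hΦ.differentiable z) v j
    have key := h.euler hc fun z => by simpa only [hd] using hdiv z
    have hm0 := fun j => (hc j).memLp (volume.restrict (spaceTime T Ω)) 2
    have hm1 := fun j => ((hc j).fderiv_apply (1, 0)).memLp (volume.restrict (spaceTime T Ω)) 2
    have i1 := fun j => (hu.component j).integrable_mul_two (hm1 j)
    have i2 := fun i j => (hu.component i).integrable_mul_two (((hu.component j).mul_bdd
      ((hc j).fderiv_apply (0, planeBasis i)).1.continuous.aestronglyMeasurable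
      ((hc j).fderiv_apply (0, planeBasis i)).exists_bound.choose_spec))
    have i3 := fun j => (hf.component j).integrable_mul_two (hm0 j)
    simp only [hd] at key i1 i2
    rw [← integral_finsetSum _ fun j _ => i1 j, ← integral_finsetSum _ fun j _ => i3 j] at key
    simp_rw [fun i => (integral_finsetSum Finset.univ fun j _ => i2 i j).symm] at key
    rw [← integral_finsetSum _ fun i _ => integrable_finsetSum _ fun j _ => i2 i j] at key
    have j1 := integrable_finsetSum Finset.univ fun j _ => i1 j
    have j2 := integrable_finsetSum Finset.univ fun i _ =>
      integrable_finsetSum Finset.univ fun j _ => i2 i j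
    have j3 := integrable_finsetSum Finset.univ fun j _ => i3 j
    have j12 : Integrable (fun z : ℝ × Plane => (∑ i, uinf z.1 z.2 i * fderiv ℝ Φ z (1, 0) i)
        + ∑ i, ∑ j, uinf z.1 z.2 i * (uinf z.1 z.2 j * fderiv ℝ Φ z (0, planeBasis i) j))
        (volume.restrict (spaceTime T Ω)) := j1.add j2
    rw [← integral_add j1 j2, ← integral_add j12 j3] at key
    refine Eq.trans (integral_congr_ae (ae_of_all _ fun z => ?_)) key
    simp only [hsum (fderiv ℝ Φ z) (uinf z.1 z.2), PiLp.inner_apply, Fin.sum_univ_two,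
      RCLike.inner_apply, conj_trivial,
      PiLp.add_apply, PiLp.smul_apply, smul_eq_mul]
    ring

/-- The Euler equations are tested with `Φ = ∇^⊥φ = (-∂₂φ, ∂₁φ)`. Integrating by parts, velocity and
force turn into their curls, while `u₀Φ₁ - u₁Φ₀ = u·∇φ` turns the quadratic form into the transport
term. Every term acquires the same minus sign. -/
theorem isWeakEulerVorticity {Dfinf : Fin 2 → Plane → Plane} (hDf : MemH1 Ω finf Dfinf)
    {ominf : ℝ → Plane → ℝ} (hv : IsVorticity Ω T uinf ominf)
    (hom : ∀ K, IsCompact K → K ⊆ Ω →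
      MemLp (fun z => K.indicator (fun _ => (1 : ℝ)) z.2 * ominf z.1 z.2) 2
        (volume.restrict (spaceTime T Ω))) :
    IsWeakEulerVorticity Ω T (fun x => Dfinf 0 x 1 - Dfinf 1 x 0) uinf ominf := by
  have hu := h.weak.2.1
  refine ⟨hv.1, locallyIntegrableOn_smul_of_memLp_indicator h.isOpen hom hu, fun φ hφ => ?_⟩
  have hd := fun i => hφ.fderiv_apply (0, planeBasis i)
  have ht := hφ.fderiv_apply (1, 0)
  have hcomm := fun z v w => fderiv_fderiv_comm (contDiff_infty.1 hφ.1 2) z v w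
  have hneg : ∀ z v, fderiv ℝ (fun z => -fderiv ℝ φ z (0, planeBasis 1)) z v
      = -fderiv ℝ (fun z => fderiv ℝ φ z (0, planeBasis 1)) z v := fun z v => by
    rw [fderiv_fun_neg]
    rfl
  obtain ⟨Φ, hΦ0, hΦ1⟩ : ∃ Φ : Fin 2 → ℝ × Plane → ℝ,
      Φ 0 = (fun z => -fderiv ℝ φ z (0, planeBasis 1)) ∧
      Φ 1 = fun z => fderiv ℝ φ z (0, planeBasis 0) := ⟨![_, _], rfl, rfl⟩
  have hΦ : ∀ j, IsTestFunction (spaceTime T Ω) (Φ j) := by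
    intro j
    fin_cases j
    · simp only [Fin.zero_eta, hΦ0]; exact (hd 1).neg
    · simp only [Fin.mk_one, hΦ1]; exact hd 0
  have hdiv : ∀ z, ∑ i, fderiv ℝ (Φ i) z (0, planeBasis i) = 0 := by
    intro z
    rw [Fin.sum_univ_two, hΦ0, hΦ1, hneg, hcomm z (0, planeBasis 1) (0, planeBasis 0)]
    ring
  have hφm := hφ.memLp (volume.restrict (spaceTime T Ω)) 2
  have hdm := fun i => (hd i).memLp (volume.restrict (spaceTime T Ω)) 2
  -- the time derivative
  have e1 : ∑ j, ∫ z in spaceTime T Ω, uinf z.1 z.2 j * fderiv ℝ (Φ j) z (1, 0)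
      = -∫ z in spaceTime T Ω, ominf z.1 z.2 * fderiv ℝ φ z (1, 0) := by
    have h1 := hv.2 _ ht
    have hm := fun i => ((hd i).fderiv_apply (1, 0)).memLp (volume.restrict (spaceTime T Ω)) 2
    simp only [hcomm _ (1, 0), mul_comm _ (ominf _ _)] at h1
    rw [h1, neg_neg, Fin.sum_univ_two, hΦ0, hΦ1,
      integral_sub ((hm 0).integrable_mul_two (hu.component 1))
      ((hm 1).integrable_mul_two (hu.component 0))]
    simp only [hneg, mul_neg, integral_neg]
    simp only [mul_comm (uinf _ _ _)]
    ring
  -- the force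
  have e3 : ∑ j, ∫ z in spaceTime T Ω, finf z.2 j * Φ j z
      = -∫ z in spaceTime T Ω, (Dfinf 0 z.2 1 - Dfinf 1 z.2 0) * φ z := by
    rw [volume_restrict_spaceTime] at hφm hdm ⊢
    have hf : MemLp (fun z : ℝ × Plane => finf z.2) 2
        ((volume.restrict (Ioo 0 T)).prod (volume.restrict Ω)) := hDf.1.comp_snd _
    have hDf2 : ∀ i, MemLp (fun z : ℝ × Plane => Dfinf i z.2) 2
        ((volume.restrict (Ioo 0 T)).prod (volume.restrict Ω)) := fun i => (hDf.2 i).1.comp_snd _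
    have hij : ∀ i j, ∫ z, finf z.2 j * fderiv ℝ φ z (0, planeBasis i)
          ∂(volume.restrict (Ioo 0 T)).prod (volume.restrict Ω)
        = -∫ z, Dfinf i z.2 j * φ z ∂(volume.restrict (Ioo 0 T)).prod (volume.restrict Ω) := by
      intro i j
      rw [integral_prod _ ((hf.component j).integrable_mul_two (hdm i)),
        integral_prod _ (((hDf2 i).component j).integrable_mul_two hφm), ← integral_neg]
      refine integral_congr_ae (ae_of_all _ fun t => ?_)
      have := (hDf.2 i).2.integral_component hDf.1 (hDf.2 i).1 (hφ.slice t) j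
      simp only [fun x => fderiv_slice (z := (t, x)) (hφ.differentiable _) (planeBasis i),
        mul_comm _ (finf _ _), mul_comm _ (Dfinf _ _ _)] at this
      exact this
    simp only [sub_mul]
    rw [Fin.sum_univ_two, hΦ0, hΦ1, integral_sub (((hDf2 0).component 1).integrable_mul_two hφm)
      (((hDf2 1).component 0).integrable_mul_two hφm)]
    simp only [mul_neg, integral_neg]
    rw [hij, hij]
    ring
  -- the convective term
  have e2 : ∑ i, ∑ j, ∫ z in spaceTime T Ω, uinf z.1 z.2 i
        * (uinf z.1 z.2 j * fderiv ℝ (Φ j) z (0, planeBasis i))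
      = -∫ z in spaceTime T Ω, ominf z.1 z.2 * fderiv ℝ φ z (0, uinf z.1 z.2) := by
    obtain ⟨K, hK, hKΩ, hS⟩ := exists_isSolenoidalTest hΦ hdiv
    obtain ⟨δ, χ, b, B, C, hδ, hχ, hχK, hbm, hbv, hb, hB, hC, hbdiv, -⟩ :=
      h.exists_localized_limit hK hKΩ
    -- The vorticity is localized by the same `χ`. It is square integrable on the support of `χ`,
    -- and the indicator of that support becomes redundant after multiplication by `χ`.
    have hL := hom _ hχ.2.1 hχ.2.2
    obtain ⟨W, hWm, hW⟩ := exists_stronglyMeasurable_localization h.isOpen hχ hL.1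
    have hW2 := (memLp_localize h.isOpen hχ hL).ae_eq hW.symm
    have hWw : W =ᵐ[(volume.restrict (Ioo 0 T)).prod volume] fun z => χ z.2 * ominf z.1 z.2 := by
      filter_upwards [hW] with z hz
      rw [hz]
      by_cases hz2 : z.2 ∈ tsupport χ
      · simp [hz2]
      · simp [image_eq_zero_of_notMem_tsupport hz2]
    have hKχ : ∀ x ∈ K, x ∈ Ω ∧ χ x = 1 := fun x hx =>
      ⟨hKΩ hx, (hχK x hx).2 x (Metric.mem_ball_self hδ)⟩
    rw [← convForm_localize hK hKχ hS hbv, convForm_eq_neg_integral_curl hK hδ hbm hb hB hC hbdiv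
      hWm hW2 (fun x hx ψ hψ => hv.ae_integral_curl hb hbv hW2 hWw
        (fun y hy => ⟨(hχK x hx).1 hy, (hχK x hx).2 y hy⟩) hψ) hS]
    have e : (fun z => W z * (b 0 z * Φ 1 z - b 1 z * Φ 0 z))
        =ᵐ[(volume.restrict (Ioo 0 T)).prod volume]
        fun z => W z * (uinf z.1 z.2 0 * Φ 1 z - uinf z.1 z.2 1 * Φ 0 z) := by
      filter_upwards [hbv 0, hbv 1] with z h0 h1
      by_cases hz : z.2 ∈ K
      · rw [h0, h1, (hKχ _ hz).2, one_mul, one_mul]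
      · simp [hS.eq_zero _ z hz]
    rw [integral_congr_ae e, integral_localize_mul_spaceTime hWw fun z hz => hKχ _ ?_]
    · congr 1
      refine integral_congr_ae (ae_of_all _ fun z => ?_)
      simp only [← fderiv_slice (hφ.differentiable z), hΦ0, hΦ1, fderiv_eq_sum _ z.2 (uinf _ _),
        Fin.sum_univ_two]
      ring
    · by_contra hn
      exact hz (by simp [hS.eq_zero _ z hn])
  have key := h.euler hΦ hdiv
  rw [e1, e2, e3] at key
  obtain ⟨K, hK, hKΩ, h0⟩ := hφ.exists_compact
  have hωm := hom K hK hKΩ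
  have hK0 : ∀ (v : ℝ × Plane) (z : ℝ × Plane), z.2 ∉ K → fderiv ℝ φ z v = 0 := fun v z hz =>
    image_eq_zero_of_notMem_tsupport (f := fun z => fderiv ℝ φ z v) fun h' =>
      h0 z hz (tsupport_fderiv_apply_subset ℝ v h')
  have hω : ∀ {g : ℝ × Plane → ℝ}, MemLp g 2 (volume.restrict (spaceTime T Ω)) →
      (∀ z, z.2 ∉ K → g z = 0) →
      Integrable (fun z => ominf z.1 z.2 * g z) (volume.restrict (spaceTime T Ω)) := by
    intro g hg hg0
    refine (hωm.integrable_mul_two hg).congr (ae_of_all _ fun z => ?_)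
    by_cases hz : z.2 ∈ K
    · simp [hz]
    · simp [hg0 z hz]
  have i1 := hω (ht.memLp _ 2) (hK0 _)
  have i2 : Integrable (fun z : ℝ × Plane => ominf z.1 z.2 * fderiv ℝ φ z (0, uinf z.1 z.2))
      (volume.restrict (spaceTime T Ω)) := by
    refine hω ?_ fun z => hK0 _ z
    have := fun i => (hu.component i).mul_bdd (hd i).1.continuous.aestronglyMeasurable
      (hd i).exists_bound.choose_spec
    refine ((this 0).add (this 1)).ae_eq (ae_of_all _ fun z => ?_)
    simp only [Pi.add_apply, ← fderiv_slice (hφ.differentiable z), fderiv_eq_sum _ z.2 (uinf _ _),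
      Fin.sum_univ_two]
  have i3 : Integrable (fun z : ℝ × Plane => (Dfinf 0 z.2 1 - Dfinf 1 z.2 0) * φ z)
      (volume.restrict (spaceTime T Ω)) := by
    rw [volume_restrict_spaceTime] at hφm ⊢
    exact ((((hDf.2 0).1.component 1).sub ((hDf.2 1).1.component 0)).comp_snd _).integrable_mul_two
      hφm
  have i12 : Integrable (fun z : ℝ × Plane => ominf z.1 z.2 * fderiv ℝ φ z (1, 0)
      + ominf z.1 z.2 * fderiv ℝ φ z (0, uinf z.1 z.2)) (volume.restrict (spaceTime T Ω)) :=
    i1.add i2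
  rw [integral_add i12 i3, integral_add i1 i2]
  linarith

end IsInviscidSequence

end LimitEquations
-- The inviscid limit theorem
theorem theorem1
    -- a bounded open set with smooth boundary, and a finite time
    (Ω : Set Plane) (hΩ : IsOpen Ω) (hΩb : Bornology.IsBounded Ω) (hΩs : HasSmoothBoundary Ω)
    (T : ℝ) (hT : 0 < T)
    -- vanishing viscosities
    (ν : ℕ → ℝ) (hν : ∀ n, 0 < ν n) (hν0 : Tendsto ν atTop (𝓝 0))
    -- forces, bounded in `H¹` and weakly convergent in `H¹`
    (f : ℕ → Plane → Plane) (Df : ℕ → Fin 2 → Plane → Plane)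
    (finf : Plane → Plane) (Dfinf : Fin 2 → Plane → Plane)
    (hfb : ∃ M : ℝ≥0, ∀ n, h1NormSq Ω (f n) (Df n) ≤ M)
    (hf : WeakTendstoH1 Ω f Df finf Dfinf)
    -- strong solutions of the Navier–Stokes equations
    (u : ℕ → ℝ → Plane → Plane)
    (hu : ∀ n, IsStrongNavierStokes Ω T (ν n) (f n) (u n))
    -- initial data, divergence-free and bounded in `H¹₀`
    (Du0 : ℕ → Fin 2 → Plane → Plane)
    (hu0 : ∀ n, MemH10 Ω (u n 0) (Du0 n))
    (hu0div : ∀ n, ∀ᵐ x ∂volume.restrict Ω, ∑ i, Du0 n i x i = 0)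
    (hu0b : ∃ M : ℝ≥0, ∀ n, h1NormSq Ω (u n 0) (Du0 n) ≤ M)
    -- vorticities, with local enstrophy bounds uniform in the viscosity
    (om : ℕ → ℝ → Plane → ℝ) (hom : ∀ n, IsVorticity Ω T (u n) (om n))
    (hloc : ∀ K : Set Plane, IsCompact K → K ⊆ Ω → ∃ C : ℝ≥0, ∀ n,
      ∀ᵐ t ∂volume.restrict (Ioo 0 T), ∫⁻ x in K, ‖om n t x‖ₑ ^ 2 ≤ C)
    -- a weak limit in `L²(0,T; L²(Ω))` of the sequence, or of a subsequence
    (κ : ℕ → ℕ) (hκ : StrictMono κ) (uinf : ℝ → Plane → Plane)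
    (hlim : WeakTendstoL2 (spaceTime T Ω) (fun n z => u (κ n) z.1 z.2)
      (fun z => uinf z.1 z.2)) :
    -- the limit is a weak solution of the Euler equations
    IsWeakEuler Ω T finf uinf ∧
    -- with bounded energy
    (∃ C : ℝ≥0, ∀ᵐ t ∂volume.restrict (Ioo 0 T), ∫⁻ x in Ω, ‖uinf t x‖ₑ ^ 2 ≤ C) ∧
    -- whose vorticity solves the vorticity equation and obeys local enstrophy bounds
    ∃ ominf : ℝ → Plane → ℝ, IsVorticity Ω T uinf ominf ∧
      IsWeakEulerVorticity Ω T (fun x => Dfinf 0 x 1 - Dfinf 1 x 0) uinf ominf ∧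
      ∀ K : Set Plane, IsCompact K → K ⊆ Ω → ∃ C : ℝ≥0,
        ∀ t ∈ Icc 0 T, ∫⁻ x in K, ‖ominf t x‖ₑ ^ 2 ≤ C := by
  obtain ⟨Mf, hMf⟩ := hfb
  obtain ⟨Mu, hMu⟩ := hu0b
  -- A bound `M` on the squared `H¹` norm gives the `L²` bound `M + 1`, since `M ≤ (M + 1)²`.
  have hbd : ∀ {v : Plane → Plane} {Dv : Fin 2 → Plane → Plane} {M : ℝ≥0}, h1NormSq Ω v Dv ≤ M →
      eLpNorm v 2 (volume.restrict Ω) ≤ ((M + 1 : ℝ≥0) : ℝ≥0∞) := by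
    intro v Dv M hM
    refine (ENNReal.pow_le_pow_left_iff two_ne_zero).1 ((le_self_add.trans hM).trans ?_)
    rw [← ENNReal.coe_pow, ENNReal.coe_le_coe]
    have : (M + 1) ^ 2 = M + (M ^ 2 + M + 1) := by ring
    exact this ▸ le_self_add
  -- Re-indexing by `κ` absorbs the subsequence. The energy constant is `a + 2TF` from the energy
  -- estimate, with `a = Mu + 1` for the initial data and `F = Mf + 1` for the forces.
  have hseq : IsInviscidSequence Ω T (fun n => ν (κ n)) (fun n => f (κ n)) (fun n => u (κ n))
      (fun n => om (κ n)) finf uinf (Mu + 1 + 2 * T.toNNReal * (Mf + 1)) (Mf + 1) :=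
    { isOpen := hΩ
      tendsto_visc := hν0.comp hκ.tendsto_atTop
      solution := fun n => hu (κ n)
      memLp_force := fun n => (hf.1 (κ n)).1
      force_le := fun n => hbd (hMf (κ n))
      energy_le := fun n t ht => (hu (κ n)).eLpNorm_le hΩ (hν (κ n)).le (hf.1 (κ n)).1
        (hbd (hMu (κ n))) (hbd (hMf (κ n))) ht
      force := ⟨fun n => (hf.1 (κ n)).1, hf.2.1.1, fun g hg =>
        (hf.2.2.1.2.2 g hg).comp hκ.tendsto_atTop⟩
      weak := hlim
      vorticity := fun n => hom (κ n)
      enstrophy := fun K hK hKΩ => (hloc K hK hKΩ).imp fun C hC n => hC (κ n) }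
  obtain ⟨ominf, hweak, hK⟩ := hseq.exists_vorticity_limit
  rw [← volume_restrict_spaceTime] at hweak
  have hvort := hseq.isVorticity_limit hweak
  exact ⟨hseq.isWeakEuler, hseq.energy_limit, ominf, hvort,
    hseq.isWeakEulerVorticity hf.2.1 hvort fun K hK hKΩ => (hweak K hK hKΩ).2.1,
    fun K hKc hKΩ => (hK K hKc hKΩ).imp fun C hC t _ => hC t⟩
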